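/- **Setting.** Fix $d\ge 1$. $\mathcal D$ is the space of smooth compactly supported functions on $\mathbb R^d$; $\varphi_x^\lambda(\cdot)=\lambda^{-d}\varphi(\lambda^{-1}(\cdot-x))$; $\mathscr B^r$ is the set of $\varphi\in\mathcal D$ supported in the closed unit ball with $\|\partial^k\varphi\|_\infty\le1$ for $|k|\le r$. For a family $F=(F_x)_{x\in\mathbb R^d}$ of linear functionals on $\mathcal D$ (in particular of distributions), $K\subset\mathbb R^d$ and $\Lambda>0$ put $$\|F\|_{\hom;K,\Lambda,r}^{a}=\sup\{\lambda^{-a}|F_x(\varphi_x^\lambda)| : x\in K,\ 0<\lambda\le\Lambda,\ \varphi\in\mathscr B^r\}\in[0,\infty];$$ $F$ is $a$-homogeneous of order $r$ if this is finite for every compact $K$ and every $\Lambda\ge1$. *Kernel.* Let $\beta,\rho>0$, $m,r\in\mathbb N_0$, and let $\mathsf K=\sum_{n\ge0}\mathsf K_n$ (a.e. on $\mathbb R^d\times\mathbb R^d$) be a $\beta$-regularising kernel of order $(m,r)$ with range $\rho$: $\mathsf K_n$ is of class $C^{m,r}$, $\mathsf K_n(x,y)=0$ if $|x-y|>\rho2^{-n}$,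 and for each compact $K$ there is $c_K$ with $|\partial_1^k\partial_2^l\mathsf K_n(x,y)|\le c_K2^{(d-\beta+|l|+|k|)n}$ for $x,y\in K$, $|k|\le m$, $|l|\le r$, and $|\int(y-x)^l\partial_2^k\mathsf K_n(x,y)\,dx|\le c_K2^{-\beta n}$ for $y\in K$, $|k|,|l|\le r$. For a distribution $f$ of order $r$ (extended canonically to compactly supported $C^r$ functions), $\mathsf Kf(\psi)=\sum_n f(\mathsf K_n^*\psi)$ with $\mathsf K_n^*\psi(y)=\int\psi(x)\mathsf K_n(x,y)\,dx$. *Model.* Let $I$ be a finite set and $\boldsymbol\alpha=(\alpha_i)_{i\in I}$ real numbers. A model $(\Pi,\Gamma)$ with homogeneities $\boldsymbol\alpha$ and order $r_\Pi$ consists of families of distributions $\Pi^i=(\Pi^i_x)_x$, with $x\mapsto\Pi^i_x(\varphi)$ measurable, that are $\alpha_i$-homogeneous of order $r_\Pi$, and of real numbers $\Gamma^{ji}_{xy}$ with $\Pi^i_y=\sum_j\Pi^j_x\Gamma^{ji}_{xy}$ for all $i,x,y$. It is *compatible* with $\mathsf K$ if $(D^k(\mathsf K\Pi^i_x))_x$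 is $0$-homogeneous of some order whenever $|k|=\alpha_i+\beta$. Put $\|\Pi\|_{K,\Lambda}=\max_i\|\Pi^i\|^{\alpha_i}_{\hom;K,\Lambda,r_\Pi}$ and $[\mathsf K\Pi]_{K,\Lambda}=\sum_i\sum_{|k|=\alpha_i+\beta}\|D^k(\mathsf K\Pi^i)\|^0_{\hom;K,\Lambda,r_\Pi}$. *Assumptions.* $\gamma\in\mathbb R$ satisfies $\gamma>\alpha_i$ for all $i$, $\gamma+\beta\notin\mathbb N_0$, $m>\gamma+\beta$, and $r\ge r_\Pi$; the model is compatible with $\mathsf K$. *New coefficients.* Let $\mathrm{poly}(t)=\{k\in\mathbb N_0^d:|k|<t\}$, $\hat I=I\sqcup\mathrm{poly}(\gamma+\beta)$, $\hat\alpha_i=\alpha_i+\beta$ for $i\in I$, and $\hat\alpha_k=|k|$ for $k\in\mathrm{poly}(\gamma+\beta)$. For $|k|<\alpha_i+\beta$ let $D^k(\mathsf K\Pi^i_x)(x)=\lim_{\lambda\downarrow0}D^k(\mathsf K\Pi^i_x)(\eta_x^\lambda)$, for any $\eta\in\mathcal D$ with $\int\eta=1$ and $\int\eta(z)z^l\,dz=0$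 for $1\le|l|<\alpha_i+\beta$. Let $(\Gamma^{\mathrm{poly}})^{lk}_{xy}=\frac{(x-y)^{k-l}}{(k-l)!}$ if $l\le k$ and $0$ otherwise. Define $\hat\Gamma^{ji}_{xy}=\Gamma^{ji}_{xy}$ for $i,j\in I$; $\hat\Gamma^{jk}_{xy}=0$ for $j\in I$, $k\in\mathrm{poly}(\gamma+\beta)$; $\hat\Gamma^{lk}_{xy}=(\Gamma^{\mathrm{poly}})^{lk}_{xy}$ for $l,k\in\mathrm{poly}(\gamma+\beta)$; and, for $l\in\mathrm{poly}(\gamma+\beta)$, $i\in I$, $$\hat\Gamma^{li}_{xy}=\sum_{j:\,\alpha_j+\beta>|l|}D^l(\mathsf K\Pi^j_x)(x)\,\Gamma^{ji}_{xy}-\sum_{k\in\mathrm{poly}(\alpha_i+\beta)}(\Gamma^{\mathrm{poly}})^{lk}_{xy}\,D^k(\mathsf K\Pi^i_y)(y).$$ **Proposition.** If $\Gamma$, with homogeneities $\boldsymbol\alpha$, has one of the following properties, then $\hat\Gamma$ has the same property with homogeneities $\boldsymbol{\hat\alpha}$: 1. *group property:* $\Gamma_{xy}\Gamma_{yz}=\Gamma_{xz}$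 for all $x,y,z$; 2. *triangular structure:* $\Gamma^{ii}_{xy}=1$, and $\Gamma^{ji}_{xy}=0$ if $j\ne i$ and $\alpha_j\ge\alpha_i$; 3. *analytic bound:* $|\Gamma^{ji}_{xy}|\lesssim|y-x|^{\alpha_i-\alpha_j}$ uniformly for $x,y$ in compact sets (with $0^0=1$ and $0^s=\infty$ for $s<0$). Moreover, for every compact $K$ there is a constant $C<\infty$, depending only on $K$, $\mathsf K$ (with its decomposition), $d$, $I$, $\boldsymbol\alpha$, $\gamma$, $r_\Pi$ and not on $(\Pi,\Gamma)$, such that for every compatible model satisfying the analytic bound, with $K'=K\oplus B(0,2)$ and $\|\Gamma\|_K=\max_{i,j}\sup_{x,y\in K}|\Gamma^{ji}_{xy}|\,|x-y|^{-(\alpha_i-\alpha_j)}$ (where $c/\infty=0$, $0/0=0$, and $c/0=\infty$ for $c>0$), $$\max_{l\in\mathrm{poly}(\gamma+\beta),\,i\in I}\ \sup_{x,y\in K}\frac{|\hat\Gamma^{li}_{xy}|}{|x-y|^{\alpha_i+\beta-|l|}}\ \le\ C\big(\|\Pi\|_{K',2(1+\rho)}+[\mathsf K\Pi]_{K',1}\big)\|\Gamma\|_K,$$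 and hence, for the norm of all of $\hat\Gamma$ with respect to $\boldsymbol{\hat\alpha}$, $$\|\hat\Gamma\|_K\ \le\ \max\Big\{1,\ \|\Gamma\|_K,\ C\big(\|\Pi\|_{K',2(1+\rho)}+[\mathsf K\Pi]_{K',1}\big)\|\Gamma\|_K\Big\}.$$ -/

import Mathlib

open MeasureTheory Filter Topology TopologicalSpace
open scoped NNReal ENNReal Pointwise Distributions

noncomputable section

namespace GermSchauder

/-! ### Multi-indices, partial derivatives, test functions -/

/-- The space `ℝ^d` with the Euclidean norm. -/
abbrev E (d : ℕ) := EuclideanSpace ℝ (Fin d)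

/-- Smooth compactly supported functions `ℝ^d → ℝ`. -/
abbrev TestFn (d : ℕ) := 𝓓((⊤ : Opens (E d)), ℝ)

/-- Real distributions on `ℝ^d`. -/
abbrev Distr (d : ℕ) := 𝓓'((⊤ : Opens (E d)), ℝ)

/-- Multi-indices `k ∈ ℕ₀^d`. -/
abbrev MIdx (d : ℕ) := Fin d → ℕ

variable {d : ℕ}

/-- The degree `|k| = k₁ + ⋯ + k_d`. -/
def deg (k : MIdx d) : ℕ := ∑ i, k i

/-- The list of coordinate directions in which `∂^k` differentiates: the `i`-th basis vector
occurs `k i` times. -/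
def dirs (k : MIdx d) : List (E d) :=
  (List.finRange d).flatMap fun i => List.replicate (k i) (EuclideanSpace.single i (1 : ℝ))

/-- The partial derivative `∂^k f`. -/
def pderiv (k : MIdx d) (f : E d → ℝ) : E d → ℝ :=
  (dirs k).foldr (fun v g x => lineDeriv ℝ g x v) f

/-- The partial derivative `∂^k φ` of a test function, as a test function. -/
def tderiv (k : MIdx d) (φ : TestFn d) : TestFn d :=
  (dirs k).foldr (fun v ψ => TestFunction.lineDerivCLM ℝ v ψ) φ

theorem coe_tderiv (k : MIdx d) (φ : TestFn d) : (tderiv k φ : E d → ℝ) = pderiv k φ := by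
  unfold tderiv pderiv
  induction dirs k with
  | nil => rfl
  | cons v l ih =>
    funext x
    simp only [List.foldr_cons]
    rw [TestFunction.lineDerivCLM_apply_of_le (by simp), ih]

/-- The monomial `x^k`. -/
def monomial (k : MIdx d) (x : E d) : ℝ := ∏ i, x i ^ k i

/-- The recentred and rescaled test function `φ_x^t = t^{-d} φ(t^{-1}(· - x))`, for `t > 0`
(and `0` for `t ≤ 0`, a case that is never used). -/
def scaled (φ : TestFn d) (x : E d) (t : ℝ) : TestFn d :=
  if ht : 0 < t then
    { toFun := fun y => (t ^ d)⁻¹ * φ (t⁻¹ • (y - x))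
      contDiff' := contDiff_const.mul
        (φ.contDiff.comp ((contDiff_id.sub contDiff_const).const_smul _))
      hasCompactSupport' := by
        have h : HasCompactSupport fun y : E d => φ (t⁻¹ • (y - x)) :=
          φ.hasCompactSupport.comp_homeomorph
            ((Homeomorph.subRight x).trans (Homeomorph.smulOfNeZero t⁻¹ (inv_ne_zero ht.ne')))
        exact h.mul_left
      tsupport_subset' := fun _ _ => trivial }
  else 0

theorem scaled_apply (φ : TestFn d) (x : E d) {t : ℝ} (ht : 0 < t) (y : E d) :
    scaled φ x t y = (t ^ d)⁻¹ * φ (t⁻¹ • (y - x)) := by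
  simp only [scaled, dif_pos ht]; rfl

/-- Test functions supported in the closed unit ball with `‖φ‖_{C^r} ≤ 1`. -/
def unitTests (d r : ℕ) : Set (TestFn d) :=
  {φ | tsupport φ ⊆ Metric.closedBall 0 1 ∧
    ∀ k : MIdx d, deg k ≤ r → ∀ x, |pderiv k φ x| ≤ 1}

/-! ### Functionals on test functions

Distributions are used through their values on test functions. The operations below (integration
against a kernel, derivatives) are defined on arbitrary functionals `TestFn d → ℝ`. -/

/-- `c` is the value at the (not necessarily smooth) function `φ` of the canonical extension of
`f` to compactly supported `C^r` functions: `f (u n) → c` whenever the test functions `u n`,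
supported in a common compact set, converge to `φ` in `C^r`. -/
def IsExtValue (r : ℕ) (f : TestFn d → ℝ) (φ : E d → ℝ) (c : ℝ) : Prop :=
  ∀ (u : ℕ → TestFn d) (S : Set (E d)), IsCompact S → (∀ n, tsupport (u n) ⊆ S) →
    (∀ k : MIdx d, deg k ≤ r →
      TendstoUniformly (fun n => pderiv k (u n)) (pderiv k φ) atTop) →
    Tendsto (fun n => f (u n)) atTop (𝓝 c)

open Classical in
/-- The value `f(φ)` of a distribution `f` of order `r` at a compactly supported `C^r`
function `φ`. -/
def extValue (r : ℕ) (f : TestFn d → ℝ) (φ : E d → ℝ) : ℝ :=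
  if h : ∃ c, IsExtValue r f φ c then h.choose else 0

/-- The distributional derivative `D^k f (φ) = (-1)^{|k|} f(∂^k φ)`. -/
def distDeriv (k : MIdx d) (f : TestFn d → ℝ) : TestFn d → ℝ :=
  fun φ => (-1) ^ deg k * f (tderiv k φ)

/-- `∫ η = 1` and `∫ η(x) x^l dx = 0` for all multi-indices `1 ≤ |l| < δ`. -/
def IsMollifier (δ : ℝ) (η : TestFn d) : Prop :=
  ∫ x, η x = 1 ∧ ∀ l : MIdx d, 1 ≤ deg l → (deg l : ℝ) < δ → ∫ x, η x * monomial l x = 0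

/-- `c` is the pointwise derivative `D^k f (x)` of `f`, defined for `|k| < δ`:
`D^k f (η_x^t) → c` as `t ↓ 0`, whatever the choice of `η`. -/
def IsPointDeriv (δ : ℝ) (k : MIdx d) (f : TestFn d → ℝ) (x : E d) (c : ℝ) : Prop :=
  ∀ η : TestFn d, IsMollifier δ η →
    Tendsto (fun t : ℝ => distDeriv k f (scaled η x t)) (𝓝[>] 0) (𝓝 c)

open Classical in
/-- The pointwise derivative `D^k f (x)`. -/
def pointDeriv (δ : ℝ) (k : MIdx d) (f : TestFn d → ℝ) (x : E d) : ℝ :=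
  if h : ∃ c, IsPointDeriv δ k f x c then h.choose else 0

/-- The homogeneity semi-norm of order `r` and exponent `a` over base points in `S` and scales
in `(0, Λ]`: the supremum of `|F_x(φ_x^t)| / t^a`. -/
def homNorm (S : Set (E d)) (Λ : ℝ) (r : ℕ) (a : ℝ) (F : E d → TestFn d → ℝ) : ℝ≥0∞ :=
  ⨆ x ∈ S, ⨆ t ∈ Set.Ioc (0 : ℝ) Λ, ⨆ φ ∈ unitTests d r,
    ENNReal.ofReal (|F x (scaled φ x t)| / t ^ a)

/-- `a`-homogeneity of order `r`. -/
def IsHomogeneous (a : ℝ) (r : ℕ) (F : E d → TestFn d → ℝ) : Prop :=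
  ∀ S : Set (E d), IsCompact S → ∀ Λ : ℝ, 1 ≤ Λ → homNorm S Λ r a F < ⊤

/-! ### Regularising kernels -/

/-- Functions of two variables of class `C^{m,r}`: the derivatives `∂₁^k ∂₂^l H` with `|k| ≤ m`
and `|l| ≤ r` exist and are jointly continuous. -/
def IsCmr (m r : ℕ) (H : E d → E d → ℝ) : Prop :=
  (∀ x, ContDiff ℝ r (H x)) ∧
  (∀ l : MIdx d, deg l ≤ r → ∀ y, ContDiff ℝ m fun x => pderiv l (H x) y) ∧
  ∀ k l : MIdx d, deg k ≤ m → deg l ≤ r →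
    Continuous fun p : E d × E d => pderiv k (fun x => pderiv l (H x) p.2) p.1

/-- A `β`-regularising kernel of order `(m, r)` with range `ρ`, together with the decomposition
`𝖪 = ∑ₙ 𝖪ₙ` that witnesses it. -/
structure RegKernel (d : ℕ) (β : ℝ) (m r : ℕ) (ρ : ℝ) where
  /-- the kernel `𝖪` -/
  toFun : E d → E d → ℝ
  /-- the pieces `𝖪ₙ` -/
  piece : ℕ → E d → E d → ℝ
  β_pos : 0 < β
  ρ_pos : 0 < ρ
  sum_eq : ∀ᵐ p : E d × E d, HasSum (fun n => piece n p.1 p.2) (toFun p.1 p.2)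
  cmr : ∀ n, IsCmr m r (piece n)
  support : ∀ n x y, piece n x y ≠ 0 → ‖x - y‖ ≤ ρ * 2 ^ (-(n : ℝ))
  bounds : ∀ S : Set (E d), IsCompact S → ∃ c : ℝ, 0 < c ∧
    (∀ n, ∀ k l : MIdx d, deg k ≤ m → deg l ≤ r → ∀ x ∈ S, ∀ y ∈ S,
      |pderiv k (fun x' => pderiv l (piece n x') y) x|
        ≤ c * 2 ^ (((d : ℝ) - β + deg l + deg k) * n)) ∧
    (∀ n, ∀ k l : MIdx d, deg k ≤ r → deg l ≤ r → ∀ y ∈ S,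
      |∫ x, monomial l (y - x) * pderiv k (piece n x) y| ≤ c * 2 ^ (-β * n))

variable {β ρ : ℝ} {m r : ℕ}

/-- `(𝖪ₙ^* ψ)(y) = ∫ ψ(x) 𝖪ₙ(x,y) dx`. -/
def RegKernel.adjoint (K : RegKernel d β m r ρ) (n : ℕ) (ψ : TestFn d) : E d → ℝ :=
  fun y => ∫ x, ψ x * K.piece n x y

/-- The singular integration `𝖪 f (ψ) = ∑ₙ f(𝖪ₙ^* ψ)` of a distribution `f` of order `r`. -/
def RegKernel.apply (K : RegKernel d β m r ρ) (f : TestFn d → ℝ) : TestFn d → ℝ :=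
  fun ψ => ∑' n, extValue r f (K.adjoint n ψ)

/-! ### Models -/

/-- A model `(Π, Γ)` on `ℝ^d` with homogeneities `α` and order `r`. The matrix entry
`gam x y j i` is `Γ^{ji}_{xy}`. -/
structure Model (d : ℕ) (I : Type*) [Fintype I] (α : I → ℝ) (r : ℕ) where
  /-- the germs `Π^i_x` -/
  pi : I → E d → Distr d
  /-- the re-expansion coefficients -/
  gam : E d → E d → Matrix I I ℝ
  measurable_pi : ∀ i (φ : TestFn d), Measurable fun x => pi i x φ
  homogeneous : ∀ i, IsHomogeneous (α i) r fun x φ => pi i x φ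
  reexpansion : ∀ i x y, pi i y = ∑ j, gam x y j i • pi j x

/-- For coefficients `G^{li}_{xy}` with columns of homogeneity `a i` and rows of homogeneity `b l`,
the supremum over `x, y ∈ S` of `|G^{li}_{xy}| / |x-y|^{a i - b l}`, maximised over `l, i`. The
extended conventions `0^s = ∞` for `s < 0`, `0^0 = 1`, `c/∞ = 0`, `0/0 = 0`, `c/0 = ∞` for `c ≠ 0`
apply on the diagonal `x = y`. -/
def gamNorm {I J : Type*} (a : I → ℝ) (b : J → ℝ) (S : Set (E d))
    (G : E d → E d → Matrix J I ℝ) : ℝ≥0∞ :=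
  ⨆ x ∈ S, ⨆ y ∈ S, ⨆ l, ⨆ i, ‖G x y l i‖ₑ / edist x y ^ (a i - b l)

/-- Group property `Γ_{xy} Γ_{yz} = Γ_{xz}`. -/
def GroupProperty {I : Type*} [Fintype I] (G : E d → E d → Matrix I I ℝ) : Prop :=
  ∀ x y z, G x y * G y z = G x z

/-- Triangular structure: `Γ^{ii}_{xy} = 1`, and `Γ^{ji}_{xy} = 0` if `j ≠ i`, `α_j ≥ α_i`. -/
def Triangular {I : Type*} (α : I → ℝ) (G : E d → E d → Matrix I I ℝ) : Prop :=
  ∀ x y, (∀ i, G x y i i = 1) ∧ ∀ i j, j ≠ i → α i ≤ α j → G x y j i = 0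

/-- Analytic bound `|Γ^{ji}_{xy}| ≲ |y-x|^{α_i-α_j}`, uniformly for `x, y` in compact sets. For
`x = y` the right-hand side is `∞`, `C` or `0` according to whether `α_i - α_j` is negative, zero
or positive. -/
def AnalyticBound {I : Type*} (α : I → ℝ) (G : E d → E d → Matrix I I ℝ) : Prop :=
  ∀ S : Set (E d), IsCompact S → ∃ C : ℝ≥0, 0 < C ∧
    ∀ x ∈ S, ∀ y ∈ S, ∀ j i, ‖G x y j i‖ₑ ≤ C * edist y x ^ (α i - α j)

section NewModel

variable {I : Type*} [Fintype I] {α : I → ℝ} {rPi : ℕ}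

/-- The family `(𝖪 Π^i_x)_x`. -/
def kpi (K : RegKernel d β m r ρ) (M : Model d I α rPi) (i : I) : E d → TestFn d → ℝ :=
  fun x => K.apply fun φ => M.pi i x φ

/-- Compatibility: `(D^k(𝖪 Π^i_x))_x` is `0`-homogeneous (of some order) if `|k| = α_i + β`. -/
def Compatible (K : RegKernel d β m r ρ) (M : Model d I α rPi) : Prop :=
  ∀ i, ∀ k : MIdx d, (deg k : ℝ) = α i + β →
    ∃ r₀ : ℕ, IsHomogeneous 0 r₀ fun x => distDeriv k (kpi K M i x)

/-- The norm `‖Π‖` over base points in `S` and scales in `(0, Λ]`. -/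
def piNorm (M : Model d I α rPi) (S : Set (E d)) (Λ : ℝ) : ℝ≥0∞ :=
  ⨆ i, homNorm S Λ rPi (α i) fun x φ => M.pi i x φ

/-- The quantity `[𝖪Π]` over base points in `S` and scales in `(0, Λ]`. -/
def compatNorm (K : RegKernel d β m r ρ) (M : Model d I α rPi) (S : Set (E d)) (Λ : ℝ) : ℝ≥0∞ :=
  ∑ i, ∑' k : {k : MIdx d // (deg k : ℝ) = α i + β},
    homNorm S Λ rPi 0 fun x => distDeriv (k : MIdx d) (kpi K M i x)

/-- `poly(t) = {k : |k| < t}`. -/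
abbrev Poly (d : ℕ) (t : ℝ) := {k : MIdx d // (deg k : ℝ) < t}

instance (d : ℕ) (t : ℝ) : Finite (Poly d t) := by
  refine Set.Finite.to_subtype (((Set.finite_Iic (fun _ : Fin d => ⌈t⌉₊))).subset ?_)
  intro k (hk : (deg k : ℝ) < t) i
  have h1 : k i ≤ deg k := Finset.single_le_sum (f := k) (fun _ _ => Nat.zero_le _)
    (Finset.mem_univ i)
  have h2 : (deg k : ℝ) ≤ ⌈t⌉₊ := hk.le.trans (Nat.le_ceil t)
  exact h1.trans (by exact_mod_cast h2)

instance (d : ℕ) (t : ℝ) : Fintype (Poly d t) := Fintype.ofFinite _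

open Classical in
/-- Coefficients of the polynomial model,
`(Γ^poly)^{lk}_{xy} = (x-y)^{k-l}/(k-l)!` if `l ≤ k`, and `0` otherwise. -/
def gamPoly (x y : E d) (l k : MIdx d) : ℝ :=
  if l ≤ k then monomial (k - l) (x - y) / ∏ i, ((k i - l i).factorial : ℝ) else 0

/-- The number `D^k(𝖪 Π^i_x)(x)`, defined for `|k| < α_i + β`. -/
def kpiDeriv (K : RegKernel d β m r ρ) (M : Model d I α rPi) (i : I) (k : MIdx d) (x : E d) : ℝ :=
  pointDeriv (α i + β) k (kpi K M i x) x

open Classical in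
/-- The block `Γ̂^{li}_{xy}`, `l ∈ poly(γ+β)`, `i ∈ I`, of the new coefficients:
`∑_{j : α_j+β > |l|} D^l(𝖪Π^j_x)(x) Γ^{ji}_{xy}
  - ∑_{k ∈ poly(α_i+β)} (Γ^poly)^{lk}_{xy} D^k(𝖪Π^i_y)(y)`. -/
def hatBlock (K : RegKernel d β m r ρ) (M : Model d I α rPi) (γ : ℝ) (x y : E d) :
    Matrix (Poly d (γ + β)) I ℝ := fun l i =>
  (∑ j, if (deg (l : MIdx d) : ℝ) < α j + β then kpiDeriv K M j l x * M.gam x y j i else 0)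
    - ∑ k : Poly d (α i + β), gamPoly x y l k * kpiDeriv K M i k y

/-- The new coefficients `Γ̂`, indexed by `Î = I ⊔ poly(γ+β)`. -/
def hatGam (K : RegKernel d β m r ρ) (M : Model d I α rPi) (γ : ℝ) (x y : E d) :
    Matrix (I ⊕ Poly d (γ + β)) (I ⊕ Poly d (γ + β)) ℝ :=
  Matrix.fromBlocks (M.gam x y) 0 (hatBlock K M γ x y) (fun l k => gamPoly x y l k)

/-- The degree as a real homogeneity on `poly(t)`. -/
def polyHom (d : ℕ) (t : ℝ) : Poly d t → ℝ := fun k => deg (k : MIdx d)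

/-- The new homogeneities: `α_i + β` on `I`, and `|k|` on `poly(γ+β)`. -/
def hatHom (d : ℕ) (α : I → ℝ) (β γ : ℝ) : I ⊕ Poly d (γ + β) → ℝ :=
  Sum.elim (fun i => α i + β) (polyHom d (γ + β))

end NewModel

end GermSchauder

end

/-! Let D_x be the matrix with entries D^l(𝖪Π^j_x)(x) for |l| < α_j+β and 0 otherwise. The new block
is D_x Γ_{xy} - Γ^poly_{xy} D_y (`hatBlock_eq`), so Γ̂_{xy} is the block diagonal matrix of Γ_{xy}
and Γ^poly_{xy}, multiplied on the left and on the right by unipotent matrices that depend on x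
alone and on y alone. The group property therefore reduces to those of Γ and Γ^poly, the latter
being the binomial theorem; the triangular structure is a count of degrees.

For the analytic bound, 𝖪 = ∑ 𝖪ₙ is split at a scale 2^{-N} comparable to |x-y|. Let T be the least
natural number above α_i+β. For n < N, re-expansion gives ∑_j Γ^{ji}_{xy} Π^j_x = Π^i_y, provided
that all j are summed. Subtracting the Taylor polynomial with all degrees |k| ≤ α_i+β then leaves
Π^i_y tested against a Taylor remainder of 𝖪ₙ in its first variable (`exists_taylor_bound`). As T >
α_i+β, the sum over n < N is geometric and is dominated by its last scale. What remains
(`regBlock_eq`, `cutSum`) is, in subcritical degrees |k| < α+β, the tail n ≥ N, and in the other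
degrees the partial sum n < N that was added in order to complete the two expressions. Tails
converge by the moment bounds on the kernel (`exists_fine_bound`, `exists_tail_bound`), and partial
sums above the critical degree are geometric. At |k| = α+β the partial sum has no geometric decay;
this is where compatibility enters: up to a bounded error, the partial sum is D^k(𝖪Π) tested at
scale 2^{-N} (`exists_partial_sum_bound`).

Pointwise derivatives are limits, so all of this is carried out at a regularisation scale t ≤
2^{-N}, uniformly in t, and t → 0 afterwards (`exists_hatBlock_bound`). On the diagonal every N is
admissible, and N → ∞ gives the bound.

This yields a factor 1+‖Γ‖ in place of ‖Γ‖. If |I|·‖Γ‖ ≥ 1 the two are comparable. Otherwise the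
identity Π_x = Π_x Γ_{xx} with small Γ_{xx} forces Π_x = 0 (`pi_eq_zero_of_small`), and the block
vanishes. -/

open MeasureTheory Filter Topology TopologicalSpace
open scoped NNReal ENNReal Pointwise Distributions

noncomputable section

namespace GermSchauder

section
variable {d : ℕ}

/-! ### Calculus of multi-indices -/

/-- The `j`-th coordinate direction. -/
abbrev basisVec (j : Fin d) : E d := EuclideanSpace.single j (1 : ℝ)

/-- The multi-index with a single entry `1` at `j`. -/
abbrev idx (j : Fin d) : MIdx d := Pi.single j 1

@[simp] theorem deg_zero : deg (0 : MIdx d) = 0 := by simp [deg]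

@[simp] theorem deg_add (k l : MIdx d) : deg (k + l) = deg k + deg l := by
  simp [deg, Finset.sum_add_distrib]

@[simp] theorem deg_idx (j : Fin d) : deg (idx j) = 1 := by
  simp [deg, idx, Finset.sum_pi_single']

theorem deg_mono {k l : MIdx d} (h : k ≤ l) : deg k ≤ deg l :=
  Finset.sum_le_sum fun i _ => h i

theorem deg_sub {k l : MIdx d} (h : l ≤ k) : deg (k - l) = deg k - deg l := by
  have : deg (k - l + l) = deg (k - l) + deg l := deg_add _ _
  rw [tsub_add_cancel_of_le h] at this
  omega

theorem eq_of_le_of_deg_le {k l : MIdx d} (h : l ≤ k) (h' : deg k ≤ deg l) : l = k := by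
  have h1 : deg (k - l) = 0 := by rw [deg_sub h]; omega
  funext i
  have h2 : (k - l) i ≤ deg (k - l) :=
    Finset.single_le_sum (f := k - l) (fun _ _ => Nat.zero_le _) (Finset.mem_univ i)
  have h3 := h i
  have h4 := deg_mono h
  have h3' : l i ≤ k i := h3
  simp only [Pi.sub_apply] at h2
  omega

/-- Since `pderiv` is a fold over a list of directions, identities for it are proved by peeling off
one coordinate direction at a time. -/
theorem midx_induction {P : MIdx d → Prop} (h0 : P 0) (h1 : ∀ k j, P k → P (k + idx j))
    (k : MIdx d) : P k := by
  generalize hn : deg k = n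
  induction n generalizing k with
  | zero =>
    have : (0 : MIdx d) = k := eq_of_le_of_deg_le (fun i => Nat.zero_le _) (by simp [hn])
    exact this ▸ h0
  | succ n ih =>
    have : ∃ j, k j ≠ 0 := by
      by_contra! h
      simp [deg, h] at hn
    obtain ⟨j, hj⟩ := this
    have hle : idx j ≤ k := by
      intro i
      by_cases hi : i = j
      · subst hi; simp; omega
      · simp [hi]
    have hk : k - idx j + idx j = k := tsub_add_cancel_of_le hle
    rw [← hk]
    refine h1 _ _ (ih _ ?_)
    rw [deg_sub hle, hn]; simp

theorem length_dirs (k : MIdx d) : (dirs k).length = deg k := by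
  simp [dirs, deg, List.length_flatMap, List.sum_ofFn, ← List.ofFn_eq_map]

theorem flatMap_replicate_perm {ι α : Type*} [DecidableEq ι] (e : ι → α) (k : ι → ℕ) (j : ι)
    (l : List ι) (hl : l.Nodup) (hj : j ∈ l) :
    (l.flatMap fun i => List.replicate ((k + Pi.single j 1 : ι → ℕ) i) (e i)).Perm
      (e j :: l.flatMap fun i => List.replicate (k i) (e i)) := by
  induction l with
  | nil => simp at hj
  | cons a l ih =>
    rw [List.nodup_cons] at hl
    simp only [List.flatMap_cons]
    by_cases ha : j = a
    · subst ha
      have : (l.flatMap fun i => List.replicate ((k + Pi.single j 1 : ι → ℕ) i) (e i))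
          = l.flatMap fun i => List.replicate (k i) (e i) := by
        refine List.flatMap_congr fun i hi => ?_
        have : i ≠ j := fun h => hl.1 (h ▸ hi)
        simp [this]
      rw [this]
      simp [List.replicate_succ]
    · have hj' : j ∈ l := by simpa [ha] using hj
      have h1 : (k + Pi.single j 1 : ι → ℕ) a = k a := by simp [Ne.symm ha]
      rw [h1]
      refine ((ih hl.2 hj').append_left _).trans ?_
      exact List.perm_middle

theorem dirs_add_idx (k : MIdx d) (j : Fin d) :
    (dirs (k + idx j)).Perm (basisVec j :: dirs k) := by
  classical
  exact flatMap_replicate_perm _ k j _ (List.nodup_finRange d) (List.mem_finRange j)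

/-- Iterated line derivatives along a list of directions. -/
def listDeriv (L : List (E d)) (f : E d → ℝ) : E d → ℝ :=
  L.foldr (fun v g x => lineDeriv ℝ g x v) f

theorem pderiv_eq_listDeriv (k : MIdx d) (f : E d → ℝ) : pderiv k f = listDeriv (dirs k) f := rfl

theorem listDeriv_cons (v : E d) (L : List (E d)) (f : E d → ℝ) :
    listDeriv (v :: L) f = fun x => lineDeriv ℝ (listDeriv L f) x v := rfl

theorem contDiff_lineDeriv {n : ℕ} {f : E d → ℝ} (hf : ContDiff ℝ ((n + 1 : ℕ)) f) (v : E d) :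
    ContDiff ℝ n fun x => lineDeriv ℝ f x v := by
  have h1 : (fun x => lineDeriv ℝ f x v) = fun x => fderiv ℝ f x v := by
    funext x
    exact (hf.differentiable (by norm_cast)).differentiableAt.lineDeriv_eq_fderiv
  rw [h1]
  exact (hf.fderiv_right (m := n) (by norm_cast)).clm_apply contDiff_const

theorem contDiff_listDeriv {n : ℕ} (L : List (E d)) {f : E d → ℝ}
    (hf : ContDiff ℝ ((n + L.length : ℕ)) f) : ContDiff ℝ n (listDeriv L f) := by
  induction L generalizing n with
  | nil => simpa [listDeriv] using hf
  | cons v L ih =>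
    rw [listDeriv_cons]
    exact contDiff_lineDeriv (ih (by convert hf using 2; simp; ring)) v

theorem lineDeriv_comm {f : E d → ℝ} (hf : ContDiff ℝ 2 f) (v w : E d) (x : E d) :
    lineDeriv ℝ (fun y => lineDeriv ℝ f y v) x w = lineDeriv ℝ (fun y => lineDeriv ℝ f y w) x v := by
  have hd : Differentiable ℝ f := hf.differentiable (by norm_num)
  have h1 : ∀ v, (fun x => lineDeriv ℝ f x v) = fun x => fderiv ℝ f x v := fun v => by
    funext x; exact hd.differentiableAt.lineDeriv_eq_fderiv
  have hf1 : ContDiff ℝ 1 (fderiv ℝ f) := hf.fderiv_right (by norm_num)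
  have hdd : Differentiable ℝ (fderiv ℝ f) := hf1.differentiable (by norm_num)
  have h2 : ∀ v w, lineDeriv ℝ (fun y => fderiv ℝ f y v) x w = fderiv ℝ (fderiv ℝ f) x w v := by
    intro v w
    have := (hdd x).hasFDerivAt.clm_apply (hasFDerivAt_const v x)
    rw [(this.hasLineDerivAt w).lineDeriv]
    simp
  rw [h1, h1, h2, h2]
  exact second_derivative_symmetric (fun y => (hd y).hasFDerivAt) (hdd x).hasFDerivAt _ _

/-- A permutation is a product of adjacent swaps, and each swap is the symmetry of second
derivatives; the length bound guarantees the two derivatives which that requires. -/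
theorem listDeriv_perm {L L' : List (E d)} (hL : L.Perm L') {f : E d → ℝ} {n : ℕ}
    (hf : ContDiff ℝ n f) (hn : L.length ≤ n) : listDeriv L f = listDeriv L' f := by
  induction hL with
  | nil => rfl
  | cons v h ih =>
    rw [listDeriv_cons, listDeriv_cons, ih (by simp at hn; omega)]
  | swap v w L =>
    simp only [List.length_cons] at hn
    have : ContDiff ℝ (2 : ℕ) (listDeriv L f) :=
      contDiff_listDeriv L (hf.of_le (by norm_cast; omega))
    funext x
    exact lineDeriv_comm (by exact_mod_cast this) _ _ x
  | trans h h' ih ih' => rw [ih hn, ih' (h.length_eq ▸ hn)]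

@[simp] theorem pderiv_zero (f : E d → ℝ) : pderiv 0 f = f := by
  have : dirs (0 : MIdx d) = [] := List.eq_nil_of_length_eq_zero (by simp [length_dirs])
  rw [pderiv_eq_listDeriv, this]; rfl

theorem contDiff_pderiv {n m : ℕ} {f : E d → ℝ} (hf : ContDiff ℝ m f) (k : MIdx d)
    (h : deg k + n ≤ m) : ContDiff ℝ n (pderiv k f) := by
  rw [pderiv_eq_listDeriv]
  refine contDiff_listDeriv _ (hf.of_le ?_)
  rw [length_dirs]; norm_cast; omega

theorem pderiv_add_idx {n : ℕ} {f : E d → ℝ} (hf : ContDiff ℝ n f) (k : MIdx d) (j : Fin d)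
    (h : deg k + 1 ≤ n) :
    pderiv (k + idx j) f = fun x => lineDeriv ℝ (pderiv k f) x (basisVec j) := by
  rw [pderiv_eq_listDeriv, listDeriv_perm (dirs_add_idx k j) hf (by simpa [length_dirs]),
    listDeriv_cons]
  rfl

theorem pderiv_lineDeriv {n : ℕ} {f : E d → ℝ} (hf : ContDiff ℝ n f) (k : MIdx d) (j : Fin d)
    (h : deg k + 1 ≤ n) :
    pderiv k (fun x => lineDeriv ℝ f x (basisVec j)) = pderiv (k + idx j) f := by
  have h1 : pderiv k (fun x => lineDeriv ℝ f x (basisVec j))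
      = listDeriv (dirs k ++ [basisVec j]) f := by
    simp [pderiv_eq_listDeriv, listDeriv, List.foldr_append]
  rw [h1, pderiv_eq_listDeriv, listDeriv_perm (dirs_add_idx k j) hf (by simpa [length_dirs])]
  refine listDeriv_perm ?_ hf (by simpa [length_dirs])
  exact List.perm_append_singleton _ _

theorem hasLineDerivAt_pderiv {n : ℕ} {f : E d → ℝ} (hf : ContDiff ℝ n f) (k : MIdx d) (j : Fin d)
    (h : deg k + 1 ≤ n) (x : E d) :
    HasLineDerivAt ℝ (pderiv k f) (pderiv (k + idx j) f x) x (basisVec j) := by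
  rw [pderiv_add_idx hf k j h]
  have h1 : ContDiff ℝ (1 : ℕ) (pderiv k f) := contDiff_pderiv hf k h
  exact ((h1.differentiable (by norm_num)).differentiableAt.lineDifferentiableAt).hasLineDerivAt

theorem fderiv_pderiv_basisVec {n : ℕ} {f : E d → ℝ} (hf : ContDiff ℝ n f) (k : MIdx d)
    (j : Fin d) (h : deg k + 1 ≤ n) (x : E d) :
    fderiv ℝ (pderiv k f) x (basisVec j) = pderiv (k + idx j) f x := by
  have h1 : ContDiff ℝ (1 : ℕ) (pderiv k f) := contDiff_pderiv hf k h
  simp only [pderiv_add_idx hf k j h]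
  rw [(h1.differentiable (by norm_num)).differentiableAt.lineDeriv_eq_fderiv]

theorem eq_sum_basisVec (v : E d) : v = ∑ j, v j • basisVec j := by
  ext i
  simp [basisVec, Pi.single_apply]

theorem abs_coord_le (v : E d) (j : Fin d) : |v j| ≤ ‖v‖ := by
  simpa using PiLp.norm_apply_le v j

theorem opNorm_le_of_basisVec (A : E d →L[ℝ] ℝ) {c : ℝ} (hc : 0 ≤ c)
    (h : ∀ j, |A (basisVec j)| ≤ c) : ‖A‖ ≤ d * c := by
  refine A.opNorm_le_bound (by positivity) fun v => ?_
  conv_lhs => rw [eq_sum_basisVec v]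
  rw [map_sum]
  calc ‖∑ j, A (v j • basisVec j)‖ ≤ ∑ j : Fin d, ‖v‖ * c := by
        refine norm_sum_le_of_le _ fun j _ => ?_
        rw [map_smul, norm_smul]
        exact mul_le_mul (abs_coord_le v j) (h j) (abs_nonneg _) (norm_nonneg _)
    _ = d * c * ‖v‖ := by simp; ring

theorem pderiv_add {n : ℕ} {f g : E d → ℝ} (hf : ContDiff ℝ n f) (hg : ContDiff ℝ n g)
    (k : MIdx d) (h : deg k ≤ n) :
    pderiv k (fun x => f x + g x) = fun x => pderiv k f x + pderiv k g x := by
  induction k using midx_induction with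
  | h0 => simp
  | h1 k j ih =>
    simp only [deg_add, deg_idx] at h
    rw [pderiv_add_idx (hf.add hg) k j h, ih (by omega)]
    funext x
    exact (HasDerivAt.add (hasLineDerivAt_pderiv hf k j h x)
      (hasLineDerivAt_pderiv hg k j h x)).deriv

theorem pderiv_const_mul {n : ℕ} {f : E d → ℝ} (hf : ContDiff ℝ n f) (c : ℝ)
    (k : MIdx d) (h : deg k ≤ n) :
    pderiv k (fun x => c * f x) = fun x => c * pderiv k f x := by
  induction k using midx_induction with
  | h0 => simp
  | h1 k j ih =>
    simp only [deg_add, deg_idx] at h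
    rw [pderiv_add_idx (contDiff_const.mul hf) k j h, ih (by omega)]
    funext x
    exact (HasDerivAt.const_mul c (hasLineDerivAt_pderiv hf k j h x)).deriv

theorem pderiv_comp_affine {n : ℕ} {f : E d → ℝ} (hf : ContDiff ℝ n f) (t : ℝ) (a : E d)
    (k : MIdx d) (h : deg k ≤ n) :
    pderiv k (fun x => f (t • (x - a))) = fun x => t ^ deg k * pderiv k f (t • (x - a)) := by
  have hc : ContDiff ℝ n fun x => f (t • (x - a)) :=
    hf.comp ((contDiff_id.sub contDiff_const).const_smul _)
  induction k using midx_induction with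
  | h0 => simp
  | h1 k j ih =>
    simp only [deg_add, deg_idx] at h
    rw [pderiv_add_idx hc k j h, ih (by omega)]
    funext x
    have h1 : ContDiff ℝ (1 : ℕ) (pderiv k f) := contDiff_pderiv hf k h
    have h2 := (h1.differentiable (by norm_num) (t • (x - a))).hasFDerivAt.comp x
      (((hasFDerivAt_id x).sub_const a).const_smul t)
    have h3 := (h2.const_mul (t ^ deg k)).hasLineDerivAt (basisVec j)
    rw [show (fun x => t ^ deg k * pderiv k f (t • (x - a)))
      = fun y => t ^ deg k * (pderiv k f ∘ (t • fun x => id x - a)) y from rfl, h3.lineDeriv]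
    simp only [FunLike.coe_smul, ContinuousLinearMap.coe_comp, Pi.smul_apply,
      Function.comp_apply, ContinuousLinearMap.coe_id', id_eq, smul_eq_mul, map_smul,
      fderiv_pderiv_basisVec hf k j h, deg_add, deg_idx]
    ring

theorem support_listDeriv_subset (L : List (E d)) (f : E d → ℝ) :
    tsupport (listDeriv L f) ⊆ tsupport f := by
  induction L with
  | nil => exact subset_rfl
  | cons v L ih =>
    refine closure_minimal ?_ (isClosed_tsupport f)
    intro x hx
    by_contra h
    have h0 : listDeriv L f =ᶠ[𝓝 x] fun _ => 0 :=
      notMem_tsupport_iff_eventuallyEq.1 fun h' => h (ih h')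
    apply hx
    rw [listDeriv_cons]
    simp only
    rw [h0.lineDeriv_eq]
    simp [lineDeriv]

theorem tsupport_pderiv_subset (k : MIdx d) (f : E d → ℝ) : tsupport (pderiv k f) ⊆ tsupport f :=
  support_listDeriv_subset _ _

theorem finite_deg_lt (d n : ℕ) : {k : MIdx d | deg k < n}.Finite := by
  have h : Finite (Poly d (n : ℝ)) := inferInstance
  refine (Set.finite_coe_iff.1 h).subset fun k hk => ?_
  have hk' : deg k < n := hk
  exact (Nat.cast_lt (α := ℝ)).2 hk'

end

section
variable {d : ℕ}

/-! ### The polynomial coefficients and Taylor's formula -/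

/-- The one-dimensional polynomial coefficient. -/
def gamPolyOne (a b : ℕ) (s : ℝ) : ℝ :=
  if a ≤ b then s ^ (b - a) / ((b - a).factorial : ℝ) else 0

theorem gamPoly_eq_prod (x y : E d) (l k : MIdx d) :
    gamPoly x y l k = ∏ i, gamPolyOne (l i) (k i) (x i - y i) := by
  unfold gamPoly gamPolyOne
  split_ifs with h
  · rw [monomial, ← Finset.prod_div_distrib]
    exact Finset.prod_congr rfl fun i _ => by simp [h i]
  · obtain ⟨i, hi⟩ : ∃ i, ¬ l i ≤ k i := by simpa [Pi.le_def] using h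
    exact (Finset.prod_eq_zero (Finset.mem_univ i) (by simp [hi])).symm

/-- This is the binomial theorem divided by (b-a)!; only a ≤ c ≤ b contributes, so any range that
contains b will do. -/
theorem gamPolyOne_comp (a b : ℕ) (s t : ℝ) (n : ℕ) (hn : b < n) :
    ∑ c ∈ Finset.range n, gamPolyOne a c s * gamPolyOne c b t = gamPolyOne a b (s + t) := by
  by_cases hab : a ≤ b
  · have hsub : Finset.Ico a (b + 1) ⊆ Finset.range n := by
      intro c hc; simp at hc ⊢; omega
    rw [← Finset.sum_subset hsub]
    · rw [Finset.sum_Ico_eq_sum_range]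
      simp only [gamPolyOne, if_pos hab]
      rw [add_pow, Finset.sum_div]
      have : b + 1 - a = b - a + 1 := by omega
      rw [this]
      refine Finset.sum_congr rfl fun i hi => ?_
      simp only [Finset.mem_range] at hi
      have h1 : a ≤ a + i := by omega
      have h2 : a + i ≤ b := by omega
      have h3 : b - (a + i) = b - a - i := by omega
      rw [if_pos h1, if_pos h2, h3, Nat.add_sub_cancel_left,
        Nat.cast_choose ℝ (by omega : i ≤ b - a)]
      field_simp
    · intro c _ hc
      simp only [Finset.mem_Ico, not_and, not_lt] at hc
      by_cases h : a ≤ c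
      · have := hc h
        simp [gamPolyOne, show ¬ c ≤ b by omega]
      · simp [gamPolyOne, h]
  · rw [Finset.sum_eq_zero]
    · simp [gamPolyOne, hab]
    · intro c _
      by_cases h : a ≤ c
      · simp [gamPolyOne, show ¬ c ≤ b by omega]
      · simp [gamPolyOne, h]

theorem gamPoly_of_not_le (x y : E d) {l k : MIdx d} (h : ¬ l ≤ k) : gamPoly x y l k = 0 :=
  if_neg h

theorem gamPoly_of_deg_lt (x y : E d) {l k : MIdx d} (h : deg k < deg l) : gamPoly x y l k = 0 :=
  gamPoly_of_not_le x y fun h' => absurd (deg_mono h') (by omega)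

theorem gamPoly_self_index (x y : E d) (l : MIdx d) : gamPoly x y l l = 1 := by
  simp [gamPoly, monomial]

theorem gamPoly_of_deg_le {x y : E d} {l k : MIdx d} (hne : l ≠ k) (h : deg k ≤ deg l) :
    gamPoly x y l k = 0 :=
  gamPoly_of_not_le x y fun h' => hne (eq_of_le_of_deg_le h' h)

theorem gamPoly_diag (x : E d) (l k : MIdx d) [Decidable (l = k)] :
    gamPoly x x l k = if l = k then 1 else 0 := by
  rw [gamPoly_eq_prod]
  split_ifs with h
  · subst h; simp [gamPolyOne]
  · obtain ⟨i, hi⟩ : ∃ i, l i ≠ k i := by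
      by_contra! h'; exact h (funext h')
    refine Finset.prod_eq_zero (Finset.mem_univ i) ?_
    by_cases h2 : l i ≤ k i
    · simp [gamPolyOne, h2, show k i - l i ≠ 0 by omega]
    · simp [gamPolyOne, h2]

theorem abs_gamPoly_le (x y : E d) (l k : MIdx d) (h : l ≤ k) :
    |gamPoly x y l k| ≤ ‖x - y‖ ^ (deg k - deg l) := by
  rw [gamPoly_eq_prod, Finset.abs_prod, ← deg_sub h, deg, ← Finset.prod_pow_eq_pow_sum]
  refine Finset.prod_le_prod (fun _ _ => abs_nonneg _) fun i _ => ?_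
  have h1 : l i ≤ k i := h i
  simp only [gamPolyOne, if_pos h1, Pi.sub_apply, abs_div, abs_pow, Nat.abs_cast]
  have h2 : |x i - y i| ≤ ‖x - y‖ := by simpa using abs_coord_le (x - y) i
  refine (div_le_self (by positivity) ?_).trans (pow_le_pow_left₀ (abs_nonneg _) h2 _)
  exact_mod_cast Nat.one_le_iff_ne_zero.2 (Nat.factorial_ne_zero _)

/-- The one-dimensional identity, multiplied over coordinates, gives a sum over a box of
multi-indices. Only p ≤ k contributes, and such p lie both in the box and in poly(t), so the two
index sets give the same sum. -/
theorem sum_gamPoly_mul_gamPoly (x y z : E d) (l : MIdx d) {t : ℝ} (k : MIdx d)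
    (hk : (deg k : ℝ) < t) :
    ∑ p : Poly d t, gamPoly x y l p * gamPoly y z p k = gamPoly x z l k := by
  classical
  set B : Finset (MIdx d) := Fintype.piFinset fun _ => Finset.range (deg k + 1) with hB
  have hkB : ∀ i, k i ≤ deg k := fun i =>
    Finset.single_le_sum (f := k) (fun _ _ => Nat.zero_le _) (Finset.mem_univ i)
  have h1 : ∑ p ∈ B, gamPoly x y l p * gamPoly y z p k = gamPoly x z l k := by
    simp only [gamPoly_eq_prod, ← Finset.prod_mul_distrib]
    rw [hB, ← Finset.prod_univ_sum (t := fun _ : Fin d => Finset.range (deg k + 1))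
      (f := fun i c => gamPolyOne (l i) c (x i - y i) * gamPolyOne c (k i) (y i - z i))]
    refine Finset.prod_congr rfl fun i _ => ?_
    rw [gamPolyOne_comp _ _ _ _ _ (Nat.lt_succ_of_le (hkB i))]
    congr 1; ring
  rw [← h1]
  have h2 : ∀ p : MIdx d, gamPoly x y l p * gamPoly y z p k ≠ 0 → p ≤ k := by
    intro p hp
    by_contra h
    exact hp (by rw [gamPoly_of_not_le _ _ h, mul_zero])
  have h3 : ∑ p : Poly d t, gamPoly x y l p * gamPoly y z p k
      = ∑ p ∈ (Finset.univ : Finset (Poly d t)).map (Function.Embedding.subtype _),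
        gamPoly x y l p * gamPoly y z p k := by
    rw [Finset.sum_map]; rfl
  rw [h3]
  have hle : ∀ p : MIdx d, p ≤ k → (deg p : ℝ) < t := fun p hp =>
    lt_of_le_of_lt (by exact_mod_cast deg_mono hp) hk
  refine Finset.sum_congr_of_eq_on_inter ?_ ?_ fun _ _ _ => rfl
  · intro p _ hp
    by_contra h
    have := h2 p h
    exact hp (by simpa [hB] using fun i => Nat.lt_succ_of_le ((this i).trans (hkB i)))
  · intro p _ hp
    by_contra h
    exact hp (by simpa using hle p (h2 p h))

theorem hasDerivAt_gamPolyOne (a b : ℕ) (s : ℝ) :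
    HasDerivAt (gamPolyOne a b) (gamPolyOne (a + 1) b s) s := by
  by_cases h : a ≤ b
  · by_cases h' : a + 1 ≤ b
    · have h1 : b - a = (b - (a + 1)) + 1 := by omega
      have h2 : gamPolyOne a b
          = fun s => s ^ (b - (a + 1) + 1) / ((b - (a + 1) + 1).factorial : ℝ) := by
        funext s; simp only [gamPolyOne, if_pos h]; rw [h1]
      rw [h2]
      convert! (hasDerivAt_pow (b - (a + 1) + 1) s).div_const
        (((b - (a + 1) + 1).factorial : ℝ)) using 1
      simp only [gamPolyOne, if_pos h', Nat.factorial_succ, Nat.add_sub_cancel]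
      push_cast
      have : ((b - (a + 1) : ℕ) : ℝ) + 1 ≠ 0 := by positivity
      field_simp
    · have h1 : b = a := by omega
      subst h1
      have h2 : gamPolyOne b b = fun _ => 1 := by funext s; simp [gamPolyOne]
      rw [h2]
      simpa [gamPolyOne] using hasDerivAt_const s (1 : ℝ)
  · have h2 : gamPolyOne a b = fun _ => 0 := by funext s; simp [gamPolyOne, h]
    rw [h2]
    simpa [gamPolyOne, show ¬ a + 1 ≤ b by omega] using hasDerivAt_const s (0 : ℝ)

/-- Differentiation in x raises the row index, so the derivative of a Taylor remainder of ∂^l h is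
the remainder of ∂^{l+e_j} h. This drives the induction in `abs_taylorRem_le`. -/
theorem hasFDerivAt_gamPoly_basisVec (x y : E d) (l k : MIdx d) :
    ∃ A : E d →L[ℝ] ℝ, HasFDerivAt (fun x => gamPoly x y l k) A x ∧
      ∀ j, A (basisVec j) = gamPoly x y (l + idx j) k := by
  classical
  simp only [gamPoly_eq_prod]
  have h1 : ∀ i ∈ (Finset.univ : Finset (Fin d)),
      HasFDerivAt (fun x : E d => gamPolyOne (l i) (k i) (x i - y i))
      (gamPolyOne (l i + 1) (k i) (x i - y i) • (EuclideanSpace.proj i : E d →L[ℝ] ℝ)) x := by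
    intro i _
    exact (hasDerivAt_gamPolyOne (l i) (k i) (x i - y i)).comp_hasFDerivAt x
      (((EuclideanSpace.proj i : E d →L[ℝ] ℝ).hasFDerivAt).sub_const (y i))
  refine ⟨_, HasFDerivAt.finsetProd h1, fun j => ?_⟩
  simp only [sum_apply, FunLike.coe_smul, Pi.smul_apply, smul_eq_mul]
  rw [Finset.sum_eq_single j]
  · rw [← Finset.mul_prod_erase _ _ (Finset.mem_univ j), mul_comm]
    simp only [PiLp.proj_apply, PiLp.single_apply, Pi.add_apply, Pi.single_eq_same]
    congr 1
    · simp
    · refine Finset.prod_congr rfl fun i hi => ?_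
      simp [Pi.single_eq_of_ne (Finset.ne_of_mem_erase hi)]
  · intro i _ hi
    simp [hi]
  · simp

/-- The remainder of the Taylor expansion of `∂^l h` at `y`, keeping the derivatives of `h`
of order less than `t`. -/
def taylorRem (h : E d → ℝ) (t : ℕ) (y : E d) (l : MIdx d) (x : E d) : ℝ :=
  pderiv l h x - ∑ k : Poly d t, gamPoly x y l k * pderiv k h y

theorem taylorRem_of_le (h : E d → ℝ) {t : ℕ} (y : E d) {l : MIdx d} (hl : t ≤ deg l) (x : E d) :
    taylorRem h t y l x = pderiv l h x := by
  rw [taylorRem, Finset.sum_eq_zero, sub_zero]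
  intro k _
  have : deg (k : MIdx d) < t := by exact_mod_cast k.2
  rw [gamPoly_of_deg_lt _ _ (by omega), zero_mul]

theorem taylorRem_self (h : E d → ℝ) {t : ℕ} (y : E d) {l : MIdx d} (hl : deg l < t) :
    taylorRem h t y l y = 0 := by
  classical
  rw [taylorRem, Finset.sum_eq_single (⟨l, by exact_mod_cast hl⟩ : Poly d t)]
  · simp [gamPoly_diag]
  · intro k _ hk
    rw [gamPoly_diag, if_neg, zero_mul]
    rintro rfl; exact hk rfl
  · simp

theorem hasFDerivAt_taylorRem {n : ℕ} {h : E d → ℝ} (hh : ContDiff ℝ n h) {t : ℕ} (y : E d)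
    {l : MIdx d} (hl : deg l + 1 ≤ n) (x : E d) :
    ∃ A : E d →L[ℝ] ℝ, HasFDerivAt (taylorRem h t y l) A x ∧
      ∀ j, A (basisVec j) = taylorRem h t y (l + idx j) x := by
  have h1 : ContDiff ℝ (1 : ℕ) (pderiv l h) := contDiff_pderiv hh l hl
  have h2 := (h1.differentiable (by norm_num) x).hasFDerivAt
  choose A hA hAj using fun k : Poly d t => hasFDerivAt_gamPoly_basisVec x y l k
  refine ⟨_, h2.sub (HasFDerivAt.fun_sum fun k _ => (hA k).mul_const (pderiv (k : MIdx d) h y)),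
    fun j => ?_⟩
  simp [hAj, fderiv_pderiv_basisVec hh l j hl, taylorRem, mul_comm]

/-- Induction on t - |l| (truncated): the remainder vanishes at y and its coordinate derivatives are
remainders of one order less, so the mean value inequality on the segment gains a factor d‖x-y‖. For
|l| ≥ t no polynomial is subtracted. -/
theorem abs_taylorRem_le {n : ℕ} {h : E d → ℝ} (hh : ContDiff ℝ n h) (t : ℕ) (x y : E d)
    (l : MIdx d) (hn : max t (deg l) ≤ n) {M : ℝ} (hM0 : 0 ≤ M)
    (hM : ∀ k, deg k = max t (deg l) → ∀ z ∈ segment ℝ y x, |pderiv k h z| ≤ M) :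
    |taylorRem h t y l x| ≤ (d : ℝ) ^ (t - deg l) * ‖x - y‖ ^ (t - deg l) * M := by
  generalize hq : t - deg l = q
  induction q generalizing l x with
  | zero =>
    rw [taylorRem_of_le _ _ (by omega)]
    simpa using hM l (by omega) x (right_mem_segment ℝ y x)
  | succ q ih =>
    choose A hA hAj using fun z => hasFDerivAt_taylorRem (t := t) hh y (l := l) (by omega) z
    have hb : ∀ z ∈ segment ℝ y x, ‖A z‖ ≤ d * ((d : ℝ) ^ q * ‖x - y‖ ^ q * M) := by
      intro z hz
      refine opNorm_le_of_basisVec _ (by positivity) fun j => ?_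
      rw [hAj]
      have hseg : segment ℝ y z ⊆ segment ℝ y x :=
        (convex_segment y x).segment_subset (left_mem_segment ℝ y x) hz
      refine (ih z (l + idx j) (by simp; omega) (fun k hk w hw => hM k ?_ w (hseg hw))
        (by simp; omega)).trans ?_
      · simp at hk; omega
      · have : ‖z - y‖ ≤ ‖x - y‖ := by
          obtain ⟨a, b, ha, hb, hab, rfl⟩ := hz
          have : a • y + b • x - y = b • (x - y) := by
            rw [show a = 1 - b by linarith]; module
          rw [this, norm_smul, Real.norm_of_nonneg hb]
          exact mul_le_of_le_one_left (norm_nonneg _) (by linarith)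
        gcongr
    have := (convex_segment y x).norm_image_sub_le_of_norm_hasFDerivWithin_le
      (fun z hz => (hA z).hasFDerivWithinAt) hb (left_mem_segment ℝ y x) (right_mem_segment ℝ y x)
    rw [taylorRem_self _ _ (by omega), sub_zero, Real.norm_eq_abs] at this
    refine this.trans (le_of_eq ?_)
    ring

end

section
variable {d : ℕ}

/-! ### Integration of kernels against test functions -/

theorem pderiv_idx (f : E d → ℝ) (hf : ContDiff ℝ 1 f) (j : Fin d) :
    pderiv (idx j) f = fun x => lineDeriv ℝ f x (basisVec j) := by
  have := pderiv_add_idx (n := 1) (f := f) (by exact_mod_cast hf) 0 j (by simp)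
  simpa using this

theorem fderiv_eq_sum (f : E d → ℝ) (hf : ContDiff ℝ 1 f) (y : E d) :
    fderiv ℝ f y = ∑ j, pderiv (idx j) f y • (EuclideanSpace.proj j : E d →L[ℝ] ℝ) := by
  ext v
  conv_lhs => rw [eq_sum_basisVec v]
  rw [map_sum, sum_apply]
  refine Finset.sum_congr rfl fun j _ => ?_
  have := fderiv_pderiv_basisVec (n := 1) (f := f) (by exact_mod_cast hf) 0 j (by simp) y
  simp only [pderiv_zero, zero_add] at this
  rw [map_smul, this]
  simp [mul_comm]

/-- Functions `H(x, y)` of class `C^r` in `y`, the derivatives being jointly continuous. -/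
def SmoothSnd (r : ℕ) (H : E d → E d → ℝ) : Prop :=
  (∀ x, ContDiff ℝ r (H x)) ∧
    ∀ l : MIdx d, deg l ≤ r → Continuous fun p : E d × E d => pderiv l (H p.1) p.2

theorem SmoothSnd.pderiv_idx {r : ℕ} {H : E d → E d → ℝ} (h : SmoothSnd (r + 1) H) (j : Fin d) :
    SmoothSnd r fun x => pderiv (idx j) (H x) := by
  refine ⟨fun x => contDiff_pderiv (h.1 x) _ (by simp; omega), fun l hl => ?_⟩
  have h1 : ∀ x, pderiv l (pderiv (idx j) (H x)) = pderiv (l + idx j) (H x) := fun x => by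
    rw [GermSchauder.pderiv_idx _ ((h.1 x).of_le (by norm_cast; omega)),
      pderiv_lineDeriv (h.1 x) _ _ (by omega)]
  simp only [h1]
  exact h.2 _ (by simp; omega)

theorem SmoothSnd.mono {r r' : ℕ} {H : E d → E d → ℝ} (h : SmoothSnd r H) (hr : r' ≤ r) :
    SmoothSnd r' H :=
  ⟨fun x => (h.1 x).of_le (by exact_mod_cast hr), fun l hl => h.2 l (hl.trans hr)⟩

theorem SmoothSnd.continuous {r : ℕ} {H : E d → E d → ℝ} (h : SmoothSnd r H) :
    Continuous fun p : E d × E d => H p.1 p.2 := by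
  simpa using h.2 0 (by simp)

section Param

variable {ψ : E d → ℝ}

theorem integrable_mul_of_hasCompactSupport (hψ : Continuous ψ) (hc : HasCompactSupport ψ)
    {g : E d → ℝ} (hg : Continuous g) : Integrable fun x => ψ x * g x :=
  (hψ.mul hg).integrable_of_hasCompactSupport hc.mul_right

theorem continuous_integral_mul (hψ : Continuous ψ) (hc : HasCompactSupport ψ)
    {H : E d → E d → ℝ} (hH : Continuous fun p : E d × E d => H p.1 p.2) :
    Continuous fun y => ∫ x, ψ x * H x y := by
  have h1 : (fun y => ∫ x, ψ x * H x y) = fun y => ∫ x in tsupport ψ, ψ x * H x y := by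
    funext y
    rw [setIntegral_eq_integral_of_forall_compl_eq_zero]
    intro x hx
    rw [image_eq_zero_of_notMem_tsupport hx, zero_mul]
  rw [h1]
  refine continuous_parametric_integral_of_continuous (f := fun y x => ψ x * H x y) ?_ hc
  exact (hψ.comp continuous_snd).mul (hH.comp continuous_swap)

theorem hasFDerivAt_integral_mul (hψ : Continuous ψ) (hc : HasCompactSupport ψ)
    {H : E d → E d → ℝ} (hH : SmoothSnd 1 H) (y : E d) :
    HasFDerivAt (fun y => ∫ x, ψ x * H x y)
      (∑ j, (∫ x, ψ x * pderiv (idx j) (H x) y) • (EuclideanSpace.proj j : E d →L[ℝ] ℝ)) y := by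
  have hcont : Continuous fun p : E d × E d => fderiv ℝ (H p.1) p.2 := by
    have : (fun p : E d × E d => fderiv ℝ (H p.1) p.2) = fun p => ∑ j,
        pderiv (idx j) (H p.1) p.2 • (EuclideanSpace.proj j : E d →L[ℝ] ℝ) := by
      funext p
      exact fderiv_eq_sum _ (by exact_mod_cast hH.1 p.1) _
    rw [this]
    exact continuous_finsetSum _ fun j _ => (hH.2 _ (by simp)).smul continuous_const
  -- Compactness of supp ψ times the unit ball around y yields the dominating function |ψ|·B.
  obtain ⟨B, hB⟩ := (hc.isCompact.prod (isCompact_closedBall y 1)).exists_bound_of_continuousOn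
    hcont.continuousOn
  have hF : ∀ y, Continuous fun x => ψ x * H x y := fun y =>
    hψ.mul (hH.continuous.comp (continuous_id.prodMk continuous_const))
  have hFi : ∀ y, Integrable fun x => ψ x * H x y := fun y =>
    integrable_mul_of_hasCompactSupport hψ hc
      (hH.continuous.comp (continuous_id.prodMk continuous_const))
  have hF' : Continuous fun x => ψ x • fderiv ℝ (H x) y :=
    hψ.smul (hcont.comp (continuous_id.prodMk continuous_const))
  have key := hasFDerivAt_integral_of_dominated_of_fderiv_le (μ := volume)
    (F := fun y x => ψ x * H x y) (F' := fun y x => ψ x • fderiv ℝ (H x) y) (x₀ := y)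
    (bound := fun x => |ψ x| * B) (Metric.ball_mem_nhds y one_pos)
    (Eventually.of_forall fun y => (hF y).aestronglyMeasurable) (hFi y)
    hF'.aestronglyMeasurable
    (Eventually.of_forall fun x z hz => ?_) ?_
    (Eventually.of_forall fun x z _ => ?_)
  · convert! key using 1
    have hi : Integrable fun x => ψ x • fderiv ℝ (H x) y :=
      hF'.integrable_of_hasCompactSupport hc.smul_right
    have h2 : ∀ j, Integrable fun x => ψ x * pderiv (idx j) (H x) y := fun j =>
      integrable_mul_of_hasCompactSupport hψ hc
        ((hH.2 (idx j) (by simp)).comp (continuous_id.prodMk continuous_const))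
    ext v
    rw [ContinuousLinearMap.integral_apply hi, sum_apply]
    simp only [FunLike.coe_smul, Pi.smul_apply, smul_eq_mul, PiLp.proj_apply,
      ← integral_mul_const]
    rw [← integral_finsetSum _ fun j _ => (h2 j).mul_const _]
    refine integral_congr_ae (Eventually.of_forall fun x => ?_)
    simp only [fderiv_eq_sum _ (show ContDiff ℝ 1 (H x) by exact_mod_cast hH.1 x), sum_apply,
      FunLike.coe_smul, Pi.smul_apply, smul_eq_mul, PiLp.proj_apply, Finset.mul_sum, mul_assoc]
  · rw [norm_smul, Real.norm_eq_abs]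
    by_cases hx : x ∈ tsupport ψ
    · exact mul_le_mul_of_nonneg_left (hB (x, z) ⟨hx, Metric.ball_subset_closedBall hz⟩)
        (abs_nonneg _)
    · simp [image_eq_zero_of_notMem_tsupport hx]
  · exact (hψ.abs.mul continuous_const).integrable_of_hasCompactSupport hc.norm.mul_right
  · exact (((hH.1 x).differentiable (by norm_num) z).hasFDerivAt).const_mul (ψ x)

theorem contDiff_integral_mul (hψ : Continuous ψ) (hc : HasCompactSupport ψ) {r : ℕ}
    {H : E d → E d → ℝ} (hH : SmoothSnd r H) : ContDiff ℝ r fun y => ∫ x, ψ x * H x y := by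
  induction r generalizing H with
  | zero => exact contDiff_zero.2 (continuous_integral_mul hψ hc hH.continuous)
  | succ r ih =>
    have h1 := hasFDerivAt_integral_mul hψ hc (hH.mono (Nat.le_add_left 1 r))
    rw [Nat.cast_add, Nat.cast_one, contDiff_succ_iff_fderiv]
    refine ⟨fun y => (h1 y).differentiableAt, by simp, ?_⟩
    rw [funext fun y => (h1 y).fderiv]
    exact ContDiff.sum fun j _ => (ih (hH.pderiv_idx j)).smul contDiff_const

theorem pderiv_integral_mul (hψ : Continuous ψ) (hc : HasCompactSupport ψ) {r : ℕ}
    {H : E d → E d → ℝ} (hH : SmoothSnd r H) (k : MIdx d) (hk : deg k ≤ r) :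
    pderiv k (fun y => ∫ x, ψ x * H x y) = fun y => ∫ x, ψ x * pderiv k (H x) y := by
  induction k using midx_induction generalizing r H with
  | h0 => simp
  | h1 k j ih =>
    simp only [deg_add, deg_idx] at hk
    obtain ⟨r, rfl⟩ : ∃ r', r = r' + 1 := ⟨r - 1, by omega⟩
    have h1 := hasFDerivAt_integral_mul hψ hc (hH.mono (Nat.le_add_left 1 r))
    have h2 : (fun y => lineDeriv ℝ (fun y => ∫ x, ψ x * H x y) y (basisVec j))
        = fun y => ∫ x, ψ x * pderiv (idx j) (H x) y := by
      funext y
      rw [((h1 y).hasLineDerivAt (basisVec j)).lineDeriv, sum_apply, Finset.sum_eq_single j]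
      · simp
      · intro i _ hi; simp [hi]
      · simp
    rw [← pderiv_lineDeriv (contDiff_integral_mul hψ hc hH) k j hk, h2,
      ih (hH.pderiv_idx j) (by omega)]
    funext y
    refine integral_congr_ae (Eventually.of_forall fun x => ?_)
    simp only
    rw [GermSchauder.pderiv_idx _ ((hH.1 x).of_le (by norm_cast; omega)),
      pderiv_lineDeriv (hH.1 x) _ _ hk]

end Param

theorem contDiff_testFn (φ : TestFn d) (n : ℕ) : ContDiff ℝ n φ :=
  φ.contDiff.of_le (by exact_mod_cast le_top)

theorem integral_tderiv_mul (ψ : TestFn d) {n : ℕ} {h : E d → ℝ} (hh : ContDiff ℝ n h)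
    (k : MIdx d) (hk : deg k ≤ n) :
    ∫ x, tderiv k ψ x * h x = (-1) ^ deg k * ∫ x, ψ x * pderiv k h x := by
  simp only [coe_tderiv]
  induction k using midx_induction generalizing n h with
  | h0 => simp
  | h1 k j ih =>
    simp only [deg_add, deg_idx] at hk
    obtain ⟨n, rfl⟩ : ∃ n', n = n' + 1 := ⟨n - 1, by omega⟩
    have hψk : ContDiff ℝ (1 : ℕ) (pderiv k ψ) :=
      contDiff_pderiv (contDiff_testFn ψ (deg k + 1)) k (by omega)
    have hcs : HasCompactSupport (pderiv k ψ) :=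
      ψ.hasCompactSupport.mono' ((subset_tsupport _).trans (tsupport_pderiv_subset k ψ))
    have hci : Continuous fun x => fderiv ℝ (pderiv k ψ) x (basisVec j) :=
      (hψk.continuous_fderiv (by norm_num)).clm_apply continuous_const
    have hcs' : HasCompactSupport fun x => fderiv ℝ (pderiv k ψ) x (basisVec j) :=
      hcs.fderiv_apply (𝕜 := ℝ) _
    have hj := contDiff_lineDeriv hh (basisVec j)
    have hd1 := hψk.differentiable (by norm_num)
    have hd2 := hh.differentiable (by norm_num)
    rw [pderiv_add_idx (contDiff_testFn ψ (deg k + 1)) k j le_rfl]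
    have key := integral_mul_fderiv_eq_neg_fderiv_mul_of_integrable (μ := volume)
      (f := pderiv k ψ) (g := h) (v := basisVec j) ?_ ?_ ?_ (fun x _ => hd1 x) (fun x _ => hd2 x)
    · simp only [(hd1 _).lineDeriv_eq_fderiv]
      have h2 : ∀ x, fderiv ℝ h x (basisVec j) = lineDeriv ℝ h x (basisVec j) := fun x =>
        (hd2 x).lineDeriv_eq_fderiv.symm
      simp only [h2] at key
      rw [eq_neg_iff_add_eq_zero, add_comm, ← eq_neg_iff_add_eq_zero] at key
      rw [key, ih hj (by omega), pderiv_lineDeriv hh k j (by omega), deg_add, deg_idx]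
      ring
    · exact integrable_mul_of_hasCompactSupport hci hcs' hh.continuous
    · exact integrable_mul_of_hasCompactSupport hψk.continuous hcs
        ((hh.continuous_fderiv (by norm_cast)).clm_apply continuous_const)
    · exact integrable_mul_of_hasCompactSupport hψk.continuous hcs hh.continuous

theorem integral_scaled_mul (η : TestFn d) (x : E d) {t : ℝ} (ht : 0 < t) (g : E d → ℝ) :
    ∫ z, scaled η x t z * g z = ∫ z, η z * g (x + t • z) := by
  have h1 := Measure.integral_comp_smul (volume : Measure (E d))
    (fun u => η (t⁻¹ • u) * g (x + u)) t
  simp only [smul_smul, inv_mul_cancel₀ ht.ne', one_smul] at h1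
  rw [h1, ← integral_sub_right_eq_self (fun u => η (t⁻¹ • u) * g (x + u)) x]
  rw [smul_eq_mul, ← integral_const_mul]
  refine integral_congr_ae (Eventually.of_forall fun z => ?_)
  simp only [scaled_apply η x ht, finrank_euclideanSpace, Fintype.card_fin, add_sub_cancel]
  rw [abs_of_pos (by positivity)]
  ring

theorem pderiv_scaled (η : TestFn d) (x : E d) {t : ℝ} (ht : 0 < t) (k : MIdx d) (y : E d) :
    pderiv k (scaled η x t) y = (t ^ d)⁻¹ * (t ^ deg k)⁻¹ * pderiv k η (t⁻¹ • (y - x)) := by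
  have h1 : (scaled η x t : E d → ℝ) = fun y => (t ^ d)⁻¹ * η (t⁻¹ • (y - x)) :=
    funext fun y => scaled_apply η x ht y
  have h2 : ContDiff ℝ (deg k) fun y => η (t⁻¹ • (y - x)) :=
    (contDiff_testFn η _).comp ((contDiff_id.sub contDiff_const).const_smul _)
  rw [h1, pderiv_const_mul h2 _ k le_rfl,
    pderiv_comp_affine (contDiff_testFn η (deg k)) _ _ k le_rfl]
  simp only [inv_pow]; ring

end

section
variable {d : ℕ}

/-! ### Mollification -/

theorem pderiv_comp_sub {n : ℕ} {f : E d → ℝ} (hf : ContDiff ℝ n f) (a : E d)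
    (k : MIdx d) (h : deg k ≤ n) :
    pderiv k (fun x => f (x - a)) = fun x => pderiv k f (x - a) := by
  simpa using pderiv_comp_affine hf 1 a k h

theorem smoothSnd_translate {r : ℕ} {φ : E d → ℝ} (hφ : ContDiff ℝ r φ) :
    SmoothSnd r fun x y => φ (y - x) := by
  refine ⟨fun x => hφ.comp (contDiff_id.sub contDiff_const), fun l hl => ?_⟩
  simp only [pderiv_comp_sub hφ _ l hl]
  exact (contDiff_pderiv (n := 0) hφ l (by omega)).continuous.comp
    (continuous_snd.sub continuous_fst)

/-- The mollification of `φ` by a bump function. -/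
def mollify (ρ : ContDiffBump (0 : E d)) (φ : E d → ℝ) : E d → ℝ :=
  fun y => ∫ x, ρ.normed volume x * φ (y - x)

theorem contDiff_mollify (ρ : ContDiffBump (0 : E d)) {φ : E d → ℝ} (hφ : Continuous φ) :
    ContDiff ℝ ((⊤ : ℕ∞)) (mollify ρ φ) :=
  ρ.hasCompactSupport_normed.contDiff_convolution_left (ContinuousLinearMap.lsmul ℝ ℝ)
    ρ.contDiff_normed hφ.locallyIntegrable

theorem pderiv_mollify (ρ : ContDiffBump (0 : E d)) {r : ℕ} {φ : E d → ℝ} (hφ : ContDiff ℝ r φ)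
    (k : MIdx d) (hk : deg k ≤ r) : pderiv k (mollify ρ φ) = mollify ρ (pderiv k φ) := by
  unfold mollify
  rw [pderiv_integral_mul ρ.continuous_normed ρ.hasCompactSupport_normed
    (smoothSnd_translate hφ) k hk]
  simp only [pderiv_comp_sub hφ _ k hk]

theorem dist_mollify_le (ρ : ContDiffBump (0 : E d)) {g : E d → ℝ} (hg : Continuous g) {ε : ℝ}
    (x : E d) (h : ∀ y, dist y x < ρ.rOut → dist (g y) (g x) ≤ ε) :
    dist (mollify ρ g x) (g x) ≤ ε :=
  ContDiffBump.dist_normed_convolution_le (φ := ρ) (μ := volume) hg.aestronglyMeasurable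
    fun y hy => h y hy

theorem tsupport_mollify_subset (ρ : ContDiffBump (0 : E d)) {φ : E d → ℝ} {y : E d} {R : ℝ}
    (h : tsupport φ ⊆ Metric.closedBall y R) :
    tsupport (mollify ρ φ) ⊆ Metric.closedBall y (R + ρ.rOut) := by
  refine closure_minimal ?_ Metric.isClosed_closedBall
  intro w hw
  by_contra hn
  apply hw
  refine integral_eq_zero_of_ae (Eventually.of_forall fun x => ?_)
  simp only [Pi.zero_apply, mul_eq_zero]
  by_contra! h2
  have h3 : x ∈ Metric.ball (0 : E d) ρ.rOut := by
    rw [← ρ.support_normed_eq (μ := volume)]; exact h2.1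
  have h4 := h (subset_tsupport _ h2.2)
  simp only [Metric.mem_closedBall, Metric.mem_ball, dist_eq_norm, sub_zero] at h3 h4 hn
  apply hn
  calc ‖w - y‖ = ‖(w - x - y) + x‖ := by congr 1; abel
    _ ≤ ‖w - x - y‖ + ‖x‖ := norm_add_le _ _
    _ ≤ R + ρ.rOut := by linarith

theorem exists_approx {r : ℕ} {φ : E d → ℝ} (hφ : ContDiff ℝ r φ) {y : E d} {R R' : ℝ}
    (hs : tsupport φ ⊆ Metric.closedBall y R) (hR : R < R') :
    ∃ u : ℕ → TestFn d, (∀ n, tsupport (u n) ⊆ Metric.closedBall y R') ∧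
      ∀ k : MIdx d, deg k ≤ r →
        TendstoUniformly (fun n => pderiv k (u n)) (pderiv k φ) atTop := by
  have hc : HasCompactSupport φ :=
    (isCompact_closedBall y R).of_isClosed_subset (isClosed_tsupport φ) hs
  -- The outer radii are at most R' - R, which keeps all supports in the ball of radius R', and they
  -- tend to 0.
  let ρ : ℕ → ContDiffBump (0 : E d) := fun n =>
    ⟨(R' - R) / (n + 2), (R' - R) / (n + 1), by have := sub_pos.2 hR; positivity, by
      have := sub_pos.2 hR
      gcongr; norm_num⟩
  have hsub : ∀ n, tsupport (mollify (ρ n) φ) ⊆ Metric.closedBall y R' := fun n =>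
    (tsupport_mollify_subset (ρ n) hs).trans (Metric.closedBall_subset_closedBall (by
      have h1 : (R' - R) / ((n : ℝ) + 1) ≤ R' - R :=
        div_le_self (sub_pos.2 hR).le (by simp)
      change R + (R' - R) / ((n : ℝ) + 1) ≤ R'
      linarith))
  refine ⟨fun n =>
    { toFun := mollify (ρ n) φ
      contDiff' := contDiff_mollify (ρ n) hφ.continuous
      hasCompactSupport' :=
        (isCompact_closedBall y R').of_isClosed_subset (isClosed_tsupport _) (hsub n)
      tsupport_subset' := fun _ _ => trivial }, hsub, fun k hk => ?_⟩
  have hcont : Continuous (pderiv k φ) := (contDiff_pderiv (n := 0) hφ k (by omega)).continuous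
  have hck : HasCompactSupport (pderiv k φ) :=
    hc.mono' ((subset_tsupport _).trans (tsupport_pderiv_subset k φ))
  have hu : UniformContinuous (pderiv k φ) := hck.uniformContinuous_of_continuous hcont
  rw [Metric.tendstoUniformly_iff]
  intro ε hε
  obtain ⟨δ, hδ, hδ'⟩ := Metric.uniformContinuous_iff.1 hu (ε / 2) (half_pos hε)
  have htend : Tendsto (fun n : ℕ => (R' - R) / ((n : ℝ) + 1)) atTop (𝓝 0) := by
    simpa [div_eq_mul_inv] using
      (tendsto_one_div_add_atTop_nhds_zero_nat (𝕜 := ℝ)).const_mul (R' - R)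
  filter_upwards [htend.eventually (gt_mem_nhds hδ)] with n hn x
  change dist (pderiv k φ x) (pderiv k (mollify (ρ n) φ) x) < ε
  rw [pderiv_mollify (ρ n) hφ k hk, dist_comm]
  refine (dist_mollify_le (ρ n) hcont x fun z hz => (hδ' (hz.trans hn)).le).trans_lt
    (half_lt_self hε)

/-! ### Extension of distributions of finite order -/

/-- Linear functionals of order `r` on test functions. -/
structure FiniteOrder (r : ℕ) (F : TestFn d → ℝ) : Prop where
  map_add : ∀ u v, F (u + v) = F u + F v
  map_smul : ∀ (c : ℝ) u, F (c • u) = c * F u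
  bound : ∀ R : ℝ, ∃ C : ℝ, ∀ (u : TestFn d) (A : ℝ), tsupport u ⊆ Metric.closedBall 0 R →
    (∀ k : MIdx d, deg k ≤ r → ∀ x, |pderiv k u x| ≤ A) → |F u| ≤ C * A

variable {F : TestFn d → ℝ} {r : ℕ}

theorem FiniteOrder.map_sub (hF : FiniteOrder r F) (u v : TestFn d) : F (u - v) = F u - F v := by
  rw [sub_eq_add_neg, hF.map_add, ← neg_one_smul ℝ v, hF.map_smul]; ring

theorem pderiv_sub_testFn (u v : TestFn d) (k : MIdx d) (x : E d) :
    pderiv k (u - v : TestFn d) x = pderiv k u x - pderiv k v x := by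
  have h1 : ((u - v : TestFn d) : E d → ℝ) = fun x => u x + (-1) * v x := by
    funext x; rw [sub_apply]; ring
  rw [h1, pderiv_add (contDiff_testFn u (deg k)) (contDiff_const.mul (contDiff_testFn v (deg k)))
    k le_rfl, pderiv_const_mul (contDiff_testFn v (deg k)) _ k le_rfl]
  ring

/-- The filter is arbitrary so that one statement serves twice: along pairs of indices it makes F(u
n) Cauchy, and along a single index it makes the limit independent of the sequence. -/
theorem FiniteOrder.tendsto_sub (hF : FiniteOrder r F) {φ : E d → ℝ} {ι : Type*} {f : Filter ι}
    {u v : ι → TestFn d} {S : Set (E d)} (hS : IsCompact S) (hu : ∀ n, tsupport (u n) ⊆ S)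
    (hv : ∀ n, tsupport (v n) ⊆ S)
    (hu' : ∀ k : MIdx d, deg k ≤ r → TendstoUniformly (fun n => pderiv k (u n)) (pderiv k φ) f)
    (hv' : ∀ k : MIdx d, deg k ≤ r → TendstoUniformly (fun n => pderiv k (v n)) (pderiv k φ) f) :
    Tendsto (fun n => F (u n) - F (v n)) f (𝓝 0) := by
  obtain ⟨R, hR⟩ := hS.isBounded.subset_closedBall 0
  obtain ⟨C, hC⟩ := hF.bound R
  rw [Metric.tendsto_nhds]
  intro ε hε
  have hδ : 0 < ε / (2 * (|C| + 1)) := by positivity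
  -- Both sequences are taken within ε/(4(|C|+1)) of φ, which leaves ε/2 at the end; |C|+1 is
  -- positive whatever the sign of C.
  have h1 : ∀ k ∈ {k : MIdx d | deg k < r + 1}, ∀ᶠ n in f, ∀ x,
      |pderiv k (u n - v n : TestFn d) x| ≤ 2 * (ε / (4 * (|C| + 1))) := by
    intro k hk
    have hk : deg k ≤ r := Nat.lt_succ_iff.1 hk
    have hδ : 0 < ε / (4 * (|C| + 1)) := by positivity
    filter_upwards [Metric.tendstoUniformly_iff.1 (hu' k hk) _ hδ,
      Metric.tendstoUniformly_iff.1 (hv' k hk) _ hδ] with n h1 h2 x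
    rw [pderiv_sub_testFn]
    have h3 := h1 x
    have h4 := h2 x
    rw [Real.dist_eq, abs_lt] at h3 h4
    rw [abs_le]
    constructor <;> linarith
  filter_upwards [(eventually_all_finite (finite_deg_lt d (r + 1))).2 h1] with n hn
  rw [dist_zero_right, ← hF.map_sub, Real.norm_eq_abs]
  have hsupp : tsupport (u n - v n : TestFn d) ⊆ Metric.closedBall 0 R := by
    refine (closure_minimal ?_ hS.isClosed).trans hR
    intro x hx
    by_contra h
    apply hx
    rw [sub_apply, image_eq_zero_of_notMem_tsupport fun h' => h (hu n h'),
      image_eq_zero_of_notMem_tsupport fun h' => h (hv n h'), sub_zero]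
  refine (hC _ _ hsupp fun k hk x => hn k (Nat.lt_succ_of_le hk) x).trans_lt ?_
  have hx : 2 * (ε / (4 * (|C| + 1))) * (|C| + 1) = ε / 2 := by field_simp; ring
  have : C ≤ |C| := le_abs_self C
  have h0 : 0 ≤ 2 * (ε / (4 * (|C| + 1))) := by positivity
  nlinarith [mul_le_mul_of_nonneg_right (this.trans (by linarith : |C| ≤ |C| + 1)) h0]

/-- Compactly supported functions of class `C^r`. -/
structure IsCrc (r : ℕ) (φ : E d → ℝ) : Prop where
  contDiff : ContDiff ℝ r φ
  compact : HasCompactSupport φ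

theorem IsCrc.exists_ball {φ : E d → ℝ} (hφ : IsCrc r φ) :
    ∃ R, tsupport φ ⊆ Metric.closedBall 0 R :=
  hφ.compact.isCompact.isBounded.subset_closedBall 0

theorem FiniteOrder.mono {r' : ℕ} (hF : FiniteOrder r F) (h : r ≤ r') : FiniteOrder r' F :=
  ⟨hF.map_add, hF.map_smul, fun R => by
    obtain ⟨C, hC⟩ := hF.bound R
    exact ⟨C, fun u A hu hA => hC u A hu fun k hk => hA k (hk.trans h)⟩⟩

/-- Mollification provides one approximating sequence, along which F is Cauchy, and every other
sequence has the same limit. Hence the default value 0 in `extValue` is never taken here. -/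
theorem FiniteOrder.isExtValue_extValue (hF : FiniteOrder r F) {φ : E d → ℝ} (hφ : IsCrc r φ) :
    IsExtValue r F φ (extValue r F φ) := by
  obtain ⟨R, hR⟩ := hφ.exists_ball
  obtain ⟨u, hu, hu'⟩ := exists_approx hφ.contDiff hR (lt_add_one R)
  have hex : ∃ c, IsExtValue r F φ c := by
    have hcau : CauchySeq fun n => F (u n) := by
      rw [Metric.cauchySeq_iff]
      have h1 : Tendsto (fun p : ℕ × ℕ => F (u p.1) - F (u p.2)) (atTop ×ˢ atTop) (𝓝 0) :=
        hF.tendsto_sub (φ := φ) (isCompact_closedBall 0 (R + 1)) (fun p => hu p.1)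
          (fun p => hu p.2)
          (fun k hk => fun V hV => tendsto_fst.eventually (hu' k hk V hV))
          (fun k hk => fun V hV => tendsto_snd.eventually (hu' k hk V hV))
      intro ε hε
      have h2 := (Metric.tendsto_nhds.1 h1 ε hε)
      rw [prod_atTop_atTop_eq, eventually_atTop] at h2
      obtain ⟨⟨a, b⟩, hab⟩ := h2
      refine ⟨max a b, fun m hm n hn => ?_⟩
      have := hab (m, n) ⟨(le_max_left _ _).trans hm, (le_max_right _ _).trans hn⟩
      rwa [dist_zero_right, ← dist_eq_norm] at this
    obtain ⟨c, hc⟩ := cauchySeq_tendsto_of_complete hcau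
    refine ⟨c, fun v S hS hv hv' => ?_⟩
    have h1 := hF.tendsto_sub (hS.union (isCompact_closedBall 0 (R + 1)))
      (fun n => (hv n).trans Set.subset_union_left)
      (fun n => (hu n).trans Set.subset_union_right) hv' hu'
    simpa using h1.add hc
  rw [extValue, dif_pos hex]
  exact hex.choose_spec

theorem FiniteOrder.extValue_eq (hF : FiniteOrder r F) {φ : E d → ℝ} (hφ : IsCrc r φ) {c : ℝ}
    (hc : IsExtValue r F φ c) : extValue r F φ = c := by
  obtain ⟨R, hR⟩ := hφ.exists_ball
  obtain ⟨u, hu, hu'⟩ := exists_approx hφ.contDiff hR (lt_add_one R)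
  exact tendsto_nhds_unique (hF.isExtValue_extValue hφ u _ (isCompact_closedBall _ _) hu hu')
    (hc u _ (isCompact_closedBall _ _) hu hu')

theorem extValue_sum {ι : Type*} [Fintype ι] {G : ι → TestFn d → ℝ} (hG : ∀ i, FiniteOrder r (G i))
    (c : ι → ℝ) (hF : FiniteOrder r F) (h : ∀ u, F u = ∑ i, c i * G i u) {φ : E d → ℝ}
    (hφ : IsCrc r φ) : extValue r F φ = ∑ i, c i * extValue r (G i) φ :=
  hF.extValue_eq hφ fun u S hS hu hu' => by
    simp only [h]
    exact tendsto_finsetSum _ fun i _ =>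
      ((hG i).isExtValue_extValue hφ u S hS hu hu').const_mul (c i)

theorem FiniteOrder.extValue_add_mul (hF : FiniteOrder r F) {φ ψ : E d → ℝ} (hφ : IsCrc r φ)
    (hψ : IsCrc r ψ) (c : ℝ) :
    extValue r F (fun x => φ x + c * ψ x) = extValue r F φ + c * extValue r F ψ := by
  obtain ⟨R, hR⟩ := hφ.exists_ball
  obtain ⟨R', hR'⟩ := hψ.exists_ball
  obtain ⟨u, hu, hu'⟩ := exists_approx hφ.contDiff hR (lt_add_one R)
  obtain ⟨v, hv, hv'⟩ := exists_approx hψ.contDiff hR' (lt_add_one R')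
  have hsum : IsCrc r fun x => φ x + c * ψ x :=
    ⟨hφ.contDiff.add (contDiff_const.mul hψ.contDiff), hφ.compact.add hψ.compact.mul_left⟩
  have hcoe : ∀ n, ((u n + c • v n : TestFn d) : E d → ℝ) = fun x => u n x + c * v n x := fun n => by
    funext x; simp
  have h1 := hF.isExtValue_extValue hφ u _ (isCompact_closedBall _ _) hu hu'
  have h2 := hF.isExtValue_extValue hψ v _ (isCompact_closedBall _ _) hv hv'
  have h3 := hF.isExtValue_extValue hsum (fun n => u n + c • v n) _
    ((isCompact_closedBall 0 (R + 1)).union (isCompact_closedBall 0 (R' + 1)))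
    (fun n => ?_) (fun k hk => ?_)
  · simp only [hF.map_add, hF.map_smul] at h3
    exact tendsto_nhds_unique h3 (h1.add (h2.const_mul c))
  · refine closure_minimal ?_ (Metric.isClosed_closedBall.union Metric.isClosed_closedBall)
    intro x hx
    by_contra h
    apply hx
    rw [hcoe]
    simp only
    rw [image_eq_zero_of_notMem_tsupport fun h' => h (Or.inl (hu n h')),
      image_eq_zero_of_notMem_tsupport fun h' => h (Or.inr (hv n h'))]
    simp
  · have h4 : ∀ n, pderiv k (u n + c • v n : TestFn d)
        = fun x => pderiv k (u n) x + c * pderiv k (v n) x := fun n => by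
      rw [hcoe, pderiv_add (contDiff_testFn _ (deg k))
        (contDiff_const.mul (contDiff_testFn _ (deg k))) k le_rfl,
        pderiv_const_mul (contDiff_testFn _ (deg k)) _ k le_rfl]
    have h5 : pderiv k (fun x => φ x + c * ψ x)
        = fun x => pderiv k φ x + c * pderiv k ψ x := by
      rw [pderiv_add hφ.contDiff (contDiff_const.mul hψ.contDiff) k hk,
        pderiv_const_mul hψ.contDiff _ k hk]
    simp only [h4, h5]
    refine (hu' k hk).add ?_
    exact ((lipschitzWith_smul c).uniformContinuous).comp_tendstoUniformly (hv' k hk)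

/-- A bound on smooth functions passes to the limit of approximants. These satisfy the derivative
bounds only with A + ε and are supported in a slightly larger ball, hence ε → 0 and R < R'. The
weights w allow a different scaling for each order of derivative. -/
theorem abs_extValue_le {r₀ : ℕ} (hF : FiniteOrder r F) (hr : r₀ ≤ r) {φ : E d → ℝ}
    (hφ : ContDiff ℝ r φ) {y : E d} {R R' : ℝ} (hs : tsupport φ ⊆ Metric.closedBall y R)
    (hR : R < R') {w : MIdx d → ℝ} (hw : ∀ k, 0 < w k) {A B : ℝ}
    (hA : ∀ k : MIdx d, deg k ≤ r₀ → ∀ x, |pderiv k φ x| ≤ A * w k)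
    (hB : ∀ (u : TestFn d) (A' : ℝ), tsupport u ⊆ Metric.closedBall y R' →
      (∀ k : MIdx d, deg k ≤ r₀ → ∀ x, |pderiv k u x| ≤ A' * w k) → |F u| ≤ B * A') :
    |extValue r F φ| ≤ B * A := by
  obtain ⟨u, hu, hu'⟩ := exists_approx hφ hs hR
  have hc : IsCrc r φ :=
    ⟨hφ, (isCompact_closedBall y R).of_isClosed_subset (isClosed_tsupport φ) hs⟩
  have h1 := (hF.isExtValue_extValue hc u _ (isCompact_closedBall _ _) hu hu').abs
  have h2 : ∀ ε > 0, |extValue r F φ| ≤ B * (A + ε) := by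
    intro ε hε
    have h3 : ∀ k ∈ {k : MIdx d | deg k < r₀ + 1}, ∀ᶠ n in atTop, ∀ x,
        |pderiv k (u n) x| ≤ (A + ε) * w k := by
      intro k hk
      have hk : deg k ≤ r₀ := Nat.lt_succ_iff.1 hk
      filter_upwards [Metric.tendstoUniformly_iff.1 (hu' k (hk.trans hr)) (ε * w k)
        (mul_pos hε (hw k))] with n hn x
      have h4 := hn x
      have h5 := hA k hk x
      rw [Real.dist_eq, abs_lt] at h4
      rw [abs_le] at h5 ⊢
      constructor <;> linarith
    refine le_of_tendsto h1 ?_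
    filter_upwards [(eventually_all_finite (finite_deg_lt d (r₀ + 1))).2 h3] with n hn
    exact hB _ _ (hu n) fun k hk x => hn k (Nat.lt_succ_of_le hk) x
  have h3 : Tendsto (fun ε : ℝ => B * (A + ε)) (𝓝[>] 0) (𝓝 (B * (A + 0))) :=
    (tendsto_const_nhds.mul (tendsto_const_nhds.add tendsto_id)).mono_left nhdsWithin_le_nhds
  rw [add_zero] at h3
  exact ge_of_tendsto h3 (eventually_mem_nhdsWithin.mono fun ε hε => h2 ε hε)

end

section
variable {d : ℕ} {β ρ : ℝ} {m r : ℕ}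

/-! ### Pieces of the kernel acting on distributions -/

/-- The dyadic scale `2^{-n}`. -/
def dyadic (n : ℕ) : ℝ := 2 ^ (-(n : ℝ))

theorem dyadic_pos (n : ℕ) : 0 < dyadic n := by unfold dyadic; positivity

theorem dyadic_eq_pow (n : ℕ) : dyadic n = (1 / 2) ^ n := by
  rw [dyadic, Real.rpow_neg (by norm_num), Real.rpow_natCast]; simp

theorem dyadic_le_one (n : ℕ) : dyadic n ≤ 1 := by
  rw [dyadic_eq_pow]; exact pow_le_one₀ (by norm_num) (by norm_num)

theorem two_rpow_mul (a : ℝ) (n : ℕ) : (2 : ℝ) ^ (a * n) = dyadic n ^ (-a) := by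
  rw [dyadic, ← Real.rpow_mul (by norm_num)]; congr 1; ring

theorem RegKernel.smoothSnd (K : RegKernel d β m r ρ) (n : ℕ) : SmoothSnd r (K.piece n) :=
  ⟨(K.cmr n).1, fun l hl => by simpa using (K.cmr n).2.2 0 l (by simp) hl⟩

theorem RegKernel.contDiff_pderiv_piece (K : RegKernel d β m r ρ) (n : ℕ) {p : MIdx d}
    (hp : deg p ≤ r) (w : E d) : ContDiff ℝ m fun x => pderiv p (K.piece n x) w :=
  (K.cmr n).2.1 p hp w

theorem RegKernel.pderiv_piece_eq_zero (K : RegKernel d β m r ρ) (n : ℕ) (p : MIdx d) {x w : E d}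
    (h : ρ * dyadic n < ‖x - w‖) : pderiv p (K.piece n x) w = 0 := by
  have h1 : tsupport (K.piece n x) ⊆ Metric.closedBall x (ρ * dyadic n) := by
    refine closure_minimal ?_ Metric.isClosed_closedBall
    intro z hz
    have := K.support n x z hz
    rwa [← dist_eq_norm, dist_comm] at this
  by_contra hne
  have h2 := h1 (tsupport_pderiv_subset p _ (subset_tsupport _ hne))
  rw [Metric.mem_closedBall, dist_comm, dist_eq_norm] at h2
  linarith

theorem RegKernel.pderiv_adjoint (K : RegKernel d β m r ρ) (n : ℕ) (ψ : TestFn d) {p : MIdx d}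
    (hp : deg p ≤ r) :
    pderiv p (K.adjoint n ψ) = fun w => ∫ x, ψ x * pderiv p (K.piece n x) w :=
  pderiv_integral_mul ψ.continuous ψ.hasCompactSupport (K.smoothSnd n) p hp

theorem RegKernel.tsupport_adjoint_subset (K : RegKernel d β m r ρ) (n : ℕ) (ψ : TestFn d)
    {y : E d} {R : ℝ} (h : tsupport ψ ⊆ Metric.closedBall y R) :
    tsupport (K.adjoint n ψ) ⊆ Metric.closedBall y (R + ρ * dyadic n) := by
  refine closure_minimal ?_ Metric.isClosed_closedBall
  intro w hw
  by_contra hn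
  apply hw
  refine integral_eq_zero_of_ae (Eventually.of_forall fun x => ?_)
  simp only [Pi.zero_apply, mul_eq_zero]
  by_contra! h2
  have h3 := K.support n x w h2.2
  have h4 := h (subset_tsupport _ h2.1)
  simp only [Metric.mem_closedBall] at h4 hn
  apply hn
  rw [← dist_eq_norm, dist_comm] at h3
  have := dist_triangle w x y
  change dist w x ≤ ρ * dyadic n at h3
  linarith

theorem exists_tsupport_subset_closedBall (ψ : TestFn d) :
    ∃ R, tsupport ψ ⊆ Metric.closedBall 0 R :=
  ψ.hasCompactSupport.isCompact.isBounded.subset_closedBall 0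

theorem RegKernel.isCrc_adjoint (K : RegKernel d β m r ρ) (n : ℕ) (ψ : TestFn d) :
    IsCrc r (K.adjoint n ψ) := by
  obtain ⟨R, hR⟩ := exists_tsupport_subset_closedBall ψ
  exact ⟨contDiff_integral_mul ψ.continuous ψ.hasCompactSupport (K.smoothSnd n),
    (isCompact_closedBall _ _).of_isClosed_subset (isClosed_tsupport _)
      (K.tsupport_adjoint_subset n ψ hR)⟩

theorem RegKernel.adjoint_add_smul (K : RegKernel d β m r ρ) (n : ℕ) (ψ φ : TestFn d) (c : ℝ) :
    K.adjoint n (ψ + c • φ) = fun y => K.adjoint n ψ y + c * K.adjoint n φ y := by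
  funext y
  have h : Continuous fun x => K.piece n x y :=
    (K.smoothSnd n).continuous.comp (continuous_id.prodMk continuous_const)
  have h1 := integrable_mul_of_hasCompactSupport ψ.continuous ψ.hasCompactSupport h
  have h2 := integrable_mul_of_hasCompactSupport φ.continuous φ.hasCompactSupport h
  unfold RegKernel.adjoint
  rw [← integral_const_mul, ← integral_add h1 (h2.const_mul c)]
  refine integral_congr_ae (Eventually.of_forall fun x => ?_)
  simp; ring

/-- The value `f(𝖪ₙ^* ψ)`. -/
def pieceVal (K : RegKernel d β m r ρ) (F : TestFn d → ℝ) (n : ℕ) (ψ : TestFn d) : ℝ :=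
  extValue r F (K.adjoint n ψ)

section PieceVal

variable (K : RegKernel d β m r ρ) {F : TestFn d → ℝ} (hF : FiniteOrder r F) (n : ℕ)
include hF

theorem pieceVal_add_smul (ψ φ : TestFn d) (c : ℝ) :
    pieceVal K F n (ψ + c • φ) = pieceVal K F n ψ + c * pieceVal K F n φ := by
  rw [pieceVal, K.adjoint_add_smul,
    hF.extValue_add_mul (K.isCrc_adjoint n ψ) (K.isCrc_adjoint n φ)]
  rfl

theorem pieceVal_smul (φ : TestFn d) (c : ℝ) :
    pieceVal K F n (c • φ) = c * pieceVal K F n φ := by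
  have h0 := pieceVal_add_smul K hF n 0 0 1
  have h1 := pieceVal_add_smul K hF n 0 φ c
  simp only [one_smul, add_zero, zero_add, one_mul] at h0 h1
  linarith

theorem pieceVal_sub (ψ φ : TestFn d) :
    pieceVal K F n (ψ - φ) = pieceVal K F n ψ - pieceVal K F n φ := by
  have := pieceVal_add_smul K hF n ψ φ (-1)
  rw [neg_one_smul, ← sub_eq_add_neg] at this
  rw [this]; ring

theorem pieceVal_sum {ι : Type*} (s : Finset ι) (c : ι → ℝ) (φ : ι → TestFn d) :
    pieceVal K F n (∑ i ∈ s, c i • φ i) = ∑ i ∈ s, c i * pieceVal K F n (φ i) := by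
  classical
  induction s using Finset.induction_on with
  | empty =>
    have := pieceVal_smul K hF n 0 0
    simpa using this
  | insert a s ha ih =>
    rw [Finset.sum_insert ha, Finset.sum_insert ha, add_comm, pieceVal_add_smul K hF, ih, add_comm]

end PieceVal

theorem pieceVal_sum_left (K : RegKernel d β m r ρ) {ι : Type*} [Fintype ι]
    {G : ι → TestFn d → ℝ} (hG : ∀ i, FiniteOrder r (G i)) (c : ι → ℝ) {F : TestFn d → ℝ}
    (hF : FiniteOrder r F) (h : ∀ u, F u = ∑ i, c i * G i u) (n : ℕ) (ψ : TestFn d) :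
    pieceVal K F n ψ = ∑ i, c i * pieceVal K (G i) n ψ :=
  extValue_sum hG c hF h (K.isCrc_adjoint n ψ)

/-! ### Consequences of homogeneity -/

theorem abs_le_homNorm {F : E d → TestFn d → ℝ} {S : Set (E d)} {Λ a : ℝ} {r₀ : ℕ}
    (hfin : homNorm S Λ r₀ a F < ⊤) {y : E d} (hy : y ∈ S) {t : ℝ} (ht : 0 < t) (htΛ : t ≤ Λ)
    {φ : TestFn d} (hφ : φ ∈ unitTests d r₀) :
    |F y (scaled φ y t)| ≤ (homNorm S Λ r₀ a F).toReal * t ^ a := by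
  have h1 : ENNReal.ofReal (|F y (scaled φ y t)| / t ^ a) ≤ homNorm S Λ r₀ a F := by
    unfold homNorm
    refine le_iSup₂_of_le y hy (le_iSup₂_of_le t ⟨ht, htΛ⟩ (le_iSup₂_of_le φ hφ le_rfl))
  have h2 := (ENNReal.ofReal_le_iff_le_toReal hfin.ne).1 h1
  rwa [div_le_iff₀ (Real.rpow_pos_of_pos ht a)] at h2

/-- Rescaled to the unit ball and divided by A, the function u becomes a unit test function, so
homogeneity applies to it at scale t. -/
theorem abs_le_of_homNorm {F : E d → TestFn d → ℝ} {S : Set (E d)} {Λ a : ℝ} {r₀ : ℕ}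
    (hfin : homNorm S Λ r₀ a F < ⊤) {y : E d} (hy : y ∈ S)
    (hsmul : ∀ (c : ℝ) u, F y (c • u) = c * F y u) {t : ℝ} (ht : 0 < t)
    (htΛ : t ≤ Λ) {u : TestFn d} (hu : tsupport u ⊆ Metric.closedBall y t) {A : ℝ}
    (hA : ∀ p : MIdx d, deg p ≤ r₀ → ∀ x, |pderiv p u x| ≤ A * (t ^ (d + deg p))⁻¹) :
    |F y u| ≤ (homNorm S Λ r₀ a F).toReal * t ^ a * A := by
  have hA0 : 0 ≤ A := by
    have := (abs_nonneg _).trans (hA 0 (by simp) y)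
    exact nonneg_of_mul_nonneg_left this (by positivity)
  -- For A = 0 no normalisation is possible, but then u = 0.
  rcases hA0.eq_or_lt with h0 | hpos
  · have : u = 0 := by
      ext x
      have := hA 0 (by simp) x
      rw [← h0, zero_mul] at this
      simpa using this
    have h2 := hsmul 0 0
    rw [smul_zero, zero_mul] at h2
    rw [this, h2, ← h0]; simp
  · have ht' : 0 < t⁻¹ := inv_pos.2 ht
    set φ : TestFn d := A⁻¹ • scaled u (-(t⁻¹ • y)) t⁻¹ with hφ
    have hcoe : (φ : E d → ℝ) = fun z => A⁻¹ * scaled u (-(t⁻¹ • y)) t⁻¹ z := by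
      funext z; simp [hφ]
    have hval : ∀ z, φ z = A⁻¹ * (t ^ d * u (t • (z + t⁻¹ • y))) := fun z => by
      rw [hcoe]; simp only [scaled_apply u _ ht']; simp
    have hmem : φ ∈ unitTests d r₀ := by
      constructor
      · refine closure_minimal ?_ Metric.isClosed_closedBall
        intro z hz
        by_contra hn
        apply hz
        rw [hval]
        suffices h : t • (z + t⁻¹ • y) ∉ tsupport u by
          rw [image_eq_zero_of_notMem_tsupport h, mul_zero, mul_zero]
        intro h'
        have h3 := hu h'
        rw [Metric.mem_closedBall, dist_eq_norm, smul_add, smul_smul, mul_inv_cancel₀ ht.ne',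
          one_smul, add_sub_cancel_right, norm_smul, Real.norm_of_nonneg ht.le] at h3
        apply hn
        rw [Metric.mem_closedBall, dist_zero_right]
        nlinarith
      · intro k hk x
        rw [hcoe, pderiv_const_mul (contDiff_testFn _ (deg k)) _ k le_rfl]
        simp only [pderiv_scaled u _ ht', inv_inv, inv_pow]
        have h3 := hA k hk (t • (x - -(t⁻¹ • y)))
        rw [abs_mul, abs_mul, abs_of_pos (inv_pos.2 hpos), abs_of_pos (by positivity),
          inv_mul_le_iff₀ hpos, ← pow_add, mul_one]
        rwa [← div_eq_mul_inv, le_div_iff₀ (by positivity), mul_comm] at h3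
    have hsc : scaled φ y t = A⁻¹ • u := by
      ext z
      rw [scaled_apply φ y ht, hval, smul_apply, smul_eq_mul, smul_add, smul_smul, smul_smul,
        mul_inv_cancel₀ ht.ne', one_smul, one_smul, sub_add_cancel]
      field_simp
    have key := abs_le_homNorm hfin hy ht htΛ hmem
    rw [hsc, hsmul, abs_mul, abs_of_pos (inv_pos.2 hpos), inv_mul_le_iff₀ hpos] at key
    linarith

section Model

variable {I : Type*} [Fintype I] {α : I → ℝ} {rPi : ℕ}

/-- Homogeneity at the single base point x, at a scale Λ ≥ 1 whose ball around x contains the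
support, bounds the functional by derivatives of order at most `rPi`. -/
theorem Model.finiteOrder (M : Model d I α rPi) (i : I) (x : E d) :
    FiniteOrder rPi fun φ => M.pi i x φ := by
  refine ⟨fun u v => map_add _ _ _, fun c u => by simp, fun R => ?_⟩
  set Λ : ℝ := max 1 (R + ‖x‖)
  have hΛ1 : 1 ≤ Λ := le_max_left _ _
  have hΛ : 0 < Λ := by linarith
  refine ⟨(homNorm {x} Λ rPi (α i) fun x φ => M.pi i x φ).toReal * Λ ^ (α i) * Λ ^ (d + rPi),
    fun u A hu hA => ?_⟩
  have hA0 : 0 ≤ A := (abs_nonneg _).trans (hA 0 (by simp) x)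
  have key := abs_le_of_homNorm (M.homogeneous i {x} isCompact_singleton Λ hΛ1)
    (Set.mem_singleton x) (fun c u => by simp) hΛ le_rfl (u := u)
    (hu.trans ?_) (A := A * Λ ^ (d + rPi)) ?_
  · calc _ ≤ _ := key
      _ = _ := by ring
  · intro z hz
    rw [Metric.mem_closedBall, dist_eq_norm] at hz ⊢
    rw [sub_zero] at hz
    exact (norm_sub_le z x).trans ((add_le_add_left hz _).trans (le_max_right _ _))
  · intro p hp z
    refine (hA p hp z).trans ?_
    rw [mul_assoc]
    refine le_mul_of_one_le_right hA0 ?_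
    rw [← div_eq_mul_inv, one_le_div (by positivity)]
    exact pow_le_pow_right₀ hΛ1 (by omega)

/-- The norm of `Π^i`, as a real number. -/
def piReal (ρ : ℝ) (M : Model d I α rPi) (S : Set (E d)) (i : I) : ℝ :=
  (homNorm S (2 * (1 + ρ)) rPi (α i) fun x φ => M.pi i x φ).toReal

theorem piReal_nonneg (M : Model d I α rPi) (S : Set (E d)) (i : I) : 0 ≤ piReal ρ M S i :=
  ENNReal.toReal_nonneg

/-- The constant lost in enlarging supports by the factor `2(1+ρ)`. -/
def enlargeConst (d : ℕ) (ρ a : ℝ) (r₀ : ℕ) : ℝ := (2 * (1 + ρ)) ^ a * (2 * (1 + ρ)) ^ (d + r₀)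

theorem enlargeConst_pos (hρ : 0 < ρ) (a : ℝ) (r₀ : ℕ) : 0 < enlargeConst d ρ a r₀ := by
  unfold enlargeConst; positivity

/-- The function 𝖪ₙ^*ψ lives in the ball of radius (2+ρ)s, since ψ lives in radius 2s and the kernel
adds ρ2^{-n} ≤ ρs. Its smooth approximants fit into radius 2(1+ρ)s, which for s ≤ 1 explains the
range of scales 2(1+ρ) in the norm of Π. -/
theorem abs_pieceVal_le (K : RegKernel d β m r ρ) (M : Model d I α rPi) (hr : rPi ≤ r)
    {S : Set (E d)} (hS : IsCompact S) (i : I) {y : E d} (hy : y ∈ S) {s : ℝ} (hs1 : s ≤ 1)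
    {n : ℕ} (hn : dyadic n ≤ s) {ψ : TestFn d} (hψ : tsupport ψ ⊆ Metric.closedBall y (2 * s))
    {A : ℝ} (hA : ∀ p : MIdx d, deg p ≤ rPi → ∀ w ∈ Metric.closedBall y (2 + ρ),
      |∫ x, ψ x * pderiv p (K.piece n x) w| ≤ A * (s ^ (d + deg p))⁻¹) :
    |pieceVal K (fun φ => M.pi i y φ) n ψ|
      ≤ enlargeConst d ρ (α i) rPi * piReal ρ M S i * s ^ α i * A := by
  have hρ := K.ρ_pos
  have hs : 0 < s := (dyadic_pos n).trans_le hn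
  have hA0 : 0 ≤ A := by
    have := (abs_nonneg _).trans (hA 0 (by simp) y (Metric.mem_closedBall_self (by positivity)))
    exact nonneg_of_mul_nonneg_left this (by positivity)
  have hsupp : tsupport (K.adjoint n ψ) ⊆ Metric.closedBall y ((2 + ρ) * s) :=
    (K.tsupport_adjoint_subset n ψ hψ).trans (Metric.closedBall_subset_closedBall
      (by nlinarith))
  have hR : (2 + ρ) * s < 2 * (1 + ρ) * s := by nlinarith
  refine abs_extValue_le ((M.finiteOrder i y).mono hr) hr (K.isCrc_adjoint n ψ).contDiff hsupp hR
    (w := fun p => (s ^ (d + deg p))⁻¹) (fun p => by positivity) ?_ ?_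
  · intro p hp w
    by_cases hw : w ∈ Metric.closedBall y (2 + ρ)
    · rw [K.pderiv_adjoint n ψ (hp.trans hr)]
      exact hA p hp w hw
    · have h1 : pderiv p (K.adjoint n ψ) w = 0 := by
        by_contra hne
        exact hw (Metric.closedBall_subset_closedBall (by nlinarith)
          (hsupp (tsupport_pderiv_subset p _ (subset_tsupport _ hne))))
      rw [h1, abs_zero]; positivity
  · intro u A' hu hA'
    have hA'0 : 0 ≤ A' := by
      have := (abs_nonneg _).trans (hA' 0 (by simp) y)
      exact nonneg_of_mul_nonneg_left this (by positivity)
    have key := abs_le_of_homNorm (M.homogeneous i S hS (2 * (1 + ρ)) (by linarith))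
      hy (fun c u => by simp) (t := 2 * (1 + ρ) * s) (by positivity)
      (by nlinarith) hu (A := A' * (2 * (1 + ρ)) ^ (d + rPi)) ?_
    · refine key.trans (le_of_eq ?_)
      rw [Real.mul_rpow (by positivity) hs.le]
      unfold enlargeConst piReal; ring
    · intro p hp z
      refine (hA' p hp z).trans ?_
      rw [mul_pow (2 * (1 + ρ)) s, mul_inv, ← mul_assoc]
      refine mul_le_mul_of_nonneg_right ?_ (by positivity)
      rw [mul_assoc]
      refine le_mul_of_one_le_right hA'0 ?_
      rw [← div_eq_mul_inv, one_le_div (by positivity)]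
      exact pow_le_pow_right₀ (by linarith) (by omega)

end Model

end

section
variable {d : ℕ} {β ρ : ℝ} {m r : ℕ}

/-! ### Scale-by-scale estimates -/

theorem exists_bound_midx (f : MIdx d → ℝ) (N : ℕ) :
    ∃ C : ℝ, 0 ≤ C ∧ ∀ p : MIdx d, deg p ≤ N → f p ≤ C := by
  obtain ⟨C, hC⟩ := ((finite_deg_lt d (N + 1)).image f).bddAbove
  exact ⟨max C 0, le_max_right _ _, fun p hp =>
    (hC (Set.mem_image_of_mem f (Nat.lt_succ_of_le hp))).trans (le_max_left _ _)⟩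

/-- The compact set is enlarged so that it contains every point met by the kernel when tested near y
∈ S at scales at most 1; the powers of two are split into the form that `abs_pieceVal_le` expects.
-/
theorem RegKernel.exists_bounds (K : RegKernel d β m r ρ) {S : Set (E d)} (hS : IsCompact S) :
    ∃ c : ℝ, 0 < c ∧ ∀ y ∈ S, ∀ n, ∀ w ∈ Metric.closedBall y (2 + 2 * ρ),
      (∀ k p : MIdx d, deg k ≤ m → deg p ≤ r → ∀ x ∈ Metric.closedBall y (2 + 2 * ρ),
        |pderiv k (fun x' => pderiv p (K.piece n x') w) x|
          ≤ c * dyadic n ^ (β - deg k) * (dyadic n ^ (d + deg p))⁻¹) ∧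
      (∀ q p : MIdx d, deg q ≤ r → deg p ≤ r →
        |∫ x, monomial q (w - x) * pderiv p (K.piece n x) w| ≤ c * dyadic n ^ β) := by
  obtain ⟨c, hc, h1, h2⟩ := K.bounds _ (hS.add (isCompact_closedBall (0 : E d) (2 + 2 * ρ)))
  have hmem : ∀ y ∈ S, ∀ z ∈ Metric.closedBall y (2 + 2 * ρ),
      z ∈ S + Metric.closedBall (0 : E d) (2 + 2 * ρ) := fun y hy z hz =>
    Set.mem_add.2 ⟨y, hy, z - y, by simpa [dist_eq_norm] using hz, by abel⟩
  refine ⟨c, hc, fun y hy n w hw => ⟨fun k p hk hp x hx => ?_, fun q p hq hp => ?_⟩⟩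
  · refine (h1 n k p hk hp x (hmem y hy x hx) w (hmem y hy w hw)).trans (le_of_eq ?_)
    rw [two_rpow_mul, mul_assoc, ← Real.rpow_natCast (dyadic n), ← Real.rpow_neg (dyadic_pos n).le,
      ← Real.rpow_add (dyadic_pos n)]
    congr 2; push_cast; ring
  · refine (h2 n p q hp hq w (hmem y hy w hw)).trans (le_of_eq ?_)
    rw [two_rpow_mul, neg_neg]

/-- The test function that represents `D^k f` tested against `η_x^t`. -/
def dtest (η : TestFn d) (k : MIdx d) (x : E d) (t : ℝ) : TestFn d :=
  (-1 : ℝ) ^ deg k • tderiv k (scaled η x t)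

theorem dtest_apply (η : TestFn d) (k : MIdx d) (x : E d) (t : ℝ) (z : E d) :
    dtest η k x t z = (-1) ^ deg k * pderiv k (scaled η x t) z := by
  rw [dtest, smul_apply, coe_tderiv, smul_eq_mul]

theorem integral_dtest_mul (η : TestFn d) {n : ℕ} {h : E d → ℝ} (hh : ContDiff ℝ n h)
    (k : MIdx d) (hk : deg k ≤ n) (x : E d) {t : ℝ} (ht : 0 < t) :
    ∫ z, dtest η k x t z * h z = ∫ z, η z * pderiv k h (x + t • z) := by
  rw [← integral_scaled_mul η x ht]
  have h1 : ∀ z, dtest η k x t z * h z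
      = (-1) ^ deg k * (tderiv k (scaled η x t) z * h z) := fun z => by
    rw [dtest, smul_apply, smul_eq_mul, mul_assoc]
  simp only [h1]
  rw [integral_const_mul, integral_tderiv_mul _ hh k hk, ← mul_assoc, ← mul_pow]
  simp

theorem tsupport_scaled_subset {η : TestFn d} (hη : tsupport η ⊆ Metric.closedBall 0 1) (x : E d)
    {t : ℝ} (ht : 0 < t) : tsupport (scaled η x t) ⊆ Metric.closedBall x t := by
  refine closure_minimal ?_ Metric.isClosed_closedBall
  intro z hz
  by_contra hn
  apply hz
  rw [scaled_apply η x ht]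
  suffices h : t⁻¹ • (z - x) ∉ tsupport η by
    rw [image_eq_zero_of_notMem_tsupport h, mul_zero]
  intro h'
  have h3 := hη h'
  rw [Metric.mem_closedBall, dist_zero_right, norm_smul, norm_inv, Real.norm_of_nonneg ht.le,
    inv_mul_le_iff₀ ht, mul_one, ← dist_eq_norm] at h3
  exact hn h3

theorem tsupport_dtest_subset {η : TestFn d} (hη : tsupport η ⊆ Metric.closedBall 0 1)
    (k : MIdx d) (x : E d) {t : ℝ} (ht : 0 < t) :
    tsupport (dtest η k x t) ⊆ Metric.closedBall x t := by
  refine Set.Subset.trans ?_ ((tsupport_pderiv_subset k _).trans (tsupport_scaled_subset hη x ht))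
  refine closure_minimal ?_ (isClosed_tsupport _)
  intro z hz
  refine subset_tsupport _ ?_
  intro h0
  apply hz
  rw [dtest_apply, h0, mul_zero]

/-- The `L^1` norm of a test function. -/
def lOne (η : TestFn d) : ℝ := ∫ z, |η z|

theorem lOne_nonneg (η : TestFn d) : 0 ≤ lOne η := integral_nonneg fun _ => abs_nonneg _

theorem integrable_testFn_mul (η : TestFn d) {g : E d → ℝ} (hg : Continuous g) :
    Integrable fun z => η z * g z :=
  integrable_mul_of_hasCompactSupport η.continuous η.hasCompactSupport hg

theorem integrable_testFn (η : TestFn d) : Integrable fun z => η z :=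
  η.continuous.integrable_of_hasCompactSupport η.hasCompactSupport

theorem abs_integral_testFn_mul_le {η : TestFn d} (hη : tsupport η ⊆ Metric.closedBall 0 1)
    {g : E d → ℝ} {B : ℝ} (hB : ∀ z ∈ Metric.closedBall (0 : E d) 1, |g z| ≤ B) :
    |∫ z, η z * g z| ≤ lOne η * B := by
  rw [lOne, ← integral_mul_const, ← Real.norm_eq_abs]
  refine norm_integral_le_of_norm_le ((integrable_testFn η).abs.mul_const B)
    (Eventually.of_forall fun z => ?_)
  rw [norm_mul, Real.norm_eq_abs, Real.norm_eq_abs]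
  by_cases hz : z ∈ tsupport η
  · exact mul_le_mul_of_nonneg_left (hB z (hη hz)) (abs_nonneg _)
  · simp [image_eq_zero_of_notMem_tsupport hz]

theorem gamPoly_add_right (x y u : E d) (l k : MIdx d) :
    gamPoly (x + u) (y + u) l k = gamPoly x y l k := by
  simp [gamPoly]

theorem add_smul_mem_closedBall {y z : E d} (hz : z ∈ Metric.closedBall (0 : E d) 1) {t : ℝ}
    (ht : 0 < t) : y + t • z ∈ Metric.closedBall y t := by
  rw [mem_closedBall_zero_iff] at hz
  rw [Metric.mem_closedBall, dist_eq_norm, add_sub_cancel_left, norm_smul,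
    Real.norm_of_nonneg ht.le]
  exact mul_le_of_le_one_right ht.le hz

section Estimates

variable {I : Type*} [Fintype I] {α : I → ℝ} {rPi : ℕ}

/-- Integration by parts moves the derivatives onto h. Since Γ^poly depends only on x - y, the shift
by λz is common to both points, and the integrand is a Taylor remainder based at y + λz. -/
theorem integral_taylor_mul (η : TestFn d) {N : ℕ} {h : E d → ℝ} (hh : ContDiff ℝ N h) (t : ℕ)
    (l : MIdx d) (hN : max t (deg l) ≤ N) (x y : E d) {lam : ℝ} (hlam : 0 < lam) :
    ∫ z, (dtest η l x lam - ∑ k : Poly d t, gamPoly x y l k • dtest η k y lam : TestFn d) z * h z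
      = ∫ z, η z * taylorRem h t (y + lam • z) l (x + lam • z) := by
  have hcd : ∀ k : MIdx d, deg k ≤ N → ∀ x, Continuous fun z : E d => pderiv k h (x + lam • z) :=
    fun k hk x => (contDiff_pderiv (n := 0) hh k (by omega)).continuous.comp
      (continuous_const.add (continuous_id.const_smul lam))
  have hkt : ∀ k : Poly d t, deg (k : MIdx d) ≤ N := fun k => by
    have : deg (k : MIdx d) < t := by exact_mod_cast k.2
    omega
  have e1 : ∀ z, (dtest η l x lam - ∑ k : Poly d t, gamPoly x y l k • dtest η k y lam : TestFn d) z
      * h z = dtest η l x lam z * h z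
        - ∑ k : Poly d t, gamPoly x y l k * (dtest η k y lam z * h z) := fun z => by
    rw [sub_apply, sum_apply, sub_mul, Finset.sum_mul]
    congr 1
    refine Finset.sum_congr rfl fun k _ => ?_
    rw [smul_apply, smul_eq_mul, mul_assoc]
  have e2 : ∀ z, η z * taylorRem h t (y + lam • z) l (x + lam • z)
      = η z * pderiv l h (x + lam • z)
        - ∑ k : Poly d t, gamPoly x y l k * (η z * pderiv k h (y + lam • z)) := fun z => by
    rw [taylorRem, mul_sub, Finset.mul_sum]
    congr 1
    refine Finset.sum_congr rfl fun k _ => ?_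
    rw [gamPoly_add_right]; ring
  simp only [e1, e2]
  rw [integral_sub (integrable_testFn_mul _ hh.continuous)
      (integrable_finsetSum _ fun k _ => (integrable_testFn_mul _ hh.continuous).const_mul _),
    integral_sub (integrable_testFn_mul _ (hcd l (by omega) x))
      (integrable_finsetSum _ fun (k : Poly d t) _ =>
        (integrable_testFn_mul _ (hcd k (hkt k) y)).const_mul _),
    integral_finsetSum _ fun k _ => (integrable_testFn_mul _ hh.continuous).const_mul _,
    integral_finsetSum _ fun (k : Poly d t) _ =>
      (integrable_testFn_mul _ (hcd k (hkt k) y)).const_mul _,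
    integral_dtest_mul η hh l (by omega) x hlam]
  congr 1
  refine Finset.sum_congr rfl fun k _ => ?_
  rw [integral_const_mul, integral_const_mul, integral_dtest_mul η hh k (hkt k) y hlam]

/-- For a piece that is coarse relative to |x-y| and λ, the combination of test functions acts on 𝖪ₙ
as a Taylor remainder in the first variable. It gains |x-y|^{t-|l|} at the price of max(t,|l|)
derivatives, each costing 2^n. -/
theorem exists_taylor_bound (K : RegKernel d β m r ρ) (hr : rPi ≤ r) {S : Set (E d)}
    (hS : IsCompact S) {η : TestFn d} (hη : tsupport η ⊆ Metric.closedBall 0 1) (i : I) :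
    ∃ C : ℝ, 0 ≤ C ∧ ∀ M : Model d I α rPi, ∀ (t : ℕ) (l : MIdx d), max t (deg l) ≤ m →
      ∀ y ∈ S, ∀ (x : E d) (n : ℕ) (lam : ℝ), ‖x - y‖ ≤ dyadic n → 0 < lam → lam ≤ dyadic n →
      |pieceVal K (fun φ => M.pi i y φ) n (dtest η l x lam)
        - ∑ k : Poly d t, gamPoly x y l k * pieceVal K (fun φ => M.pi i y φ) n (dtest η k y lam)|
      ≤ C * piReal ρ M S i * ‖x - y‖ ^ (t - deg l)
          * dyadic n ^ (α i + β - (max t (deg l) : ℕ)) := by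
  obtain ⟨c, hc, hK⟩ := K.exists_bounds hS
  have hρ := K.ρ_pos
  -- The factor (d+1)^m dominates the Taylor constants d^{t-|l|} for all admissible t and l at once.
  refine ⟨enlargeConst d ρ (α i) rPi * (lOne η * ((d + 1) ^ m * c)), ?_, ?_⟩
  · have := lOne_nonneg η
    have := (enlargeConst_pos (d := d) hρ (α i) rPi).le
    positivity
  intro M t l htl y hy x n lam hxy hlam hlamn
  have hs := dyadic_pos n
  have hs1 := dyadic_le_one n
  have hF := (M.finiteOrder i y).mono hr
  rw [← pieceVal_sum K hF, ← pieceVal_sub K hF]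
  refine (abs_pieceVal_le K M hr hS i hy hs1 le_rfl (ψ := _)
    (A := lOne η * ((d + 1) ^ m * ‖x - y‖ ^ (t - deg l)
      * (c * dyadic n ^ (β - (max t (deg l) : ℕ))))) ?_ ?_).trans (le_of_eq ?_)
  · refine closure_minimal ?_ Metric.isClosed_closedBall
    intro z hz
    by_contra hn
    apply hz
    have hl : lam ≤ 2 * dyadic n := by linarith
    have h1 : ∀ k, dtest η k y lam z = 0 := fun k => image_eq_zero_of_notMem_tsupport fun h' => hn
      (Metric.closedBall_subset_closedBall hl (tsupport_dtest_subset hη k y hlam h'))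
    have h2 : dtest η l x lam z = 0 := image_eq_zero_of_notMem_tsupport fun h' => hn (by
      have h3 := tsupport_dtest_subset hη l x hlam h'
      rw [Metric.mem_closedBall] at h3 ⊢
      rw [← dist_eq_norm] at hxy
      linarith [dist_triangle z x y])
    rw [sub_apply, sum_apply, h2, Finset.sum_eq_zero, sub_zero]
    intro k _
    rw [smul_apply, h1, smul_zero]
  · intro p hp w hw
    have hw' : w ∈ Metric.closedBall y (2 + 2 * ρ) :=
      Metric.closedBall_subset_closedBall (by linarith) hw
    have hh := K.contDiff_pderiv_piece n (hp.trans hr) w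
    rw [integral_taylor_mul η hh t l htl x y hlam, mul_assoc]
    refine abs_integral_testFn_mul_le hη fun z hz => ?_
    have hyz := add_smul_mem_closedBall (y := y) hz hlam
    have hxz := add_smul_mem_closedBall (y := x) hz hlam
    have hsub : segment ℝ (y + lam • z) (x + lam • z) ⊆ Metric.closedBall y (2 + 2 * ρ) := by
      refine (convex_closedBall y _).segment_subset ?_ ?_
      · exact Metric.closedBall_subset_closedBall (by linarith) hyz
      · rw [Metric.mem_closedBall] at hxz ⊢
        rw [← dist_eq_norm] at hxy
        linarith [dist_triangle (x + lam • z) x y]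
    refine (abs_taylorRem_le hh t _ _ l htl (M := c * dyadic n ^ (β - (max t (deg l) : ℕ))
      * (dyadic n ^ (d + deg p))⁻¹) (by positivity) ?_).trans ?_
    · intro k hk u hu
      have := (hK y hy n w hw').1 k p (by omega) (hp.trans hr) u (hsub hu)
      rwa [hk] at this
    · rw [add_sub_add_right_eq_sub]
      have h3 : (d : ℝ) ^ (t - deg l) ≤ (d + 1) ^ m :=
        (pow_le_pow_left₀ (by positivity) (by linarith) _).trans
          (pow_le_pow_right₀ (by linarith [(Nat.cast_nonneg d : (0 : ℝ) ≤ d)]) (by omega))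
      calc _ ≤ ((d : ℝ) + 1) ^ m * ‖x - y‖ ^ (t - deg l)
            * (c * dyadic n ^ (β - (max t (deg l) : ℕ)) * (dyadic n ^ (d + deg p))⁻¹) := by gcongr
        _ = _ := by ring
  · rw [show α i + β - (max t (deg l) : ℕ) = α i + (β - (max t (deg l) : ℕ)) by ring,
      Real.rpow_add hs]
    ring

theorem abs_integral_sub_le {η : TestFn d} (hη : tsupport η ⊆ Metric.closedBall 0 1)
    (hη1 : ∫ z, η z = 1) {N : ℕ} {h : E d → ℝ} (hh : ContDiff ℝ N h) (k : MIdx d)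
    (hk : deg k + 1 ≤ N) (y : E d) {lam : ℝ} (hlam : 0 < lam) {B : ℝ} (hB0 : 0 ≤ B)
    (hB : ∀ k' : MIdx d, deg k' = deg k + 1 → ∀ z ∈ Metric.closedBall y lam,
      |pderiv k' h z| ≤ B) :
    |(∫ z, η z * pderiv k h (y + lam • z)) - pderiv k h y| ≤ lOne η * (d * lam * B) := by
  have hcd : Continuous fun z : E d => pderiv k h (y + lam • z) :=
    (contDiff_pderiv (n := 0) hh k (by omega)).continuous.comp
      (continuous_const.add (continuous_id.const_smul lam))
  have h1 : (∫ z, η z * pderiv k h (y + lam • z)) - pderiv k h y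
      = ∫ z, η z * (pderiv k h (y + lam • z) - pderiv k h y) := by
    simp only [mul_sub]
    rw [integral_sub (integrable_testFn_mul _ hcd) (integrable_testFn_mul _ continuous_const),
      integral_mul_const, hη1, one_mul]
  rw [h1]
  refine abs_integral_testFn_mul_le hη fun z hz => ?_
  have hyz := add_smul_mem_closedBall (y := y) hz hlam
  have hsub : segment ℝ y (y + lam • z) ⊆ Metric.closedBall y lam :=
    (convex_closedBall y _).segment_subset (Metric.mem_closedBall_self hlam.le) hyz
  have hf : ∀ u, DifferentiableAt ℝ (pderiv k h) u := fun u =>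
    (contDiff_pderiv (n := 1) hh k hk).differentiable (by norm_num) u
  have := (convex_segment y (y + lam • z)).norm_image_sub_le_of_norm_fderiv_le (f := pderiv k h)
    (C := d * B) (fun u _ => hf u) (fun u hu => opNorm_le_of_basisVec _ hB0 fun j => by
      rw [fderiv_pderiv_basisVec hh k j hk]
      exact hB _ (by simp) u (hsub hu)) (left_mem_segment ℝ _ _) (right_mem_segment ℝ _ _)
  rw [Real.norm_eq_abs] at this
  refine this.trans ?_
  rw [Metric.mem_closedBall, dist_eq_norm] at hyz
  calc d * B * ‖y + lam • z - y‖ ≤ d * B * lam := by gcongr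
    _ = d * lam * B := by ring

/-- Both test functions have mass one, so each returns the derivative of 𝖪ₙ at y up to a first-order
error. The values cancel, and the errors cost one further derivative, 2^n, against the factor max a
b. -/
theorem exists_change_bound (K : RegKernel d β m r ρ) (hr : rPi ≤ r) {S : Set (E d)}
    (hS : IsCompact S) {η η' : TestFn d} (hη : tsupport η ⊆ Metric.closedBall 0 1)
    (hη1 : ∫ z, η z = 1) (hη' : tsupport η' ⊆ Metric.closedBall 0 1) (hη1' : ∫ z, η' z = 1)
    (i : I) :
    ∃ C : ℝ, 0 ≤ C ∧ ∀ M : Model d I α rPi, ∀ k : MIdx d, deg k + 1 ≤ m →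
      ∀ y ∈ S, ∀ (n : ℕ) (a b : ℝ), 0 < a → a ≤ dyadic n → 0 < b → b ≤ dyadic n →
      |pieceVal K (fun φ => M.pi i y φ) n (dtest η k y a)
        - pieceVal K (fun φ => M.pi i y φ) n (dtest η' k y b)|
      ≤ C * piReal ρ M S i * max a b * dyadic n ^ (α i + β - deg k - 1) := by
  obtain ⟨c, hc, hK⟩ := K.exists_bounds hS
  have hρ := K.ρ_pos
  refine ⟨enlargeConst d ρ (α i) rPi * ((lOne η + lOne η') * (d * c)), ?_, ?_⟩
  · have := lOne_nonneg η
    have := lOne_nonneg η'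
    have := (enlargeConst_pos (d := d) hρ (α i) rPi).le
    positivity
  intro M k hkm y hy n a b ha han hb hbn
  have hs := dyadic_pos n
  have hs1 := dyadic_le_one n
  have hF := (M.finiteOrder i y).mono hr
  have hL := lOne_nonneg η
  have hL' := lOne_nonneg η'
  rw [← pieceVal_sub K hF]
  refine (abs_pieceVal_le K M hr hS i hy hs1 le_rfl (ψ := _)
    (A := (lOne η + lOne η') * (d * max a b * (c * dyadic n ^ (β - (deg k + 1 : ℕ))))) ?_
    ?_).trans (le_of_eq ?_)
  · refine closure_minimal ?_ Metric.isClosed_closedBall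
    intro z hz
    by_contra hn
    apply hz
    rw [sub_apply, image_eq_zero_of_notMem_tsupport fun h' => hn
      (Metric.closedBall_subset_closedBall (by linarith) (tsupport_dtest_subset hη k y ha h')),
      image_eq_zero_of_notMem_tsupport fun h' => hn
      (Metric.closedBall_subset_closedBall (by linarith) (tsupport_dtest_subset hη' k y hb h')),
      sub_zero]
  · intro p hp w hw
    have hw' : w ∈ Metric.closedBall y (2 + 2 * ρ) :=
      Metric.closedBall_subset_closedBall (by linarith) hw
    have hh := K.contDiff_pderiv_piece n (hp.trans hr) w
    set h := fun x => pderiv p (K.piece n x) w with hdef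
    have e1 : ∀ z, (dtest η k y a - dtest η' k y b : TestFn d) z * h z
        = dtest η k y a z * h z - dtest η' k y b z * h z := fun z => by
      rw [sub_apply, sub_mul]
    change |∫ z, (dtest η k y a - dtest η' k y b : TestFn d) z * h z| ≤ _
    simp only [e1]
    rw [integral_sub (integrable_testFn_mul _ hh.continuous)
      (integrable_testFn_mul _ hh.continuous), integral_dtest_mul η hh k (by omega) y ha,
      integral_dtest_mul η' hh k (by omega) y hb]
    set B := c * dyadic n ^ (β - (deg k + 1 : ℕ)) * (dyadic n ^ (d + deg p))⁻¹ with hB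
    have hB0 : 0 ≤ B := by positivity
    have hBd : ∀ a, a ≤ dyadic n → ∀ k' : MIdx d, deg k' = deg k + 1 →
        ∀ z ∈ Metric.closedBall y a, |pderiv k' h z| ≤ B := by
      intro a ha k' hk' z hz
      have := (hK y hy n w hw').1 k' p (by omega) (hp.trans hr) z
        (Metric.closedBall_subset_closedBall (by linarith) hz)
      rwa [hk'] at this
    have h1 := abs_integral_sub_le hη hη1 hh k hkm y ha hB0 (hBd a han)
    have h2 := abs_integral_sub_le hη' hη1' hh k hkm y hb hB0 (hBd b hbn)
    have h3 : lOne η * (d * a * B) ≤ lOne η * (d * max a b * B) := by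
      gcongr; exact le_max_left _ _
    have h4 : lOne η' * (d * b * B) ≤ lOne η' * (d * max a b * B) := by
      gcongr; exact le_max_right _ _
    have h5 : (lOne η + lOne η') * (d * max a b * (c * dyadic n ^ (β - (deg k + 1 : ℕ))))
        * (dyadic n ^ (d + deg p))⁻¹
        = lOne η * (d * max a b * B) + lOne η' * (d * max a b * B) := by rw [hB]; ring
    rw [h5]
    rw [abs_le] at h1 h2 ⊢
    constructor <;> linarith
  · rw [show α i + β - deg k - 1 = α i + (β - (deg k + 1 : ℕ)) by push_cast; ring,
      Real.rpow_add hs]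
    ring

theorem pderiv_pderiv {n : ℕ} {f : E d → ℝ} (hf : ContDiff ℝ n f) (q k : MIdx d)
    (h : deg q + deg k ≤ n) : pderiv q (pderiv k f) = pderiv (q + k) f := by
  induction q using midx_induction with
  | h0 => simp
  | h1 q j ih =>
    simp only [deg_add, deg_idx] at h
    rw [pderiv_add_idx (contDiff_pderiv (n := deg q + 1) hf k (by omega)) q j le_rfl,
      ih (by omega), show q + idx j + k = q + k + idx j by abel,
      pderiv_add_idx hf (q + k) j (by simp; omega)]

theorem abs_pderiv_dtest_le (η : TestFn d) (k q : MIdx d) {B : ℝ}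
    (hB : ∀ z, |pderiv (q + k) η z| ≤ B) (y : E d) {t : ℝ} (ht : 0 < t) (z : E d) :
    |pderiv q (dtest η k y t) z| ≤ B * (t ^ (d + deg k + deg q))⁻¹ := by
  have h1 : (dtest η k y t : E d → ℝ) = fun z => (-1) ^ deg k * pderiv k (scaled η y t) z :=
    funext fun z => dtest_apply η k y t z
  have hs := contDiff_testFn (scaled η y t) (deg q + deg k)
  rw [h1, pderiv_const_mul (contDiff_pderiv (n := deg q) hs k (by omega)) _ q le_rfl,
    pderiv_pderiv hs q k le_rfl]
  simp only [abs_mul, abs_pow, abs_neg, abs_one, one_pow, one_mul, pderiv_scaled η y ht, deg_add]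
  rw [abs_of_pos (by positivity : 0 < (t ^ d)⁻¹), abs_of_pos (by positivity :
    0 < (t ^ (deg q + deg k))⁻¹), mul_comm B, ← mul_inv, ← pow_add,
    show d + (deg q + deg k) = d + deg k + deg q by ring]
  exact mul_le_mul_of_nonneg_left (hB _) (by positivity)

theorem exists_pderiv_bound (η : TestFn d) (k : MIdx d) (N : ℕ) :
    ∃ B : ℝ, 0 ≤ B ∧ ∀ q : MIdx d, deg q ≤ N → ∀ z, |pderiv (q + k) η z| ≤ B := by
  have h1 : ∀ q : MIdx d, ∃ B, ∀ z, |pderiv q η z| ≤ B := fun q => by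
    have hc : Continuous (pderiv q η) :=
      (contDiff_pderiv (n := 0) (contDiff_testFn η (deg q)) q (by omega)).continuous
    have hcs : HasCompactSupport (pderiv q η) :=
      η.hasCompactSupport.mono' ((subset_tsupport _).trans (tsupport_pderiv_subset q η))
    exact hcs.exists_bound_of_continuous hc
  choose B hB using h1
  obtain ⟨C, hC, hC'⟩ := exists_bound_midx (fun q => B (q + k)) N
  exact ⟨C, hC, fun q hq z => (hB _ z).trans (hC' q hq)⟩

theorem monomial_neg_sub (q : MIdx d) (x w : E d) :
    monomial q (x - w) = (-1) ^ deg q * monomial q (w - x) := by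
  unfold monomial deg
  rw [← Finset.prod_pow_eq_pow_sum, ← Finset.prod_mul_distrib]
  refine Finset.prod_congr rfl fun i _ => ?_
  rw [← mul_pow]; congr 1; simp

/-- Here ψ varies slowly relative to 𝖪ₙ, so it is Taylor expanded at w to order |p|. The polynomial
part meets the moment bounds of the kernel. The remainder is O(2^{-n|p|}) on a ball of volume
O(2^{-nd}), which cancels the growth 2^{n(d+|p|)} of ∂₂^p 𝖪ₙ. -/
theorem abs_integral_mul_pderiv_piece_le (K : RegKernel d β m r ρ) {c : ℝ}
    (hc : 0 < c) {y : E d} {n : ℕ} {w : E d} (hw : w ∈ Metric.closedBall y (2 + ρ))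
    {p : MIdx d} (hp : deg p ≤ r)
    (h1 : ∀ x ∈ Metric.closedBall y (2 + 2 * ρ), |pderiv p (K.piece n x) w|
          ≤ c * dyadic n ^ β * (dyadic n ^ (d + deg p))⁻¹)
    (h2 : ∀ q : MIdx d, deg q ≤ r → |∫ x, monomial q (w - x) * pderiv p (K.piece n x) w|
          ≤ c * dyadic n ^ β)
    (ψ : TestFn d) {B : ℝ} (hB : ∀ q : MIdx d, deg q ≤ deg p → ∀ z, |pderiv q ψ z| ≤ B) :
    |∫ x, ψ x * pderiv p (K.piece n x) w| ≤ (Fintype.card (Poly d (deg p))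
      + d ^ deg p * ρ ^ (deg p + d) * volume.real (Metric.ball (0 : E d) 1))
        * (B * (c * dyadic n ^ β)) := by
  have hρ := K.ρ_pos
  have hs := dyadic_pos n
  have hs1 := dyadic_le_one n
  have hB0 : 0 ≤ B := (abs_nonneg _).trans (hB 0 (by simp) y)
  set g := fun x => pderiv p (K.piece n x) w with hg
  have hgc : Continuous g := (K.contDiff_pderiv_piece n hp w).continuous
  have hg0 : ∀ x, x ∉ Metric.closedBall w (ρ * dyadic n) → g x = 0 := fun x hx =>
    K.pderiv_piece_eq_zero n p (by rwa [Metric.mem_closedBall, not_le, dist_eq_norm] at hx)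
  have hgs : HasCompactSupport g := HasCompactSupport.intro (isCompact_closedBall _ _) hg0
  have hmul : ∀ f : E d → ℝ, Continuous f → Integrable fun x => f x * g x := fun f hf =>
    (hf.mul hgc).integrable_of_hasCompactSupport hgs.mul_left
  have hgp : ∀ q : MIdx d, Continuous fun x => gamPoly x w 0 q := fun q =>
    continuous_iff_continuousAt.2 fun x =>
      (hasFDerivAt_gamPoly_basisVec x w 0 q).choose_spec.1.continuousAt
  set R := taylorRem ψ (deg p) w 0 with hR
  have hRe : ∀ x, ψ x = (∑ q : Poly d (deg p), gamPoly x w 0 q * pderiv q ψ w) + R x := fun x => by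
    rw [hR, taylorRem, pderiv_zero]; ring
  have hRc : Continuous R := by
    have : R = fun x => ψ x - ∑ q : Poly d (deg p), gamPoly x w 0 q * pderiv q ψ w := by
      funext x; rw [hRe x]; ring
    rw [this]
    exact ψ.continuous.sub (continuous_finsetSum _ fun q _ => (hgp q).mul continuous_const)
  have hsplit : ∫ x, ψ x * g x
      = (∑ q : Poly d (deg p), pderiv q ψ w * ∫ x, gamPoly x w 0 q * g x) + ∫ x, R x * g x := by
    have e : ∀ x, ψ x * g x
        = (∑ q : Poly d (deg p), pderiv q ψ w * (gamPoly x w 0 q * g x)) + R x * g x := fun x => by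
      conv_lhs => rw [hRe x]
      rw [add_mul, Finset.sum_mul]
      congr 1
      exact Finset.sum_congr rfl fun q _ => by ring
    simp only [e]
    rw [integral_add (integrable_finsetSum _ fun (q : Poly d (deg p)) _ => (hmul _ (hgp q)).const_mul _) (hmul _ hRc),
      integral_finsetSum _ fun (q : Poly d (deg p)) _ => (hmul _ (hgp q)).const_mul _]
    simp only [integral_const_mul]
  have hpoly : ∀ q : Poly d (deg p), |∫ x, gamPoly x w 0 q * g x| ≤ c * dyadic n ^ β := by
    intro q
    have hq : deg (q : MIdx d) < deg p := by exact_mod_cast q.2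
    have e : ∀ x, gamPoly x w 0 q * g x = ((-1) ^ deg (q : MIdx d) /
        ∏ i, (((q : MIdx d) i).factorial : ℝ)) * (monomial q (w - x) * g x) := fun x => by
      rw [gamPoly, if_pos (show (0 : MIdx d) ≤ (q : MIdx d) from fun i => Nat.zero_le _), tsub_zero, monomial_neg_sub]
      simp only [Pi.zero_apply, tsub_zero]
      ring
    simp only [e]
    rw [integral_const_mul, abs_mul, abs_div, abs_pow, abs_neg, abs_one, one_pow]
    have h3 : (1 : ℝ) ≤ ∏ i, (((q : MIdx d) i).factorial : ℝ) := by
      exact_mod_cast Nat.one_le_iff_ne_zero.2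
        (Finset.prod_ne_zero_iff.2 fun i _ => Nat.factorial_ne_zero _)
    refine (mul_le_of_le_one_left (abs_nonneg _) ?_).trans (h2 q (by omega))
    rw [abs_of_pos (by linarith)]
    exact div_le_one_of_le₀ h3 (by linarith)
  have hrem : |∫ x, R x * g x| ≤ d ^ deg p * ρ ^ (deg p + d)
      * volume.real (Metric.ball (0 : E d) 1) * (B * (c * dyadic n ^ β)) := by
    have e : ∫ x, R x * g x = ∫ x in Metric.closedBall w (ρ * dyadic n), R x * g x := by
      rw [setIntegral_eq_integral_of_forall_compl_eq_zero]
      intro x hx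
      rw [hg0 x hx, mul_zero]
    rw [e, ← Real.norm_eq_abs]
    refine (norm_setIntegral_le_of_norm_le_const (measure_closedBall_lt_top)
      (C := d ^ deg p * (ρ * dyadic n) ^ deg p * B
        * (c * dyadic n ^ β * (dyadic n ^ (d + deg p))⁻¹)) ?_).trans (le_of_eq ?_)
    · intro x hx
      rw [norm_mul, Real.norm_eq_abs, Real.norm_eq_abs]
      have hx' : ‖x - w‖ ≤ ρ * dyadic n := by rwa [← dist_eq_norm]
      have h3 : |R x| ≤ d ^ deg p * (ρ * dyadic n) ^ deg p * B := by
        refine (abs_taylorRem_le (contDiff_testFn ψ (deg p)) (deg p) x w 0 (by simp) hB0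
          fun k hk z _ => hB k (by simpa using hk.le) z).trans ?_
        rw [deg_zero, tsub_zero]
        gcongr
      have h4 := h1 x (by
        rw [Metric.mem_closedBall] at hx hw ⊢
        nlinarith [dist_triangle x w y])
      exact mul_le_mul h3 h4 (abs_nonneg _) (by positivity)
    · rw [Measure.addHaar_real_closedBall _ _ (by positivity), finrank_euclideanSpace,
        Fintype.card_fin]
      field_simp
      ring
  rw [hsplit, add_mul]
  refine (abs_add_le _ _).trans (add_le_add ?_ hrem)
  refine (Finset.abs_sum_le_sum_abs _ _).trans ?_
  rw [← Finset.card_univ, ← nsmul_eq_mul]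
  refine Finset.sum_le_card_nsmul _ _ _ fun q _ => ?_
  rw [abs_mul]
  have hq : deg (q : MIdx d) < deg p := by exact_mod_cast q.2
  exact mul_le_mul (hB q hq.le w) (hpoly q) (abs_nonneg _) hB0

/-- For pieces finer than the test scale, derivatives fall on the test function and cost powers of
lam instead of powers of 2^n. The factor 2^{-nβ} makes the series over n converge. -/
theorem exists_fine_bound (K : RegKernel d β m r ρ) (hr : rPi ≤ r) {S : Set (E d)}
    (hS : IsCompact S) {η : TestFn d} (hη : tsupport η ⊆ Metric.closedBall 0 1) (i : I)
    (k : MIdx d) :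
    ∃ C : ℝ, 0 ≤ C ∧ ∀ M : Model d I α rPi,
      ∀ y ∈ S, ∀ (n : ℕ) (lam : ℝ), dyadic n ≤ lam → lam ≤ 1 →
      |pieceVal K (fun φ => M.pi i y φ) n (dtest η k y lam)|
      ≤ C * piReal ρ M S i * lam ^ (α i - deg k) * dyadic n ^ β := by
  obtain ⟨c, hc, hK⟩ := K.exists_bounds hS
  have hρ := K.ρ_pos
  obtain ⟨B, hB0, hB⟩ := exists_pderiv_bound η k rPi
  obtain ⟨V, hV0, hV⟩ := exists_bound_midx (fun p : MIdx d => (Fintype.card (Poly d (deg p))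
      + d ^ deg p * ρ ^ (deg p + d) * volume.real (Metric.ball (0 : E d) 1) : ℝ)) rPi
  refine ⟨enlargeConst d ρ (α i) rPi * (V * (B * c)), ?_, ?_⟩
  · have := (enlargeConst_pos (d := d) hρ (α i) rPi).le
    positivity
  intro M y hy n lam hn hlam1
  have hs := dyadic_pos n
  have hlam : 0 < lam := hs.trans_le hn
  refine (abs_pieceVal_le K M hr hS i hy hlam1 hn
    (A := V * (B * (lam ^ deg k)⁻¹ * (c * dyadic n ^ β)))
    ((tsupport_dtest_subset hη k y hlam).trans
      (Metric.closedBall_subset_closedBall (by linarith))) ?_).trans (le_of_eq ?_)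
  · intro p hp w hw
    have hw' : w ∈ Metric.closedBall y (2 + 2 * ρ) :=
      Metric.closedBall_subset_closedBall (by linarith) hw
    have key := abs_integral_mul_pderiv_piece_le K hc hw (hp.trans hr)
      (fun x hx => by
        simpa using (hK y hy n w hw').1 0 p (by simp) (hp.trans hr) x hx)
      (fun q hq => (hK y hy n w hw').2 q p hq (hp.trans hr)) (dtest η k y lam)
      -- As lam ≤ 1, the top order |p| gives the worst power and serves for all lower orders.
      (B := B * (lam ^ (d + deg k + deg p))⁻¹) (fun q hq z => by
        refine (abs_pderiv_dtest_le η k q (hB q (hq.trans hp)) y hlam z).trans ?_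
        refine mul_le_mul_of_nonneg_left ?_ hB0
        refine inv_anti₀ (by positivity) ?_
        exact pow_le_pow_of_le_one hlam.le hlam1 (by omega))
    refine key.trans ?_
    calc _ ≤ V * (B * (lam ^ (d + deg k + deg p))⁻¹ * (c * dyadic n ^ β)) :=
          mul_le_mul_of_nonneg_right (hV p hp) (by positivity)
      _ = _ := by
        rw [show d + deg k + deg p = deg k + (d + deg p) by ring, pow_add, mul_inv]; ring
  · rw [Real.rpow_sub hlam, Real.rpow_natCast]
    field_simp

end Estimates

end

section
variable {d : ℕ} {β ρ : ℝ} {m r : ℕ}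

/-! ### Mollifiers with vanishing moments -/

/-- The coefficients are the Lagrange basis polynomials for the nodes 1/(j+1), evaluated at 0:
interpolation reproduces X^p for p ≤ N, whose value at 0 is 1 or 0. -/
theorem exists_coeff_vanishing (N : ℕ) :
    ∃ c : ℕ → ℝ, ∀ p ≤ N, ∑ j ∈ Finset.range (N + 1), c j * ((j : ℝ) + 1)⁻¹ ^ p
      = if p = 0 then 1 else 0 := by
  classical
  set v : ℕ → ℝ := fun j => ((j : ℝ) + 1)⁻¹
  have hv : Set.InjOn v (Finset.range (N + 1)) := fun a _ b _ h => by
    have := inv_injective h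
    exact_mod_cast add_right_cancel this
  refine ⟨fun j => (Lagrange.basis (Finset.range (N + 1)) v j).eval 0, fun p hp => ?_⟩
  have h1 := Lagrange.eq_interpolate (f := (Polynomial.X ^ p : Polynomial ℝ)) hv (by
    rw [Polynomial.degree_X_pow, Finset.card_range]
    exact_mod_cast Nat.lt_succ_of_le hp)
  have h2 := congrArg (Polynomial.eval 0) h1
  rw [Lagrange.interpolate_apply, Polynomial.eval_finsetSum] at h2
  simp only [Polynomial.eval_pow, Polynomial.eval_X, Polynomial.eval_mul, Polynomial.eval_C] at h2
  rw [zero_pow_eq] at h2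
  rw [h2]
  exact Finset.sum_congr rfl fun j _ => mul_comm _ _

theorem monomial_smul (l : MIdx d) (t : ℝ) (z : E d) :
    monomial l (t • z) = t ^ deg l * monomial l z := by
  unfold monomial deg
  rw [← Finset.prod_pow_eq_pow_sum, ← Finset.prod_mul_distrib]
  exact Finset.prod_congr rfl fun i _ => by simp [mul_pow]

theorem continuous_monomial (l : MIdx d) : Continuous (monomial l : E d → ℝ) :=
  continuous_finsetProd _ fun i _ => ((EuclideanSpace.proj i : E d →L[ℝ] ℝ).continuous).pow _

/-- Rescaling a bump by s multiplies its moments of order |l| by s^{|l|}, so a combination of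
rescalings by 1/(j+1) kills all moments of orders 1 to N. These scales are at most 1, which
preserves the support condition. -/
theorem exists_mollifier (d N : ℕ) :
    ∃ η : TestFn d, tsupport η ⊆ Metric.closedBall 0 1 ∧ ∀ δ : ℝ, δ ≤ N → IsMollifier δ η := by
  obtain ⟨c, hc⟩ := exists_coeff_vanishing N
  let b : ContDiffBump (0 : E d) := ⟨1 / 2, 1, by norm_num, by norm_num⟩
  let φ : TestFn d :=
    { toFun := b.normed volume
      contDiff' := b.contDiff_normed
      hasCompactSupport' := b.hasCompactSupport_normed
      tsupport_subset' := fun _ _ => trivial }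
  have hφs : tsupport φ ⊆ Metric.closedBall 0 1 := (b.tsupport_normed_eq (μ := volume)).subset
  have hφ1 : ∫ z, φ z = 1 := b.integral_normed
  have hpos : ∀ j : ℕ, 0 < ((j : ℝ) + 1)⁻¹ := fun j => by positivity
  set η : TestFn d := ∑ j ∈ Finset.range (N + 1), c j • scaled φ 0 ((j : ℝ) + 1)⁻¹ with hη
  have hval : ∀ z, η z = ∑ j ∈ Finset.range (N + 1), c j * scaled φ 0 ((j : ℝ) + 1)⁻¹ z :=
    fun z => by rw [hη, sum_apply]; exact Finset.sum_congr rfl fun j _ => by simp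
  have hint : ∀ l : MIdx d, ∫ z, η z * monomial l z
      = (∑ j ∈ Finset.range (N + 1), c j * ((j : ℝ) + 1)⁻¹ ^ deg l) * ∫ z, φ z * monomial l z := by
    intro l
    have e : ∀ z, η z * monomial l z = ∑ j ∈ Finset.range (N + 1),
        c j * (scaled φ 0 ((j : ℝ) + 1)⁻¹ z * monomial l z) := fun z => by
      rw [hval, Finset.sum_mul]
      exact Finset.sum_congr rfl fun j _ => by ring
    simp only [e]
    rw [integral_finsetSum _ fun j _ =>
      (integrable_testFn_mul _ (continuous_monomial l)).const_mul _, Finset.sum_mul]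
    refine Finset.sum_congr rfl fun j _ => ?_
    rw [integral_const_mul, integral_scaled_mul φ 0 (hpos j)]
    simp only [zero_add, monomial_smul]
    rw [mul_assoc]
    congr 1
    rw [← integral_const_mul]
    congr 1
    funext z; ring
  refine ⟨η, ?_, fun δ hδ => ⟨?_, fun l hl hl' => ?_⟩⟩
  · refine closure_minimal ?_ Metric.isClosed_closedBall
    intro z hz
    by_contra hn
    apply hz
    rw [hval]
    refine Finset.sum_eq_zero fun j _ => ?_
    rw [image_eq_zero_of_notMem_tsupport (x := z) fun h' => hn
      (Metric.closedBall_subset_closedBall (inv_le_one_of_one_le₀ (by simp))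
      (tsupport_scaled_subset hφs 0 (hpos j) h')), mul_zero]
  · have := hint 0
    simp only [monomial, Pi.zero_apply, pow_zero, Finset.prod_const_one, mul_one, hφ1] at this
    rw [this, deg_zero]
    simpa using hc 0 (Nat.zero_le _)
  · have h1 : deg l ≤ N := by exact_mod_cast (hl'.le.trans hδ)
    rw [hint, hc _ h1, if_neg (by omega), zero_mul]

/-! ### Geometric sums over dyadic scales -/

theorem dyadic_add (n k : ℕ) : dyadic (n + k) = dyadic n * dyadic k := by
  simp only [dyadic_eq_pow, pow_add]

theorem dyadic_anti {n k : ℕ} (h : n ≤ k) : dyadic k ≤ dyadic n := by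
  simp only [dyadic_eq_pow]
  exact pow_le_pow_of_le_one (by norm_num) (by norm_num) h

theorem tendsto_dyadic : Tendsto dyadic atTop (𝓝 0) := by
  rw [show dyadic = fun n => (1 / 2 : ℝ) ^ n from funext dyadic_eq_pow]
  exact tendsto_pow_atTop_nhds_zero_of_lt_one (by norm_num) (by norm_num)

theorem exists_dyadic_le {t : ℝ} (ht : 0 < t) : ∃ n, dyadic n ≤ t := by
  obtain ⟨n, hn⟩ := (tendsto_dyadic.eventually (gt_mem_nhds ht)).exists
  exact ⟨n, hn.le⟩

theorem dyadic_rpow (σ : ℝ) (n : ℕ) : dyadic n ^ σ = ((1 / 2 : ℝ) ^ σ) ^ n := by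
  rw [dyadic_eq_pow, ← Real.rpow_natCast, ← Real.rpow_natCast, ← Real.rpow_mul (by norm_num),
    ← Real.rpow_mul (by norm_num), mul_comm]

theorem summable_dyadic {σ : ℝ} (hσ : 0 < σ) : Summable fun n => dyadic n ^ σ := by
  simp only [dyadic_rpow]
  exact summable_geometric_of_lt_one (by positivity)
    (Real.rpow_lt_one (by norm_num) (by norm_num) hσ)

/-- The sum of the geometric series `∑ 2^{-nσ}`. -/
def geomSum (σ : ℝ) : ℝ := ∑' n, dyadic n ^ σ

theorem geomSum_nonneg (σ : ℝ) : 0 ≤ geomSum σ :=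
  tsum_nonneg fun n => Real.rpow_nonneg (dyadic_pos n).le _

theorem hasSum_dyadic_add {σ : ℝ} (hσ : 0 < σ) (N : ℕ) :
    HasSum (fun n => dyadic (n + N) ^ σ) (geomSum σ * dyadic N ^ σ) := by
  simp only [dyadic_add]
  simp only [Real.mul_rpow (dyadic_pos _).le (dyadic_pos _).le]
  exact (summable_dyadic hσ).hasSum.mul_right _

/-- A growing geometric sum is dominated by its last term: ∑_{n<N} 2^{nσ} ≤ 2^{Nσ}/(2^σ - 1). -/
theorem exists_sum_dyadic_neg_le {σ : ℝ} (hσ : 0 < σ) :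
    ∃ C : ℝ, 0 ≤ C ∧ ∀ N, ∑ n ∈ Finset.range N, dyadic n ^ (-σ) ≤ C * dyadic N ^ (-σ) := by
  have h2 : 1 < (2 : ℝ) ^ σ := Real.one_lt_rpow (by norm_num) hσ
  have h3 : 0 < (2 : ℝ) ^ σ - 1 := by linarith
  refine ⟨1 / (2 ^ σ - 1), by positivity, fun N => ?_⟩
  induction N with
  | zero =>
    simp only [Finset.range_zero, Finset.sum_empty]
    have := Real.rpow_nonneg (dyadic_pos 0).le (-σ)
    positivity
  | succ N ih =>
    rw [Finset.sum_range_succ]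
    have h4 : dyadic (N + 1) ^ (-σ) = 2 ^ σ * dyadic N ^ (-σ) := by
      rw [dyadic_add, Real.mul_rpow (dyadic_pos _).le (dyadic_pos _).le, mul_comm]
      congr 1
      rw [dyadic_eq_pow, pow_one, one_div, Real.inv_rpow (by norm_num), Real.rpow_neg (by norm_num),
        inv_inv]
    rw [h4]
    calc _ ≤ 1 / ((2 : ℝ) ^ σ - 1) * dyadic N ^ (-σ) + dyadic N ^ (-σ) := by linarith
      _ = _ := by field_simp; ring

theorem exists_sum_dyadic_le {σ : ℝ} (hσ : σ < 0) :
    ∃ C : ℝ, 0 ≤ C ∧ ∀ N, ∑ n ∈ Finset.range N, dyadic n ^ σ ≤ C * dyadic N ^ σ := by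
  simpa using exists_sum_dyadic_neg_le (neg_pos.2 hσ)

/-! ### Pointwise derivatives -/

section Sums

variable {I : Type*} [Fintype I] {α : I → ℝ} {rPi : ℕ}

/-- The number `Π^i_y(𝖪ₙ^* ψ)` with `ψ` the test function representing `D^k` at scale `t`. -/
def term (K : RegKernel d β m r ρ) (M : Model d I α rPi) (η : TestFn d) (i : I) (k : MIdx d)
    (y : E d) (t : ℝ) (n : ℕ) : ℝ :=
  pieceVal K (fun φ => M.pi i y φ) n (dtest η k y t)

theorem distDeriv_kpi (K : RegKernel d β m r ρ) (M : Model d I α rPi) (hr : rPi ≤ r)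
    (η : TestFn d) (i : I) (k : MIdx d) (y : E d) (t : ℝ) :
    distDeriv k (kpi K M i y) (scaled η y t) = ∑' n, term K M η i k y t n := by
  unfold distDeriv kpi RegKernel.apply term dtest
  simp only [pieceVal_smul K ((M.finiteOrder i y).mono hr)]
  rw [tsum_mul_left]
  rfl

/-- The Taylor bound with the empty polynomial (t = 0) and x = y. -/
theorem exists_term_bound (K : RegKernel d β m r ρ) (hr : rPi ≤ r) {S : Set (E d)}
    (hS : IsCompact S) {η : TestFn d} (hη : tsupport η ⊆ Metric.closedBall 0 1) (i : I) :
    ∃ C : ℝ, 0 ≤ C ∧ ∀ M : Model d I α rPi, ∀ k : MIdx d, deg k ≤ m → ∀ y ∈ S, ∀ (n : ℕ) (t : ℝ),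
      0 < t → t ≤ dyadic n →
      |term K M η i k y t n| ≤ C * piReal ρ M S i * dyadic n ^ (α i + β - deg k) := by
  obtain ⟨C, hC, h⟩ := exists_taylor_bound (α := α) K hr hS hη i
  refine ⟨C, hC, fun M k hk y hy n t ht htn => ?_⟩
  have := h M 0 k (by simpa using hk) y hy y n t (by simpa using (dyadic_pos n).le) ht htn
  rw [Finset.sum_eq_zero] at this
  · simpa [term] using this
  · intro q _
    have := q.2
    simp only [Nat.cast_zero] at this
    exact absurd this (not_lt.2 (Nat.cast_nonneg _))

theorem summable_term (K : RegKernel d β m r ρ) (M : Model d I α rPi) (hr : rPi ≤ r)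
    {η : TestFn d} (hη : tsupport η ⊆ Metric.closedBall 0 1) (i : I) (k : MIdx d)
    (y : E d) {t : ℝ} (ht : 0 < t) (ht1 : t ≤ 1) : Summable (term K M η i k y t) := by
  obtain ⟨C, hC, h⟩ := exists_fine_bound (α := α) K hr isCompact_singleton hη i k
  obtain ⟨N, hN⟩ := exists_dyadic_le ht
  rw [← summable_nat_add_iff N]
  refine Summable.of_norm_bounded (((hasSum_dyadic_add K.β_pos N).summable).mul_left
    (C * piReal ρ M {y} i * t ^ (α i - deg k))) fun n => ?_
  exact h M y (Set.mem_singleton y) (n + N) t ((dyadic_anti (Nat.le_add_left N n)).trans hN) ht1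

/-- In the tail, pieces coarser than t decay like 2^{-nσ} with σ = α_i+β-|k| > 0, and pieces finer
than t like t^{σ-β}2^{-nβ}. Neither bound holds throughout. -/
theorem exists_tail_bound (K : RegKernel d β m r ρ) (hr : rPi ≤ r) {S : Set (E d)}
    (hS : IsCompact S) {η : TestFn d} (hη : tsupport η ⊆ Metric.closedBall 0 1) (i : I)
    (k : MIdx d) (hk : deg k ≤ m) (hσ : (deg k : ℝ) < α i + β) :
    ∃ C : ℝ, 0 ≤ C ∧ ∀ M : Model d I α rPi, ∀ y ∈ S, ∀ (N : ℕ) (t : ℝ),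
      0 < t → t ≤ dyadic N →
      |∑' n, term K M η i k y t (n + N)| ≤ C * piReal ρ M S i * dyadic N ^ (α i + β - deg k) := by
  obtain ⟨C₁, hC₁, h₁⟩ := exists_term_bound (α := α) K hr hS hη i
  obtain ⟨C₂, hC₂, h₂⟩ := exists_fine_bound (α := α) K hr hS hη i k
  set σ := α i + β - deg k with hσd
  have hσ0 : 0 < σ := by linarith
  -- With τ ≤ β and τ ≤ σ, both regimes are bounded by 2^{-N(σ-τ)} 2^{-nτ}, a single summable
  -- majorant.
  set τ := min β σ with hτ
  have hτ0 : 0 < τ := lt_min K.β_pos hσ0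
  refine ⟨(C₁ + C₂) * geomSum τ, mul_nonneg (add_nonneg hC₁ hC₂) (geomSum_nonneg _),
    fun M y hy N t ht htN => ?_⟩
  have hP := piReal_nonneg (ρ := ρ) M S i
  have hN := dyadic_pos N
  have hsum := (hasSum_dyadic_add hτ0 N).mul_left ((C₁ + C₂) * piReal ρ M S i * dyadic N ^ (σ - τ))
  have key : ∀ n, ‖term K M η i k y t (n + N)‖
      ≤ (C₁ + C₂) * piReal ρ M S i * dyadic N ^ (σ - τ) * dyadic (n + N) ^ τ := by
    intro n
    have hs := dyadic_pos (n + N)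
    have hsN := dyadic_anti (Nat.le_add_left N n)
    rw [Real.norm_eq_abs]
    rcases le_total t (dyadic (n + N)) with hc | hc
    · refine (h₁ M k hk y hy (n + N) t ht hc).trans ?_
      have e1 : dyadic (n + N) ^ σ = dyadic (n + N) ^ (σ - τ) * dyadic (n + N) ^ τ := by
        rw [← Real.rpow_add hs]; congr 1; ring
      have e2 : dyadic (n + N) ^ (σ - τ) ≤ dyadic N ^ (σ - τ) :=
        Real.rpow_le_rpow hs.le hsN (sub_nonneg.2 (min_le_right _ _))
      rw [← hσd, e1, mul_assoc ((C₁ + C₂) * piReal ρ M S i)]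
      gcongr
      linarith
    · refine (h₂ M y hy (n + N) t hc (htN.trans (dyadic_le_one N))).trans ?_
      have e1 : t ^ (α i - deg k) * dyadic (n + N) ^ β
          = t ^ (σ - τ) * ((dyadic (n + N) / t) ^ (β - τ) * dyadic (n + N) ^ τ) := by
        rw [Real.div_rpow hs.le ht.le, show α i - deg k = (σ - τ) - (β - τ) by rw [hσd]; ring,
          Real.rpow_sub ht (σ - τ), Real.rpow_sub hs β τ]
        field_simp
      have e2 : (dyadic (n + N) / t) ^ (β - τ) ≤ 1 :=
        Real.rpow_le_one (by positivity) (div_le_one_of_le₀ hc ht.le)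
          (sub_nonneg.2 (min_le_left _ _))
      have e3 : t ^ (σ - τ) ≤ dyadic N ^ (σ - τ) :=
        Real.rpow_le_rpow ht.le htN (sub_nonneg.2 (min_le_right _ _))
      rw [mul_assoc, e1, mul_assoc ((C₁ + C₂) * piReal ρ M S i)]
      have hpτ : 0 ≤ dyadic (n + N) ^ τ := Real.rpow_nonneg hs.le _
      refine mul_le_mul ?_ (mul_le_mul e3 ?_ (by positivity) (by positivity)) (by positivity)
        (by positivity)
      · gcongr; linarith
      · exact mul_le_of_le_one_left hpτ e2
  have := tsum_of_norm_bounded hsum key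
  rw [Real.norm_eq_abs] at this
  refine this.trans (le_of_eq ?_)
  have e1 : dyadic N ^ σ = dyadic N ^ (σ - τ) * dyadic N ^ τ := by
    rw [← Real.rpow_add hN]; congr 1; ring
  rw [e1]; ring

/-- A Cauchy criterion: first N is chosen to make both tails small, then δ to make the finitely many
coarse pieces nearly independent of scale and test function. -/
theorem exists_forall_sub_lt (K : RegKernel d β m r ρ) (M : Model d I α rPi) (hr : rPi ≤ r)
    {η η' : TestFn d} (hη : tsupport η ⊆ Metric.closedBall 0 1)
    (hη1 : ∫ z, η z = 1) (hη' : tsupport η' ⊆ Metric.closedBall 0 1) (hη1' : ∫ z, η' z = 1)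
    (i : I) (k : MIdx d) (hk : deg k + 1 ≤ m) (hσ : (deg k : ℝ) < α i + β) (y : E d)
    {ε : ℝ} (hε : 0 < ε) :
    ∃ δ > 0, ∀ a b : ℝ, 0 < a → a < δ → 0 < b → b < δ →
      |∑' n, term K M η i k y a n - ∑' n, term K M η' i k y b n| < ε := by
  obtain ⟨C₁, hC₁, h₁⟩ := exists_tail_bound (α := α) K hr isCompact_singleton hη i k
    (by omega) hσ (S := {y})
  obtain ⟨C₂, hC₂, h₂⟩ := exists_tail_bound (α := α) K hr isCompact_singleton hη' i k
    (by omega) hσ (S := {y})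
  obtain ⟨C₃, hC₃, h₃⟩ := exists_change_bound (α := α) K hr isCompact_singleton hη hη1 hη' hη1' i
    (S := {y})
  set P := piReal ρ M {y} i
  have hP : 0 ≤ P := piReal_nonneg M {y} i
  set σ := α i + β - deg k with hσd
  have hσ0 : 0 < σ := by linarith
  have hlim : Tendsto (fun N => (C₁ + C₂) * P * dyadic N ^ σ) atTop (𝓝 0) := by
    have := (tendsto_dyadic.rpow_const (p := σ) (Or.inr hσ0.le)).const_mul ((C₁ + C₂) * P)
    rwa [Real.zero_rpow hσ0.ne', mul_zero] at this
  obtain ⟨N, hN⟩ := (hlim.eventually (gt_mem_nhds (half_pos hε))).exists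
  set D := ∑ n ∈ Finset.range N, C₃ * P * dyadic n ^ (σ - 1)
  have hD : 0 ≤ D := Finset.sum_nonneg fun n _ => by
    have := Real.rpow_nonneg (dyadic_pos n).le (σ - 1)
    positivity
  refine ⟨min (dyadic N) (ε / (2 * (D + 1))), lt_min (dyadic_pos N) (by positivity),
    fun a b ha haδ hb hbδ => ?_⟩
  have haN := (haδ.trans_le (min_le_left _ _)).le
  have hbN := (hbδ.trans_le (min_le_left _ _)).le
  have hsa := summable_term K M hr hη i k y ha (haN.trans (dyadic_le_one N))
  have hsb := summable_term K M hr hη' i k y hb (hbN.trans (dyadic_le_one N))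
  have hmax : max a b < ε / (2 * (D + 1)) :=
    max_lt (haδ.trans_le (min_le_right _ _)) (hbδ.trans_le (min_le_right _ _))
  have hmax0 : 0 < max a b := lt_max_of_lt_left ha
  rw [← hsa.sum_add_tsum_nat_add N, ← hsb.sum_add_tsum_nat_add N]
  have k1 := h₁ M y rfl N a ha haN
  have k2 := h₂ M y rfl N b hb hbN
  have k3 : |∑ n ∈ Finset.range N, term K M η i k y a n
      - ∑ n ∈ Finset.range N, term K M η' i k y b n| ≤ max a b * D := by
    rw [← Finset.sum_sub_distrib, Finset.mul_sum]
    refine (Finset.abs_sum_le_sum_abs _ _).trans (Finset.sum_le_sum fun n hn => ?_)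
    have hnN := dyadic_anti (Finset.mem_range.1 hn).le
    refine (h₃ M k hk y rfl n a b ha (haN.trans hnN) hb (hbN.trans hnN)).trans (le_of_eq ?_)
    rw [hσd]; ring
  have k4 : max a b * D < ε / 2 := by
    have : max a b * (D + 1) < ε / (2 * (D + 1)) * (D + 1) := by gcongr
    have e : ε / (2 * (D + 1)) * (D + 1) = ε / 2 := by field_simp
    nlinarith
  have k5 : C₁ * P * dyadic N ^ σ + C₂ * P * dyadic N ^ σ < ε / 2 := by linarith
  rw [abs_le] at k1 k2 k3
  rw [abs_lt]
  constructor <;> linarith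

theorem tsupport_scaled_inv_subset {η : TestFn d} {R : ℝ} (hR : 0 < R)
    (hη : tsupport η ⊆ Metric.closedBall 0 R) :
    tsupport (scaled η 0 R⁻¹) ⊆ Metric.closedBall 0 1 := by
  refine closure_minimal ?_ Metric.isClosed_closedBall
  intro z hz
  by_contra hn
  apply hz
  rw [scaled_apply η 0 (inv_pos.2 hR)]
  suffices h : R⁻¹⁻¹ • (z - 0) ∉ tsupport η by
    rw [image_eq_zero_of_notMem_tsupport h, mul_zero]
  intro h'
  have h3 := hη h'
  rw [inv_inv, sub_zero, Metric.mem_closedBall, dist_zero_right, norm_smul,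
    Real.norm_of_nonneg hR.le] at h3
  apply hn
  rw [Metric.mem_closedBall, dist_zero_right]
  nlinarith

theorem scaled_scaled_inv (η : TestFn d) {R : ℝ} (hR : 0 < R) (y : E d) {t : ℝ} (ht : 0 < t) :
    scaled (scaled η 0 R⁻¹) y (R * t) = scaled η y t := by
  ext z
  rw [scaled_apply _ _ (by positivity), scaled_apply _ _ (inv_pos.2 hR), scaled_apply _ _ ht,
    sub_zero, inv_inv, smul_smul, mul_inv, ← mul_assoc R, mul_inv_cancel₀ hR.ne', one_mul,
    ← mul_assoc]
  congr 1
  rw [inv_pow, inv_inv, mul_pow, mul_inv]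
  field_simp

/-- Convergence and independence of the test function need only mass one. The vanishing moments of η
serve to make it an admissible choice in `IsPointDeriv`; without such an η the defining condition
would not pin down the chosen value. -/
theorem tendsto_kpiDeriv (K : RegKernel d β m r ρ) (M : Model d I α rPi) (hr : rPi ≤ r)
    {η : TestFn d} (hη : tsupport η ⊆ Metric.closedBall 0 1) (i : I)
    (hηm : IsMollifier (α i + β) η) (k : MIdx d) (hk : deg k + 1 ≤ m)
    (hσ : (deg k : ℝ) < α i + β) (y : E d) :
    Tendsto (fun t => ∑' n, term K M η i k y t n) (𝓝[>] 0) (𝓝 (kpiDeriv K M i k y)) := by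
  have hcau : ∃ c, Tendsto (fun t => ∑' n, term K M η i k y t n) (𝓝[>] 0) (𝓝 c) := by
    rw [← cauchy_map_iff_exists_tendsto, Metric.cauchy_iff]
    refine ⟨inferInstance, fun ε hε => ?_⟩
    obtain ⟨δ, hδ, h⟩ := exists_forall_sub_lt K M hr hη hηm.1 hη hηm.1 i k hk hσ y hε
    refine ⟨_, image_mem_map (Ioo_mem_nhdsGT hδ), ?_⟩
    rintro _ ⟨a, ha, rfl⟩ _ ⟨b, hb, rfl⟩
    exact h a b ha.1 ha.2 hb.1 hb.2
  obtain ⟨c, hc⟩ := hcau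
  have hunit : ∀ η' : TestFn d, tsupport η' ⊆ Metric.closedBall 0 1 → ∫ z, η' z = 1 →
      Tendsto (fun t => ∑' n, term K M η' i k y t n) (𝓝[>] 0) (𝓝 c) := by
    intro η' hη' hη1'
    rw [Metric.tendsto_nhds]
    intro ε hε
    obtain ⟨δ, hδ, h⟩ := exists_forall_sub_lt K M hr hη' hη1' hη hηm.1 i k hk hσ y (half_pos hε)
    filter_upwards [Ioo_mem_nhdsGT hδ] with a ha
    have h1 : dist (∑' n, term K M η' i k y a n) c ≤ ε / 2 := by
      refine le_of_tendsto (tendsto_const_nhds.dist hc) ?_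
      filter_upwards [Ioo_mem_nhdsGT hδ] with b hb
      exact (h a b ha.1 ha.2 hb.1 hb.2).le
    linarith
  -- A test function of arbitrary support is rescaled into the unit ball; this only reparametrises t
  -- by the factor R'.
  have hP : IsPointDeriv (α i + β) k (kpi K M i y) y c := by
    intro η' hη'
    obtain ⟨R, hR⟩ := exists_tsupport_subset_closedBall η'
    set R' := max R 1
    have hR'0 : 0 < R' := lt_max_of_lt_right one_pos
    have hR' : tsupport η' ⊆ Metric.closedBall 0 R' :=
      hR.trans (Metric.closedBall_subset_closedBall (le_max_left _ _))
    have h1 : ∫ z, scaled η' 0 R'⁻¹ z = 1 := by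
      have := integral_scaled_mul η' 0 (inv_pos.2 hR'0) (fun _ => 1)
      simp only [mul_one] at this
      rw [this, hη'.1]
    have h2 := hunit _ (tsupport_scaled_inv_subset hR'0 hR') h1
    have h3 : Tendsto (fun t : ℝ => R' * t) (𝓝[>] 0) (𝓝[>] 0) := by
      refine tendsto_nhdsWithin_iff.2 ⟨?_, eventually_mem_nhdsWithin.mono fun t ht =>
        mul_pos hR'0 ht⟩
      have : Tendsto (fun t : ℝ => R' * t) (𝓝 0) (𝓝 (R' * 0)) := tendsto_id.const_mul R'
      rw [mul_zero] at this
      exact this.mono_left nhdsWithin_le_nhds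
    refine (h2.comp h3).congr' ?_
    filter_upwards [self_mem_nhdsWithin] with t ht
    simp only [Function.comp_apply]
    rw [← distDeriv_kpi K M hr, scaled_scaled_inv η' hR'0 y ht]
  have hex : ∃ c, IsPointDeriv (α i + β) k (kpi K M i y) y c := ⟨c, hP⟩
  have hch := hex.choose_spec η hηm
  simp only [distDeriv_kpi K M hr] at hch
  rw [kpiDeriv, pointDeriv, dif_pos hex]
  exact hch

/-- At scale 2^{-N} the full series is bounded by Q, and the tail by the fine bound, whose powers
cancel exactly at the critical degree; hence so is the partial sum. Passing from 2^{-N} to t costs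
∑_{n<N} 2^{n-N}, which is bounded. -/
theorem exists_partial_sum_bound (K : RegKernel d β m r ρ) (hr : rPi ≤ r) {S : Set (E d)}
    (hS : IsCompact S) {η : TestFn d} (hη : tsupport η ⊆ Metric.closedBall 0 1)
    (hη1 : ∫ z, η z = 1) (i : I) (k : MIdx d) (hk : deg k + 1 ≤ m)
    (hσ : (deg k : ℝ) = α i + β) :
    ∃ C : ℝ, 0 ≤ C ∧ ∀ (M : Model d I α rPi) (Q : ℝ), ∀ y ∈ S,
      (∀ t, 0 < t → t ≤ 1 → |distDeriv k (kpi K M i y) (scaled η y t)| ≤ Q) →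
      ∀ (N : ℕ) (t : ℝ), 0 < t → t ≤ dyadic N →
      |∑ n ∈ Finset.range N, term K M η i k y t n| ≤ C * piReal ρ M S i + Q := by
  obtain ⟨C₁, hC₁, h₁⟩ := exists_fine_bound (α := α) K hr hS hη i k
  obtain ⟨C₂, hC₂, h₂⟩ := exists_change_bound (α := α) K hr hS hη hη1 hη hη1 i
  obtain ⟨C₃, hC₃, h₃⟩ := exists_sum_dyadic_le (σ := -1) (by norm_num)
  refine ⟨C₁ * geomSum β + C₂ * C₃, add_nonneg (mul_nonneg hC₁ (geomSum_nonneg _))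
    (mul_nonneg hC₂ hC₃), fun M Q y hy hQ N t ht htN => ?_⟩
  set P := piReal ρ M S i
  have hP : 0 ≤ P := piReal_nonneg M S i
  have hN := dyadic_pos N
  have hs := summable_term K M hr hη i k y hN (dyadic_le_one N)
  have k1 := hQ _ hN (dyadic_le_one N)
  rw [distDeriv_kpi K M hr, ← hs.sum_add_tsum_nat_add N] at k1
  have k2 : |∑' n, term K M η i k y (dyadic N) (n + N)| ≤ C₁ * geomSum β * P := by
    have hsum := (hasSum_dyadic_add K.β_pos N).mul_left (C₁ * P * dyadic N ^ (α i - deg k))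
    have := tsum_of_norm_bounded (f := fun n => term K M η i k y (dyadic N) (n + N)) hsum fun n =>
      h₁ M y hy (n + N) (dyadic N) (dyadic_anti (Nat.le_add_left N n)) (dyadic_le_one N)
    rw [Real.norm_eq_abs] at this
    refine this.trans (le_of_eq ?_)
    have e : dyadic N ^ (α i - deg k) * dyadic N ^ β = 1 := by
      rw [← Real.rpow_add hN, hσ]; simp
    calc _ = C₁ * geomSum β * P * (dyadic N ^ (α i - deg k) * dyadic N ^ β) := by ring
      _ = _ := by rw [e, mul_one]
  have k3 : |∑ n ∈ Finset.range N, term K M η i k y t n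
      - ∑ n ∈ Finset.range N, term K M η i k y (dyadic N) n| ≤ C₂ * C₃ * P := by
    rw [← Finset.sum_sub_distrib]
    refine (Finset.abs_sum_le_sum_abs _ _).trans ?_
    have : ∀ n ∈ Finset.range N, |term K M η i k y t n - term K M η i k y (dyadic N) n|
        ≤ C₂ * P * dyadic N * dyadic n ^ (-1 : ℝ) := fun n hn => by
      have hnN := dyadic_anti (Finset.mem_range.1 hn).le
      refine (h₂ M k hk y hy n t (dyadic N) ht (htN.trans hnN) hN hnN).trans (le_of_eq ?_)
      rw [max_eq_right htN, hσ]; congr 2; ring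
    refine (Finset.sum_le_sum this).trans ?_
    rw [← Finset.mul_sum]
    calc _ ≤ C₂ * P * dyadic N * (C₃ * dyadic N ^ (-1 : ℝ)) := by gcongr; exact h₃ N
      _ = _ := by rw [Real.rpow_neg_one]; field_simp
  rw [abs_le] at k1 k2 k3 ⊢
  constructor <;> linarith

end Sums

end

section
variable {d : ℕ} {β ρ : ℝ} {m r : ℕ}

/-! ### The block of new coefficients: real bounds -/

theorem sum_poly_eq_sum_ite {s t : ℝ} (hst : s ≤ t) (f : MIdx d → ℝ) :
    ∑ k : Poly d s, f k = ∑ k : Poly d t, if (deg (k : MIdx d) : ℝ) < s then f k else 0 := by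
  classical
  rw [← Finset.sum_filter]
  refine Finset.sum_bij (fun k _ => ⟨k, k.2.trans_le hst⟩) (fun k _ => by simpa using k.2)
    (fun a _ b _ h => Subtype.ext (by simpa using h))
    (fun b hb => ⟨⟨b, by simpa using hb⟩, Finset.mem_univ _, rfl⟩) (fun _ _ => rfl)

/-- The least natural number that is larger than `a`. -/
def natAbove (a : ℝ) : ℕ := ⌊a + 1⌋₊

theorem lt_natAbove (a : ℝ) : a < natAbove a := by
  have := Nat.lt_floor_add_one (a + 1)
  rw [natAbove]; linarith

theorem lt_natAbove_iff {a : ℝ} {n : ℕ} : n < natAbove a ↔ (n : ℝ) ≤ a := by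
  rw [natAbove, ← Nat.succ_le_iff, Nat.le_floor_iff' (Nat.succ_ne_zero n)]
  push_cast
  constructor <;> intro h <;> linarith

theorem natAbove_le {a : ℝ} {n : ℕ} (h : a < n) : natAbove a ≤ n := by
  by_contra hn
  exact absurd (lt_natAbove_iff.1 (not_le.1 hn)) (not_le.2 h)

section Block

variable {I : Type*} [Fintype I] {α : I → ℝ} {rPi : ℕ}

open Classical in
/-- The tail `∑_{n ≥ N}` of the series of pieces below the critical degree, and minus the partial
sum `∑_{n < N}` from the critical degree on. -/
def cutSum (K : RegKernel d β m r ρ) (M : Model d I α rPi) (η : TestFn d) (i : I) (k : MIdx d)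
    (y : E d) (t : ℝ) (N : ℕ) : ℝ :=
  if (deg k : ℝ) < α i + β then ∑' n, term K M η i k y t (n + N)
  else -∑ n ∈ Finset.range N, term K M η i k y t n

/-- `Q` bounds the critical derivatives of `𝖪Π` tested against `η` at scales in `(0, 1]`. -/
def CritBound (K : RegKernel d β m r ρ) (M : Model d I α rPi) (η : TestFn d) (S : Set (E d))
    (Q : ℝ) : Prop :=
  ∀ i, ∀ k : MIdx d, (deg k : ℝ) = α i + β → ∀ y ∈ S, ∀ t, 0 < t → t ≤ 1 →
    |distDeriv k (kpi K M i y) (scaled η y t)| ≤ Q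

/-- Below the critical degree this is the tail bound, at it the hypothesis `CritBound`, and above it
a geometric sum dominated by n near N. In all cases the size is that of a single piece at scale
2^{-N}. -/
theorem exists_cutSum_bound (K : RegKernel d β m r ρ) (hr : rPi ≤ r) {S : Set (E d)}
    (hS : IsCompact S) {η : TestFn d} (hη : tsupport η ⊆ Metric.closedBall 0 1)
    (hη1 : ∫ z, η z = 1) (i : I) (k : MIdx d) (hk : deg k + 1 ≤ m) :
    ∃ C : ℝ, 0 ≤ C ∧ ∀ (M : Model d I α rPi) (Q : ℝ), 0 ≤ Q → CritBound K M η S Q →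
      ∀ y ∈ S, ∀ (N : ℕ) (t : ℝ), 0 < t → t ≤ dyadic N →
      |cutSum K M η i k y t N| ≤ C * (piReal ρ M S i + Q) * dyadic N ^ (α i + β - deg k) := by
  rcases lt_trichotomy (deg k : ℝ) (α i + β) with h | h | h
  · obtain ⟨C, hC, hb⟩ := exists_tail_bound (α := α) K hr hS hη i k (by omega) h
    refine ⟨C, hC, fun M Q hQ _ y hy N t ht htN => ?_⟩
    rw [cutSum, if_pos h]
    refine (hb M y hy N t ht htN).trans ?_
    have := dyadic_pos N
    gcongr
    linarith
  · obtain ⟨C, hC, hb⟩ := exists_partial_sum_bound (α := α) K hr hS hη hη1 i k hk h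
    refine ⟨C + 1, by linarith, fun M Q hQ hcr y hy N t ht htN => ?_⟩
    rw [cutSum, if_neg (by linarith), abs_neg, ← h, sub_self, Real.rpow_zero, mul_one]
    refine (hb M Q y hy (hcr i k h y hy) N t ht htN).trans ?_
    have := piReal_nonneg (ρ := ρ) M S i
    nlinarith [mul_nonneg hC hQ]
  · obtain ⟨C, hC, hb⟩ := exists_term_bound (α := α) K hr hS hη i
    obtain ⟨C', hC', hs⟩ := exists_sum_dyadic_le (σ := α i + β - deg k) (by linarith)
    refine ⟨C * C', by positivity, fun M Q hQ hcr y hy N t ht htN => ?_⟩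
    have hP := piReal_nonneg (ρ := ρ) M S i
    rw [cutSum, if_neg (by linarith), abs_neg]
    refine (Finset.abs_sum_le_sum_abs _ _).trans ((Finset.sum_le_sum fun n hn =>
      hb M k (by omega) y hy n t ht (htN.trans (dyadic_anti (Finset.mem_range.1 hn).le))).trans ?_)
    rw [← Finset.mul_sum]
    have hN := Real.rpow_nonneg (dyadic_pos N).le (α i + β - deg k)
    calc _ ≤ C * piReal ρ M S i * (C' * dyadic N ^ (α i + β - deg k)) := by gcongr; exact hs N
      _ = C * C' * piReal ρ M S i * dyadic N ^ (α i + β - deg k) := by ring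
      _ ≤ _ := by gcongr; linarith

open Classical in
/-- The expression in `hatBlock` at the regularisation scale `t`. -/
def regBlock (K : RegKernel d β m r ρ) (M : Model d I α rPi) (η : TestFn d) (x y : E d)
    (l : MIdx d) (i : I) (t : ℝ) : ℝ :=
  (∑ j, if (deg l : ℝ) < α j + β then (∑' n, term K M η j l x t n) * M.gam x y j i else 0)
    - ∑ k : Poly d (α i + β), gamPoly x y l k * ∑' n, term K M η i k y t n

theorem tendsto_regBlock (K : RegKernel d β m r ρ) (M : Model d I α rPi) (hr : rPi ≤ r) {γ : ℝ}
    (hγ : ∀ i, α i < γ) (hm : γ + β < m)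
    {η : TestFn d} (hη : tsupport η ⊆ Metric.closedBall 0 1)
    (hηm : ∀ i, IsMollifier (α i + β) η) (x y : E d) (l : Poly d (γ + β)) (i : I) :
    Tendsto (regBlock K M η x y l i) (𝓝[>] 0) (𝓝 (hatBlock K M γ x y l i)) := by
  have hlm : ∀ k : MIdx d, (deg k : ℝ) < γ + β → deg k + 1 ≤ m := fun k hk => by
    exact_mod_cast hk.trans hm
  refine Tendsto.sub (tendsto_finsetSum _ fun j _ => ?_) (tendsto_finsetSum _ fun k _ => ?_)
  · split_ifs with h
    · exact (tendsto_kpiDeriv K M hr hη j (hηm j) l (hlm l l.2) h x).mul_const _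
    · exact tendsto_const_nhds
  · exact (tendsto_kpiDeriv K M hr hη i (hηm i) k
      (hlm k (k.2.trans (by linarith [hγ i]))) k.2 y).const_mul _

/-- The series are cut at N. Coarse pieces are completed to all j, so that they re-expand into
Π^i_y, and to all |k| ≤ α_i+β, so that they form a Taylor remainder. `cutSum` records the tails and,
with a minus sign, the pieces so added. -/
theorem regBlock_eq (K : RegKernel d β m r ρ) (M : Model d I α rPi) (hr : rPi ≤ r)
    {η : TestFn d} (hη : tsupport η ⊆ Metric.closedBall 0 1) (x y : E d) (l : MIdx d) (i : I)
    (N : ℕ) {t : ℝ} (ht : 0 < t) (ht1 : t ≤ 1) :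
    regBlock K M η x y l i t =
      (∑ j, M.gam x y j i * cutSum K M η j l x t N)
      - (∑ k : Poly d (natAbove (α i + β)), gamPoly x y l k * cutSum K M η i k y t N)
      + ∑ n ∈ Finset.range N, (pieceVal K (fun φ => M.pi i y φ) n (dtest η l x t)
        - ∑ k : Poly d (natAbove (α i + β)), gamPoly x y l k * term K M η i k y t n) := by
  classical
  have hsp : ∀ j k z, ∑' n, term K M η j k z t n
      = ∑ n ∈ Finset.range N, term K M η j k z t n + ∑' n, term K M η j k z t (n + N) :=
    fun j k z => ((summable_term K M hr hη j k z ht ht1).sum_add_tsum_nat_add N).symm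
  have hre : ∀ n, pieceVal K (fun φ => M.pi i y φ) n (dtest η l x t)
      = ∑ j, M.gam x y j i * term K M η j l x t n := fun n =>
    pieceVal_sum_left K (fun j => (M.finiteOrder j x).mono hr) (fun j => M.gam x y j i)
      ((M.finiteOrder i y).mono hr) (fun u => by
        rw [M.reexpansion i x y]
        simp) n _
  rw [regBlock, sum_poly_eq_sum_ite (lt_natAbove (α i + β)).le
    (fun k => gamPoly x y l k * ∑' n, term K M η i k y t n)]
  simp only [hre, Finset.sum_sub_distrib]
  rw [Finset.sum_comm (s := Finset.range N), Finset.sum_comm (s := Finset.range N)]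
  -- It remains to match the sums over j and over k separately, each being its `cutSum` plus its
  -- completed coarse part.
  have e : ∀ a b c e' : ℝ, ∀ A B, A = a + c → B = b + e' → A - B = a - b + (c - e') := by
    intros; subst_vars; ring
  refine e _ _ _ _ _ _ ?_ ?_
  · rw [← Finset.sum_add_distrib]
    refine Finset.sum_congr rfl fun j _ => ?_
    rw [cutSum, ← Finset.mul_sum, ← mul_add]
    split_ifs with h
    · rw [hsp]; ring
    · ring
  · rw [← Finset.sum_add_distrib]
    refine Finset.sum_congr rfl fun k _ => ?_
    rw [cutSum, ← Finset.mul_sum, ← mul_add]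
    split_ifs with h
    · rw [hsp]; ring
    · ring

/-- The sum of the norms of the `Π^i` over base points in `S`. -/
def piSum (ρ : ℝ) (M : Model d I α rPi) (S : Set (E d)) : ℝ := ∑ i, piReal ρ M S i

theorem piSum_nonneg (M : Model d I α rPi) (S : Set (E d)) : 0 ≤ piSum ρ M S :=
  Finset.sum_nonneg fun i _ => piReal_nonneg M S i

theorem piReal_le_piSum (M : Model d I α rPi) (S : Set (E d)) (i : I) :
    piReal ρ M S i ≤ piSum ρ M S :=
  Finset.single_le_sum (f := piReal ρ M S) (fun i _ => piReal_nonneg M S i) (Finset.mem_univ i)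

open Classical in
/-- The profile that controls `hatBlock` when pieces are split at scale `2^{-N}`; `G` stands for
the column `Γ^{·i}_{xy}` and `δ` for `|x-y|`. -/
def blockProfile (α : I → ℝ) (β : ℝ) (l : MIdx d) (i : I) (G : I → ℝ) (δ : ℝ) (N : ℕ) : ℝ :=
  (∑ j, |G j| * dyadic N ^ (α j + β - deg l))
    + (∑ k : Poly d (natAbove (α i + β)), (if l ≤ k then δ ^ (deg (k : MIdx d) - deg l) else 0)
        * dyadic N ^ (α i + β - deg (k : MIdx d)))
    + δ ^ (natAbove (α i + β) - deg l)
        * dyadic N ^ (α i + β - (max (natAbove (α i + β)) (deg l) : ℕ))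

/-- The three groups of terms in `regBlock_eq` are bounded by the three terms of the profile. Only
the coarse scales n < N need |x-y| ≤ 2^{-n}. -/
theorem exists_hatBlock_bound (K : RegKernel d β m r ρ) (hr : rPi ≤ r) {γ : ℝ}
    (hγ : ∀ i, α i < γ) (hm : γ + β < m) {S : Set (E d)} (hS : IsCompact S)
    {η : TestFn d} (hη : tsupport η ⊆ Metric.closedBall 0 1)
    (hηm : ∀ i, IsMollifier (α i + β) η) (l : Poly d (γ + β)) (i : I) :
    ∃ C : ℝ, 0 ≤ C ∧ ∀ (M : Model d I α rPi) (Q : ℝ), 0 ≤ Q → CritBound K M η S Q →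
      ∀ x ∈ S, ∀ y ∈ S, ∀ N : ℕ, (∀ n < N, ‖x - y‖ ≤ dyadic n) →
      |hatBlock K M γ x y l i| ≤ C * (piSum ρ M S + Q)
        * blockProfile α β (l : MIdx d) i (fun j => M.gam x y j i) ‖x - y‖ N := by
  classical
  have hηone := (hηm i).1
  have hlm : ∀ k : MIdx d, (deg k : ℝ) < γ + β → deg k + 1 ≤ m := fun k hk => by
    exact_mod_cast hk.trans hm
  set T := natAbove (α i + β) with hT
  have hTm : T ≤ m := natAbove_le (by linarith [hγ i])
  choose C₁ hC₁ h₁ using fun j =>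
    exists_cutSum_bound (α := α) K hr hS hη hηone j l (hlm l l.2)
  choose C₂ hC₂ h₂ using fun k : Poly d T =>
    exists_cutSum_bound (α := α) K hr hS hη hηone i k
      (by have : deg (k : MIdx d) < T := by exact_mod_cast k.2
          omega)
  obtain ⟨C₃, hC₃, h₃⟩ := exists_taylor_bound (α := α) K hr hS hη i
  -- Strict negativity, due to T > α_i+β, is what makes the sum over coarse scales comparable to its
  -- last term.
  have hσ : α i + β - (max T (deg (l : MIdx d)) : ℕ) < 0 := by
    have h1 := lt_natAbove (α i + β)
    have h2 : (T : ℝ) ≤ (max T (deg (l : MIdx d)) : ℕ) := by exact_mod_cast le_max_left _ _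
    linarith
  obtain ⟨C₄, hC₄, h₄⟩ := exists_sum_dyadic_le hσ
  set C := (∑ j, C₁ j) + (∑ k, C₂ k) + C₃ * C₄ with hCd
  have hs1 : 0 ≤ ∑ j, C₁ j := Finset.sum_nonneg fun j _ => hC₁ j
  have hs2 : 0 ≤ ∑ k, C₂ k := Finset.sum_nonneg fun j _ => hC₂ j
  have hc1 : ∀ j, C₁ j ≤ C := fun j => by
    have := Finset.single_le_sum (f := C₁) (fun j _ => hC₁ j) (Finset.mem_univ j)
    have := mul_nonneg hC₃ hC₄
    linarith
  have hc2 : ∀ k, C₂ k ≤ C := fun k => by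
    have := Finset.single_le_sum (f := C₂) (fun j _ => hC₂ j) (Finset.mem_univ k)
    have := mul_nonneg hC₃ hC₄
    linarith
  have hC0 : 0 ≤ C := by positivity
  refine ⟨C, hC0, fun M Q hQ hcr x hx y hy N hN => ?_⟩
  have hPs := piSum_nonneg (ρ := ρ) M S
  set PQ := piSum ρ M S + Q with hPQ
  have hPQ0 : 0 ≤ PQ := by positivity
  have hPi : ∀ j, piReal ρ M S j + Q ≤ PQ := fun j => by
    have := piReal_le_piSum (ρ := ρ) M S j; linarith
  have hdN := dyadic_pos N
  -- The cut N stays fixed while t → 0; the bounds are uniform over t ≤ 2^{-N}.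
  refine le_of_tendsto (tendsto_regBlock K M hr hγ hm hη hηm x y l i).abs
    (Filter.eventually_of_mem (Ioc_mem_nhdsGT hdN) fun t ht => ?_)
  obtain ⟨ht, htN⟩ := ht
  rw [regBlock_eq K M hr hη x y l i N ht (htN.trans (dyadic_le_one N)), blockProfile, mul_add,
    mul_add]
  refine (abs_add_le _ _).trans (add_le_add ((abs_sub _ _).trans (add_le_add ?_ ?_)) ?_)
  · rw [Finset.mul_sum]
    refine (Finset.abs_sum_le_sum_abs _ _).trans (Finset.sum_le_sum fun j _ => ?_)
    rw [abs_mul]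
    calc _ ≤ |M.gam x y j i| * (C * PQ * dyadic N ^ (α j + β - deg (l : MIdx d))) := by
          refine mul_le_mul_of_nonneg_left ((h₁ j M Q hQ hcr x hx N t ht htN).trans ?_)
            (abs_nonneg _)
          have := hc1 j
          have := hPi j
          have := piReal_nonneg (ρ := ρ) M S j
          gcongr
      _ = _ := by ring
  · rw [Finset.mul_sum]
    refine (Finset.abs_sum_le_sum_abs _ _).trans (Finset.sum_le_sum fun k _ => ?_)
    rw [abs_mul]
    split_ifs with hlk
    · calc _ ≤ ‖x - y‖ ^ (deg (k : MIdx d) - deg (l : MIdx d))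
            * (C * PQ * dyadic N ^ (α i + β - deg (k : MIdx d))) := by
            refine mul_le_mul (abs_gamPoly_le x y l k hlk)
              ((h₂ k M Q hQ hcr y hy N t ht htN).trans ?_) (abs_nonneg _) (by positivity)
            have := hc2 k
            have := hPi i
            have := piReal_nonneg (ρ := ρ) M S i
            gcongr
        _ = _ := by ring
    · rw [gamPoly_of_not_le x y hlk]; simp
  · refine (Finset.abs_sum_le_sum_abs _ _).trans ((Finset.sum_le_sum fun n hn =>
      h₃ M T l (max_le hTm (by have := hlm l l.2; omega)) y hy x n t
        (hN n (Finset.mem_range.1 hn)) ht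
        (htN.trans (dyadic_anti (Finset.mem_range.1 hn).le))).trans ?_)
    rw [← Finset.mul_sum]
    have hP := piReal_nonneg (ρ := ρ) M S i
    calc _ ≤ C₃ * piReal ρ M S i * ‖x - y‖ ^ (T - deg (l : MIdx d))
          * (C₄ * dyadic N ^ (α i + β - (max T (deg (l : MIdx d)) : ℕ))) := by
          gcongr; exact h₄ N
      _ = (C₃ * C₄) * piReal ρ M S i * (‖x - y‖ ^ (T - deg (l : MIdx d))
          * dyadic N ^ (α i + β - (max T (deg (l : MIdx d)) : ℕ))) := by ring
      _ ≤ _ := by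
          gcongr
          · rw [hCd]; linarith
          · have := hPi i; linarith

end Block

end

/-! ### Choice of the cutting scale, the diagonal, and vanishing of models with small coefficients
-/

section
variable {d : ℕ} {β ρ : ℝ} {m r : ℕ}

theorem dyadic_rpow_le {R δ : ℝ} (hR : 1 ≤ R) (hδ : 0 < δ) {N : ℕ} (h1 : dyadic N ≤ δ)
    (h2 : δ ≤ R * dyadic N) (e : ℝ) : dyadic N ^ e ≤ R ^ |e| * δ ^ e := by
  have hN := dyadic_pos N
  have hR0 : 0 < R := by linarith
  rcases le_total 0 e with he | he
  · calc dyadic N ^ e ≤ 1 * δ ^ e := by rw [one_mul]; gcongr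
      _ ≤ _ := by
        gcongr
        exact Real.one_le_rpow hR (abs_nonneg e)
  · rw [abs_of_nonpos he]
    have h3 : δ / R ≤ dyadic N := by rw [div_le_iff₀ hR0]; linarith
    calc dyadic N ^ e ≤ (δ / R) ^ e := Real.rpow_le_rpow_of_nonpos (by positivity) h3 he
      _ = _ := by
        rw [Real.div_rpow hδ.le hR0.le, Real.rpow_neg hR0.le]
        field_simp

/-- Between `δ` and `δ/R` there is a dyadic number, and larger dyadic numbers exceed `δ`. -/
theorem exists_dyadic_comparable {R δ : ℝ} (hR : 2 ≤ R) (hδ : 0 < δ) (hδR : δ ≤ R) :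
    ∃ N, dyadic N ≤ δ ∧ δ ≤ R * dyadic N ∧ ∀ n < N, δ ≤ dyadic n := by
  classical
  have hex := exists_dyadic_le hδ
  refine ⟨Nat.find hex, Nat.find_spec hex, ?_, fun n hn => (not_le.1 (Nat.find_min hex hn)).le⟩
  -- For N = 0 the comparison is δ ≤ R; otherwise 2^{-(N-1)} > δ by minimality, and R ≥ 2 absorbs
  -- the last halving.
  rcases Nat.eq_zero_or_pos (Nat.find hex) with h | h
  · rw [h, dyadic_eq_pow, pow_zero, mul_one]; exact hδR
  · obtain ⟨n, hn⟩ := Nat.exists_eq_add_of_lt h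
    have h1 := (not_le.1 (Nat.find_min hex (m := n) (by omega))).le
    have h2 : dyadic (Nat.find hex) = dyadic n * (1 / 2) := by
      rw [hn, zero_add, dyadic_add, dyadic_eq_pow 1, pow_one]
    rw [h2]
    nlinarith [dyadic_pos n]

section Block

variable {I : Type*} [Fintype I] {α : I → ℝ} {rPi : ℕ}

/-- Once 2^{-N} is replaced by δ, every term of the profile has the same homogeneity α_i+β-|l|. -/
theorem exists_blockProfile_le (α : I → ℝ) (β : ℝ) (l : MIdx d) (i : I) {R : ℝ} (hR : 1 ≤ R) :
    ∃ C : ℝ, 0 ≤ C ∧ ∀ (G : I → ℝ) (g δ : ℝ) (N : ℕ), 0 ≤ g → 0 < δ → dyadic N ≤ δ →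
      δ ≤ R * dyadic N → (∀ j, |G j| ≤ g * δ ^ (α i - α j)) →
      blockProfile α β l i G δ N ≤ C * (1 + g) * δ ^ (α i + β - deg l) := by
  classical
  have hR0 : 0 < R := by linarith
  refine ⟨(∑ j, R ^ |α j + β - deg l|)
    + (∑ k : Poly d (natAbove (α i + β)), R ^ |α i + β - deg (k : MIdx d)|)
    + R ^ |α i + β - (max (natAbove (α i + β)) (deg l) : ℕ)|, by positivity,
    fun G g δ N hg hδ h1 h2 hG => ?_⟩
  have hd := dyadic_rpow_le hR hδ h1 h2
  rw [blockProfile, add_mul, add_mul, add_mul, add_mul]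
  have hpow : ∀ (a b : ℕ) (s : ℝ), a ≤ b → δ ^ (b - a) * δ ^ (s - b) = δ ^ (s - a) :=
    fun a b s hab => by
      rw [← Real.rpow_natCast, ← Real.rpow_add hδ]
      push_cast [hab]
      congr 1; ring
  refine add_le_add (add_le_add ?_ ?_) ?_
  · rw [Finset.sum_mul, Finset.sum_mul]
    refine Finset.sum_le_sum fun j _ => ?_
    calc _ ≤ (g * δ ^ (α i - α j)) * (R ^ |α j + β - deg l| * δ ^ (α j + β - deg l)) := by
          exact mul_le_mul (hG j) (hd _) (Real.rpow_nonneg (dyadic_pos N).le _) (by positivity)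
      _ = R ^ |α j + β - deg l| * g * (δ ^ (α i - α j) * δ ^ (α j + β - deg l)) := by ring
      _ = R ^ |α j + β - deg l| * g * δ ^ (α i + β - deg l) := by
          rw [← Real.rpow_add hδ]; congr 2; ring
      _ ≤ _ := by gcongr; linarith
  · rw [Finset.sum_mul, Finset.sum_mul]
    refine Finset.sum_le_sum fun k _ => ?_
    split_ifs with hlk
    · calc _ ≤ δ ^ (deg (k : MIdx d) - deg l) * (R ^ |α i + β - deg (k : MIdx d)|
            * δ ^ (α i + β - deg (k : MIdx d))) := by
            gcongr; exact hd _
        _ = R ^ |α i + β - deg (k : MIdx d)| * 1 * (δ ^ (deg (k : MIdx d) - deg l)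
            * δ ^ (α i + β - deg (k : MIdx d))) := by ring
        _ = R ^ |α i + β - deg (k : MIdx d)| * 1 * δ ^ (α i + β - deg l) := by
            rw [hpow _ _ _ (deg_mono hlk)]
        _ ≤ _ := by gcongr; linarith
    · rw [zero_mul]; positivity
  -- The subtraction is truncated: both sides vanish when |l| ≥ T.
  · have e : natAbove (α i + β) - deg l = max (natAbove (α i + β)) (deg l) - deg l := by omega
    rw [e]
    calc _ ≤ δ ^ (max (natAbove (α i + β)) (deg l) - deg l)
          * (R ^ |α i + β - (max (natAbove (α i + β)) (deg l) : ℕ)|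
            * δ ^ (α i + β - (max (natAbove (α i + β)) (deg l) : ℕ))) := by
          gcongr; exact hd _
      _ = R ^ |α i + β - (max (natAbove (α i + β)) (deg l) : ℕ)| * 1
            * (δ ^ (max (natAbove (α i + β)) (deg l) - deg l)
            * δ ^ (α i + β - (max (natAbove (α i + β)) (deg l) : ℕ))) := by ring
      _ = R ^ |α i + β - (max (natAbove (α i + β)) (deg l) : ℕ)| * 1 * δ ^ (α i + β - deg l) := by
          rw [hpow _ _ _ (le_max_right _ _)]
      _ ≤ _ := by gcongr; linarith

theorem tendsto_dyadic_rpow {e : ℝ} (he : 0 ≤ e) :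
    Tendsto (fun N => dyadic N ^ e) atTop (𝓝 (if e = 0 then 1 else 0)) := by
  split_ifs with h
  · simp [h]
  · have h0 : 0 < e := lt_of_le_of_ne he (Ne.symm h)
    have := (Real.continuousAt_rpow_const 0 e (Or.inr h0.le)).tendsto.comp tendsto_dyadic
    rwa [Real.zero_rpow h] at this

/-- At δ = 0 the sum over k retains only k = l, through 0^0 = 1, and the Taylor term vanishes
because |l| < T. The surviving powers of 2^{-N} have nonnegative exponents, and a nonzero limit can
come only from exponent 0. -/
theorem tendsto_blockProfile_zero (l : MIdx d) (i : I) {G : I → ℝ}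
    (hl : (deg l : ℝ) ≤ α i + β) (hG : ∀ j, α j < α i → G j = 0) :
    ∃ L : ℝ, Tendsto (blockProfile α β l i G 0) atTop (𝓝 L) ∧
      ((deg l : ℝ) < α i + β → L = 0) ∧
      ∀ g, (∀ j, α j = α i → |G j| ≤ g) → L ≤ (Fintype.card I + 1) * (1 + g) := by
  classical
  have hlT := lt_natAbove_iff.2 hl
  have h1 : Tendsto (fun N => ∑ j, |G j| * dyadic N ^ (α j + β - deg l)) atTop
      (𝓝 (∑ j, if α j + β = deg l then |G j| else 0)) := by
    refine tendsto_finsetSum _ fun j _ => ?_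
    rcases lt_or_ge (α j) (α i) with h | h
    · simp [hG j h]
    · have := (tendsto_dyadic_rpow (e := α j + β - deg l) (by linarith)).const_mul |G j|
      simpa [sub_eq_zero] using this
  have h2 : Tendsto (fun N => ∑ k : Poly d (natAbove (α i + β)),
      (if l ≤ k then (0 : ℝ) ^ (deg (k : MIdx d) - deg l) else 0)
        * dyadic N ^ (α i + β - deg (k : MIdx d))) atTop
      (𝓝 (if α i + β = deg l then 1 else 0)) := by
    have e : ∀ N, ∑ k : Poly d (natAbove (α i + β)),
        (if l ≤ k then (0 : ℝ) ^ (deg (k : MIdx d) - deg l) else 0)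
        * dyadic N ^ (α i + β - deg (k : MIdx d)) = dyadic N ^ (α i + β - deg l) := fun N => by
      rw [Finset.sum_eq_single (⟨l, by exact_mod_cast hlT⟩ : Poly d (natAbove (α i + β)))]
      · simp
      · intro k _ hk
        split_ifs with h
        · have : deg (k : MIdx d) - deg l ≠ 0 := fun h0 =>
            hk (Subtype.ext (eq_of_le_of_deg_le h (by omega)).symm)
          rw [zero_pow this, zero_mul]
        · rw [zero_mul]
      · simp
    simp only [e]
    simpa [sub_eq_zero] using tendsto_dyadic_rpow (e := α i + β - deg l) (by linarith)
  refine ⟨(∑ j, if α j + β = deg l then |G j| else 0) + (if α i + β = deg l then 1 else 0) + 0,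
    (h1.add h2).add ?_, fun hlt => ?_, fun g hg => ?_⟩
  · rw [zero_pow (by omega)]
    simp
  · rw [if_neg (by linarith), add_zero, add_zero]
    refine Finset.sum_eq_zero fun j _ => ?_
    split_ifs with h
    · rw [hG j (by linarith), abs_zero]
    · rfl
  · have hg0 : 0 ≤ g := (abs_nonneg _).trans (hg i rfl)
    have : ∑ j, (if α j + β = deg l then |G j| else 0) ≤ ∑ _j : I, (1 + g) := by
      refine Finset.sum_le_sum fun j _ => ?_
      split_ifs with h
      · rcases (show α j ≤ α i by linarith).lt_or_eq with h' | h'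
        · rw [hG j h', abs_zero]; linarith
        · linarith [hg j h']
      · linarith
    rw [Finset.sum_const, Finset.card_univ, nsmul_eq_mul] at this
    split_ifs <;> linarith

theorem abs_le_of_enorm_div_le {c δ e g : ℝ} (hδ : 0 < δ) (hg : 0 ≤ g) :
    ‖c‖ₑ / ENNReal.ofReal δ ^ e ≤ ENNReal.ofReal g ↔ |c| ≤ g * δ ^ e := by
  have hp := Real.rpow_pos_of_pos hδ e
  rw [ENNReal.ofReal_rpow_of_pos hδ, Real.enorm_eq_ofReal_abs, ← ENNReal.ofReal_div_of_pos hp,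
    ENNReal.ofReal_le_ofReal_iff hg, div_le_iff₀ hp]

theorem eq_zero_of_enorm_div_zero_rpow_le {c e g : ℝ} (he : 0 < e)
    (h : ‖c‖ₑ / (0 : ℝ≥0∞) ^ e ≤ ENNReal.ofReal g) : c = 0 := by
  rw [ENNReal.zero_rpow_of_pos he] at h
  by_contra hc
  rw [ENNReal.div_zero (by simpa using hc)] at h
  exact absurd h (by simp)

theorem abs_le_of_enorm_div_zero_rpow_le {c g : ℝ} (hg : 0 ≤ g)
    (h : ‖c‖ₑ / (0 : ℝ≥0∞) ^ (0 : ℝ) ≤ ENNReal.ofReal g) : |c| ≤ g := by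
  rwa [ENNReal.rpow_zero, div_one, Real.enorm_eq_ofReal_abs, ENNReal.ofReal_le_ofReal_iff hg] at h

theorem exists_enorm_hatBlock_div_le (K : RegKernel d β m r ρ) (hr : rPi ≤ r) {γ : ℝ}
    (hγ : ∀ i, α i < γ) (hm : γ + β < m) {S : Set (E d)} (hS : IsCompact S)
    {η : TestFn d} (hη : tsupport η ⊆ Metric.closedBall 0 1)
    (hηm : ∀ i, IsMollifier (α i + β) η) (l : Poly d (γ + β)) (i : I) :
    ∃ C : ℝ, 0 ≤ C ∧ ∀ (M : Model d I α rPi) (Q g : ℝ), 0 ≤ Q → 0 ≤ g → CritBound K M η S Q →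
      ∀ x ∈ S, ∀ y ∈ S,
      (∀ j, ‖M.gam x y j i‖ₑ / edist x y ^ (α i - α j) ≤ ENNReal.ofReal g) →
      ‖hatBlock K M γ x y l i‖ₑ / edist x y ^ (α i + β - deg (l : MIdx d))
        ≤ ENNReal.ofReal (C * (piSum ρ M S + Q) * (1 + g)) := by
  obtain ⟨C₁, hC₁, h₁⟩ := exists_hatBlock_bound K hr hγ hm hS hη hηm l i
  -- The diameter covers pairs with |x-y| > 1, for which no dyadic scale exceeds the distance.
  set R := max 2 (Metric.diam S) with hRd
  have hR2 : 2 ≤ R := le_max_left _ _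
  obtain ⟨C₂, hC₂, h₂⟩ := exists_blockProfile_le α β (l : MIdx d) i
    (show 1 ≤ R by linarith)
  refine ⟨C₁ * (C₂ + (Fintype.card I + 1)), by positivity,
    fun M Q g hQ hg hcr x hx y hy hG => ?_⟩
  have hP := piSum_nonneg (ρ := ρ) M S
  have hb := h₁ M Q hQ hcr x hx y hy
  -- On the diagonal a negative exponent makes the denominator infinite, a positive one requires the
  -- entry to vanish, and exponent 0 requires a bound; the latter two follow from N → ∞.
  rcases eq_or_ne x y with rfl | hxy
  · rw [edist_self] at hG ⊢
    rcases lt_or_ge (α i + β) (deg (l : MIdx d)) with hlt | hle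
    · rw [ENNReal.zero_rpow_of_neg (by linarith), ENNReal.div_top]
      exact zero_le
    · obtain ⟨L, hL, hL0, hLg⟩ := tendsto_blockProfile_zero (α := α) (β := β) (l : MIdx d) i
        (G := fun j => M.gam x x j i) hle
        (fun j hj => eq_zero_of_enorm_div_zero_rpow_le (by linarith) (hG j))
      have hlim : |hatBlock K M γ x x l i| ≤ C₁ * (piSum ρ M S + Q) * L := by
        refine ge_of_tendsto' (hL.const_mul _) fun N => ?_
        have := hb N (fun n _ => by simpa using (dyadic_pos n).le)
        simpa using this
      rcases hle.lt_or_eq with hlt | heq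
      · rw [hL0 hlt, mul_zero] at hlim
        rw [abs_nonpos_iff.1 hlim]
        simp
      · rw [← heq, sub_self, ENNReal.rpow_zero, div_one, Real.enorm_eq_ofReal_abs]
        refine ENNReal.ofReal_le_ofReal (hlim.trans ?_)
        have hL' := hLg g fun j hj => abs_le_of_enorm_div_zero_rpow_le hg
          (by simpa [hj] using hG j)
        calc _ ≤ C₁ * (piSum ρ M S + Q) * ((Fintype.card I + 1) * (1 + g)) := by gcongr
          _ ≤ C₁ * (piSum ρ M S + Q) * ((C₂ + (Fintype.card I + 1)) * (1 + g)) := by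
            refine mul_le_mul_of_nonneg_left (mul_le_mul_of_nonneg_right (by linarith)
              (by linarith)) (by positivity)
          _ = _ := by ring
  · have hδ : 0 < ‖x - y‖ := norm_pos_iff.2 (sub_ne_zero.2 hxy)
    have hed : edist x y = ENNReal.ofReal ‖x - y‖ := by rw [edist_dist, dist_eq_norm]
    rw [hed] at hG ⊢
    obtain ⟨N, hN1, hN2, hN3⟩ := exists_dyadic_comparable hR2 hδ (by
      rw [← dist_eq_norm]
      exact (Metric.dist_le_diam_of_mem hS.isBounded hx hy).trans (le_max_right _ _))
    rw [abs_le_of_enorm_div_le hδ (by positivity)]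
    refine (hb N hN3).trans ?_
    have := h₂ (fun j => M.gam x y j i) g ‖x - y‖ N hg hδ hN1 hN2
      fun j => (abs_le_of_enorm_div_le hδ hg).1 (hG j)
    have hp := Real.rpow_pos_of_pos hδ (α i + β - deg (l : MIdx d))
    calc _ ≤ C₁ * (piSum ρ M S + Q) * (C₂ * (1 + g) * ‖x - y‖ ^ (α i + β - deg (l : MIdx d))) := by
          gcongr
      _ = C₁ * C₂ * (piSum ρ M S + Q) * (1 + g) * ‖x - y‖ ^ (α i + β - deg (l : MIdx d)) := by
          ring
      _ ≤ _ := by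
          gcongr
          have : (0 : ℝ) ≤ Fintype.card I + 1 := by positivity
          linarith

/-! ### Models with small coefficients -/

/-- Among the i with Π^i_x(φ) ≠ 0, take one with maximal α_i and, among these, maximal |Π^i_x(φ)|.
In Π^i_x = ∑_j Γ^{ji}_{xx} Π^j_x only indices with α_j = α_i then contribute, whence |Π^i_x(φ)| ≤
|I| g |Π^i_x(φ)|, a contradiction. -/
theorem pi_eq_zero_of_small (M : Model d I α rPi) {x : E d} {g : ℝ}
    (hg : Fintype.card I * g < 1)
    (h0 : ∀ i j, α j < α i → M.gam x x j i = 0)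
    (h1 : ∀ i j, α j = α i → |M.gam x x j i| ≤ g) (i : I) : M.pi i x = 0 := by
  classical
  ext φ
  by_contra hi
  set A := Finset.univ.filter fun j => M.pi j x φ ≠ 0 with hA
  obtain ⟨i₀, hi₀, hmax⟩ := A.exists_max_image (fun j => toLex (α j, |M.pi j x φ|))
    ⟨i, by simpa [hA] using hi⟩
  have hne : M.pi i₀ x φ ≠ 0 := by simpa [hA] using hi₀
  have hre : M.pi i₀ x φ = ∑ j, M.gam x x j i₀ * M.pi j x φ := by
    conv_lhs => rw [M.reexpansion i₀ x x]
    simp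
  have hle : |M.pi i₀ x φ| ≤ ∑ _j : I, g * |M.pi i₀ x φ| := by
    conv_lhs => rw [hre]
    refine (Finset.abs_sum_le_sum_abs _ _).trans (Finset.sum_le_sum fun j _ => ?_)
    have hg0 : 0 ≤ g := (abs_nonneg _).trans (h1 i₀ i₀ rfl)
    rw [abs_mul]
    by_cases hj : M.pi j x φ = 0
    · rw [hj]; simp; positivity
    · have := hmax j (by simpa [hA] using hj)
      rw [Prod.Lex.toLex_le_toLex] at this
      rcases this with h | ⟨h, h'⟩
      · rw [h0 i₀ j h]; simp; positivity
      · exact mul_le_mul (h1 i₀ j h) h' (abs_nonneg _) hg0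
  rw [Finset.sum_const, Finset.card_univ, nsmul_eq_mul, ← mul_assoc] at hle
  nlinarith [abs_pos.2 hne]

theorem kpiDeriv_eq_zero (K : RegKernel d β m r ρ) (M : Model d I α rPi) (hr : rPi ≤ r)
    {η : TestFn d} (hη : tsupport η ⊆ Metric.closedBall 0 1) (i : I)
    (hηm : IsMollifier (α i + β) η) (k : MIdx d) (hk : deg k + 1 ≤ m)
    (hσ : (deg k : ℝ) < α i + β) {x : E d} (h : M.pi i x = 0) : kpiDeriv K M i k x = 0 := by
  have h1 := tendsto_kpiDeriv K M hr hη i hηm k hk hσ x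
  have h2 : ∀ t n, term K M η i k x t n = 0 := fun t n => by
    -- The zero functional is an empty linear combination.
    have := pieceVal_sum_left (ι := Empty) K (G := fun e => e.elim) (fun e => e.elim)
      (fun e => e.elim) ((M.finiteOrder i x).mono hr) (fun u => by rw [h]; simp) n (dtest η k x t)
    simpa [term] using this
  simp only [h2, tsum_zero] at h1
  exact tendsto_nhds_unique h1 tendsto_const_nhds

theorem hatBlock_eq_zero (K : RegKernel d β m r ρ) (M : Model d I α rPi) (hr : rPi ≤ r) {γ : ℝ}
    (hγ : ∀ i, α i < γ) (hm : γ + β < m)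
    {η : TestFn d} (hη : tsupport η ⊆ Metric.closedBall 0 1)
    (hηm : ∀ i, IsMollifier (α i + β) η) {x y : E d} (hx : ∀ i, M.pi i x = 0)
    (hy : ∀ i, M.pi i y = 0) (l : Poly d (γ + β)) (i : I) : hatBlock K M γ x y l i = 0 := by
  have hlm : ∀ k : MIdx d, (deg k : ℝ) < γ + β → deg k + 1 ≤ m := fun k hk => by
    exact_mod_cast hk.trans hm
  rw [hatBlock, Finset.sum_eq_zero, Finset.sum_eq_zero, sub_zero]
  · intro k _
    rw [kpiDeriv_eq_zero K M hr hη i (hηm i) k (hlm k (k.2.trans (by linarith [hγ i]))) k.2 (hy i),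
      mul_zero]
  · intro j _
    split_ifs with h
    · rw [kpiDeriv_eq_zero K M hr hη j (hηm j) l (hlm l l.2) h (hx j), zero_mul]
    · rfl

end Block

end

section
variable {d : ℕ} {β ρ : ℝ} {m r : ℕ}

section Assembly

variable {I : Type*} [Fintype I] {α : I → ℝ} {rPi : ℕ}

/-! ### Group property and triangular structure -/

open Classical in
/-- The pointwise derivatives of `𝖪Π` at the base point, as a matrix. -/
def derivMatrix (K : RegKernel d β m r ρ) (M : Model d I α rPi) (γ : ℝ) (x : E d) :
    Matrix (Poly d (γ + β)) I ℝ :=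
  fun l j => if (deg (l : MIdx d) : ℝ) < α j + β then kpiDeriv K M j l x else 0

/-- The coefficients of the polynomial model, as a matrix. -/
def polyMatrix (t : ℝ) (x y : E d) : Matrix (Poly d t) (Poly d t) ℝ := fun l k => gamPoly x y l k

theorem polyMatrix_mul (t : ℝ) (x y z : E d) :
    polyMatrix t x y * polyMatrix t y z = polyMatrix t x z := by
  ext l k
  rw [Matrix.mul_apply]
  exact sum_gamPoly_mul_gamPoly x y z l k k.2

/-- As α_i < γ, the sum over poly(α_i+β) extends by zero to poly(γ+β), which turns the block into
matrix products. -/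
theorem hatBlock_eq (K : RegKernel d β m r ρ) (M : Model d I α rPi) {γ : ℝ}
    (hγ : ∀ i, α i < γ) (x y : E d) :
    hatBlock K M γ x y = derivMatrix K M γ x * M.gam x y
      - polyMatrix (γ + β) x y * derivMatrix K M γ y := by
  classical
  ext l i
  rw [Matrix.sub_apply, Matrix.mul_apply, Matrix.mul_apply, hatBlock,
    sum_poly_eq_sum_ite (show α i + β ≤ γ + β by linarith [hγ i])
      (fun k => gamPoly x y l k * kpiDeriv K M i k y)]
  congr 1
  · refine Finset.sum_congr rfl fun j _ => ?_
    simp only [derivMatrix]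
    split_ifs <;> simp
  · refine Finset.sum_congr rfl fun k _ => ?_
    simp only [derivMatrix, polyMatrix]
    split_ifs <;> simp

/-- With the block in the form D_x Γ - Γ^poly D_y, the mixed terms through the middle point y
cancel. -/
theorem groupProperty_hatGam (K : RegKernel d β m r ρ) (M : Model d I α rPi) {γ : ℝ}
    (hγ : ∀ i, α i < γ) (h : GroupProperty M.gam) : GroupProperty (hatGam K M γ) := by
  intro x y z
  have e : ∀ x y, hatGam K M γ x y
      = Matrix.fromBlocks (M.gam x y) 0 (hatBlock K M γ x y) (polyMatrix (γ + β) x y) :=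
    fun _ _ => rfl
  rw [e, e, e, Matrix.fromBlocks_multiply, hatBlock_eq K M hγ, hatBlock_eq K M hγ,
    hatBlock_eq K M hγ, ← h x y z, ← polyMatrix_mul (γ + β) x y z]
  simp [Matrix.sub_mul, Matrix.mul_sub, Matrix.mul_assoc]

theorem triangular_hatGam (K : RegKernel d β m r ρ) (M : Model d I α rPi) (γ : ℝ)
    (h : Triangular α M.gam) : Triangular (hatHom d α β γ) (hatGam K M γ) := by
  intro x y
  refine ⟨?_, ?_⟩
  · rintro (i | k)
    · exact (h x y).1 i
    · exact gamPoly_self_index x y k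
  · rintro (i | k) (j | l) hne hle
    · exact (h x y).2 i j (fun e => hne (e ▸ rfl)) (by simpa [hatHom] using hle)
    · have hle' : α i + β ≤ deg (l : MIdx d) := hle
      change hatBlock K M γ x y l i = 0
      -- With |l| ≥ α_i+β, every k in the second sum has |k| < |l|, and every j in the first has α_j
      -- > α_i; both sums vanish term by term.
      rw [hatBlock, Finset.sum_eq_zero, Finset.sum_eq_zero, sub_zero]
      · intro k _
        have : deg (k : MIdx d) < deg (l : MIdx d) := by exact_mod_cast k.2.trans_le hle'
        rw [gamPoly_of_deg_lt x y this, zero_mul]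
      · intro j _
        split_ifs with hj
        · rw [(h x y).2 i j (fun e => by rw [e] at hj; linarith) (by linarith), mul_zero]
        · rfl
    · rfl
    · have hle' : (deg (k : MIdx d) : ℝ) ≤ deg (l : MIdx d) := hle
      exact gamPoly_of_deg_le (fun e => hne (by rw [Subtype.ext e])) (by exact_mod_cast hle')

/-! ### Norms of coefficients -/

theorem enorm_div_le_gamNorm {I J : Type*} (a : I → ℝ) (b : J → ℝ) {S : Set (E d)}
    (G : E d → E d → Matrix J I ℝ) {x y : E d} (hx : x ∈ S) (hy : y ∈ S) (l : J) (i : I) :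
    ‖G x y l i‖ₑ / edist x y ^ (a i - b l) ≤ gamNorm a b S G :=
  le_iSup₂_of_le x hx (le_iSup₂_of_le y hy (le_iSup₂_of_le l i le_rfl))

theorem gamNorm_le {I J : Type*} {a : I → ℝ} {b : J → ℝ} {S : Set (E d)}
    {G : E d → E d → Matrix J I ℝ} {c : ℝ≥0∞}
    (h : ∀ x ∈ S, ∀ y ∈ S, ∀ l i, ‖G x y l i‖ₑ / edist x y ^ (a i - b l) ≤ c) :
    gamNorm a b S G ≤ c :=
  iSup₂_le fun x hx => iSup₂_le fun y hy => iSup₂_le fun l i => h x hx y hy l i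

theorem analyticBound_iff {I : Type*} {a : I → ℝ} {G : E d → E d → Matrix I I ℝ} :
    AnalyticBound a G ↔ ∀ S : Set (E d), IsCompact S → gamNorm a a S G < ⊤ := by
  refine forall₂_congr fun S _ => ⟨?_, fun h => ?_⟩
  · rintro ⟨C, -, hC⟩
    refine (gamNorm_le fun x hx y hy l i => ?_).trans_lt (ENNReal.coe_lt_top (r := C))
    exact ENNReal.div_le_of_le_mul (by simpa [edist_comm] using hC x hx y hy l i)
  -- The added 1 keeps the constant positive, so that its product with an infinite power on the
  -- diagonal is ∞.
  · refine ⟨(gamNorm a a S G).toNNReal + 1, by positivity, fun x hx y hy j i => ?_⟩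
    have h1 := enorm_div_le_gamNorm a a G hx hy j i
    have h2 : gamNorm a a S G ≤ ((gamNorm a a S G).toNNReal + 1 : ℝ≥0) := by
      push_cast
      rw [ENNReal.coe_toNNReal h.ne]
      exact le_self_add
    rw [edist_comm y x]
    exact (ENNReal.div_le_iff_le_mul (Or.inr (by simp)) (Or.inr (by simp))).1 (h1.trans h2)

theorem enorm_gamPoly_div_le (x y : E d) (l k : MIdx d) :
    ‖gamPoly x y l k‖ₑ / edist x y ^ ((deg k : ℝ) - deg l) ≤ 1 := by
  by_cases h : l ≤ k
  · refine ENNReal.div_le_of_le_mul ?_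
    rw [one_mul, ← Nat.cast_sub (deg_mono h), ENNReal.rpow_natCast, edist_dist, dist_eq_norm,
      ← ENNReal.ofReal_pow (norm_nonneg _), Real.enorm_eq_ofReal_abs]
    exact ENNReal.ofReal_le_ofReal (abs_gamPoly_le x y l k h)
  · rw [gamPoly_of_not_le x y h]; simp

theorem gamNorm_hatGam_le (K : RegKernel d β m r ρ) (M : Model d I α rPi) (γ : ℝ) (S : Set (E d)) :
    gamNorm (hatHom d α β γ) (hatHom d α β γ) S (hatGam K M γ) ≤
      max (gamNorm (fun i => α i + β) (polyHom d (γ + β)) S (hatBlock K M γ))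
        (max 1 (gamNorm α α S M.gam)) := by
  refine gamNorm_le fun x hx y hy => ?_
  rintro (j | l) (i | k)
  · refine le_max_of_le_right (le_max_of_le_right ?_)
    have := enorm_div_le_gamNorm α α M.gam hx hy j i
    rwa [show α i - α j = (α i + β) - (α j + β) by ring] at this
  · have : hatGam K M γ x y (Sum.inl j) (Sum.inr k) = 0 := rfl
    rw [this]; simp
  · exact le_max_of_le_left
      (enorm_div_le_gamNorm (fun i => α i + β) (polyHom d (γ + β)) (hatBlock K M γ) hx hy l i)
  · exact le_max_of_le_right (le_max_of_le_left (enorm_gamPoly_div_le x y l k))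

/-! ### Bounds by the norms of the model -/

theorem kpi_smul (K : RegKernel d β m r ρ) (M : Model d I α rPi) (hr : rPi ≤ r) (i : I) (x : E d)
    (c : ℝ) (u : TestFn d) : kpi K M i x (c • u) = c * kpi K M i x u := by
  unfold kpi RegKernel.apply
  rw [← tsum_mul_left]
  exact tsum_congr fun n => pieceVal_smul K ((M.finiteOrder i x).mono hr) n u c

theorem tderiv_smul (k : MIdx d) (c : ℝ) (u : TestFn d) : tderiv k (c • u) = c • tderiv k u := by
  ext z
  rw [coe_tderiv, smul_apply, coe_tderiv, smul_eq_mul]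
  exact congrFun (pderiv_const_mul (contDiff_testFn u (deg k)) c k le_rfl) z

/-- A fixed η is, up to a constant B, a unit test function of order r₀, so the supremum in the
semi-norm controls it. -/
theorem exists_abs_distDeriv_le (K : RegKernel d β m r ρ) (hr : rPi ≤ r) {η : TestFn d}
    (hη : tsupport η ⊆ Metric.closedBall 0 1) (r₀ : ℕ) :
    ∃ B : ℝ, 0 ≤ B ∧ ∀ (M : Model d I α rPi) (S : Set (E d)) (i : I) (k : MIdx d),
      homNorm S 1 r₀ 0 (fun x => distDeriv k (kpi K M i x)) < ⊤ →
      ∀ y ∈ S, ∀ t, 0 < t → t ≤ 1 → |distDeriv k (kpi K M i y) (scaled η y t)|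
        ≤ B * (homNorm S 1 r₀ 0 (fun x => distDeriv k (kpi K M i x))).toReal := by
  obtain ⟨B, hB, h⟩ := exists_pderiv_bound η 0 r₀
  refine ⟨B, hB, fun M S i k hfin y hy t ht ht1 => ?_⟩
  have := abs_le_of_homNorm hfin hy (fun c u => by
    unfold distDeriv
    rw [tderiv_smul, kpi_smul K M hr]; ring) ht ht1 (tsupport_scaled_subset hη y ht) (A := B)
    fun p hp z => by
      rw [pderiv_scaled η y ht, abs_mul, abs_of_pos (by positivity), pow_add, mul_inv, mul_comm]
      gcongr
      simpa using h p hp (t⁻¹ • (z - y))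
  rwa [Real.rpow_zero, mul_one, mul_comm] at this

/-- Compatibility allows an order r₀ depending on i and k, but only finitely many pairs are
critical, so one Q serves them all. -/
theorem exists_critBound (K : RegKernel d β m r ρ) (hr : rPi ≤ r) {η : TestFn d}
    (hη : tsupport η ⊆ Metric.closedBall 0 1) {M : Model d I α rPi} (hM : Compatible K M)
    {S : Set (E d)} (hS : IsCompact S) : ∃ Q : ℝ, 0 ≤ Q ∧ CritBound K M η S Q := by
  have h1 : ∀ i, ∀ k : MIdx d, ∃ q : ℝ, (deg k : ℝ) = α i + β → ∀ y ∈ S, ∀ t, 0 < t → t ≤ 1 →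
      |distDeriv k (kpi K M i y) (scaled η y t)| ≤ q := fun i k => by
    by_cases hk : (deg k : ℝ) = α i + β
    · obtain ⟨r₀, hr₀⟩ := hM i k hk
      obtain ⟨B, -, hB⟩ := exists_abs_distDeriv_le (α := α) K hr hη r₀
      exact ⟨_, fun _ => hB M S i k (hr₀ S hS 1 le_rfl)⟩
    · exact ⟨0, fun h => absurd h hk⟩
  choose q hq using h1
  choose C hC hqC using fun i => exists_bound_midx (q i) ⌈α i + β⌉₊
  refine ⟨∑ i, C i, Finset.sum_nonneg fun i _ => hC i, fun i k hk y hy t ht ht1 => ?_⟩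
  refine (hq i k hk y hy t ht ht1).trans ((hqC i k ?_).trans
    (Finset.single_le_sum (f := C) (fun i _ => hC i) (Finset.mem_univ i)))
  exact_mod_cast hk.le.trans (Nat.le_ceil _)

theorem homNorm_mono {S S' : Set (E d)} (h : S ⊆ S') (Λ : ℝ) (r₀ : ℕ) (a : ℝ)
    (F : E d → TestFn d → ℝ) : homNorm S Λ r₀ a F ≤ homNorm S' Λ r₀ a F :=
  biSup_mono fun _ hx => h hx

theorem exists_gamNorm_hatBlock_le (K : RegKernel d β m r ρ) (hr : rPi ≤ r) {γ : ℝ}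
    (hγ : ∀ i, α i < γ) (hm : γ + β < m) {S : Set (E d)} (hS : IsCompact S)
    {η : TestFn d} (hη : tsupport η ⊆ Metric.closedBall 0 1)
    (hηm : ∀ i, IsMollifier (α i + β) η) :
    ∃ C : ℝ, 0 ≤ C ∧ ∀ (M : Model d I α rPi) (Q : ℝ), 0 ≤ Q → CritBound K M η S Q →
      gamNorm α α S M.gam < ⊤ →
      gamNorm (fun i => α i + β) (polyHom d (γ + β)) S (hatBlock K M γ) ≤
        ENNReal.ofReal (C * (piSum ρ M S + Q) * (gamNorm α α S M.gam).toReal) := by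
  choose C hC h using fun (l : Poly d (γ + β)) (i : I) =>
    exists_enorm_hatBlock_div_le K hr hγ hm hS hη hηm l i
  set C₀ := ∑ l, ∑ i, C l i with hC₀
  have hCle : ∀ l i, C l i ≤ C₀ := fun l i =>
    (Finset.single_le_sum (f := C l) (fun i _ => hC l i) (Finset.mem_univ i)).trans
      (Finset.single_le_sum (f := fun l => ∑ i, C l i)
        (fun l _ => Finset.sum_nonneg fun i _ => hC l i) (Finset.mem_univ l))
  have hC₀0 : 0 ≤ C₀ := Finset.sum_nonneg fun l _ => Finset.sum_nonneg fun i _ => hC l i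
  refine ⟨C₀ * (Fintype.card I + 1), by positivity, fun M Q hQ hcr hfin => ?_⟩
  set g := (gamNorm α α S M.gam).toReal with hg
  have hg0 : 0 ≤ g := ENNReal.toReal_nonneg
  have hG : ∀ x ∈ S, ∀ y ∈ S, ∀ i j,
      ‖M.gam x y j i‖ₑ / edist x y ^ (α i - α j) ≤ ENNReal.ofReal g := fun x hx y hy i j => by
    rw [hg, ENNReal.ofReal_toReal hfin.ne]
    exact enorm_div_le_gamNorm α α M.gam hx hy j i
  have hP := piSum_nonneg (ρ := ρ) M S
  refine gamNorm_le fun x hx y hy l i => ?_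
  -- Small coefficients force Π to vanish on S; otherwise 1 + g ≤ (|I|+1) g turns the affine bound
  -- into a linear one.
  rcases lt_or_ge (Fintype.card I * g) 1 with hsm | hlg
  · have hz : ∀ x ∈ S, ∀ i, M.pi i x = 0 := fun x hx => by
      have hGx : ∀ i j, ‖M.gam x x j i‖ₑ / (0 : ℝ≥0∞) ^ (α i - α j) ≤ ENNReal.ofReal g :=
        fun i j => by simpa using hG x hx x hx i j
      exact pi_eq_zero_of_small M hsm
        (fun i j hij => eq_zero_of_enorm_div_zero_rpow_le (by linarith) (hGx i j))
        (fun i j hij => abs_le_of_enorm_div_zero_rpow_le hg0 (by simpa [hij] using hGx i j))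
    rw [hatBlock_eq_zero K M hr hγ hm hη hηm (hz x hx) (hz y hy)]
    simp
  · refine (h l i M Q g hQ hg0 hcr x hx y hy (hG x hx y hy i)).trans (ENNReal.ofReal_le_ofReal ?_)
    have := hCle l i
    calc _ ≤ C₀ * (piSum ρ M S + Q) * ((Fintype.card I + 1) * g) := by
          refine mul_le_mul (by gcongr) (by linarith) (by linarith) (by positivity)
      _ = _ := by ring

theorem piNorm_lt_top (K : RegKernel d β m r ρ) (M : Model d I α rPi) {S : Set (E d)}
    (hS : IsCompact S) : piNorm M S (2 * (1 + ρ)) < ⊤ := by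
  have h1 : piNorm M S (2 * (1 + ρ)) ≤ ∑ i, homNorm S (2 * (1 + ρ)) rPi (α i)
      fun x φ => M.pi i x φ :=
    iSup_le fun i => Finset.single_le_sum (f := fun i => homNorm S (2 * (1 + ρ)) rPi (α i)
      fun x φ => M.pi i x φ) (fun _ _ => zero_le) (Finset.mem_univ i)
  have := K.ρ_pos
  exact h1.trans_lt (ENNReal.sum_lt_top.2 fun i _ => M.homogeneous i S hS _ (by linarith))

theorem piSum_le (K : RegKernel d β m r ρ) (M : Model d I α rPi) {S S' : Set (E d)}
    (hSS : S ⊆ S') (hS' : IsCompact S') :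
    piSum ρ M S ≤ Fintype.card I * (piNorm M S' (2 * (1 + ρ))).toReal := by
  have : piSum ρ M S ≤ ∑ _i : I, (piNorm M S' (2 * (1 + ρ))).toReal :=
    Finset.sum_le_sum fun i _ => ENNReal.toReal_mono (piNorm_lt_top K M hS').ne
      ((homNorm_mono hSS _ _ _ _).trans
        (le_iSup (fun i => homNorm S' (2 * (1 + ρ)) rPi (α i) fun x φ => M.pi i x φ) i))
  simpa using this

theorem homNorm_le_compatNorm (K : RegKernel d β m r ρ) (M : Model d I α rPi) {S S' : Set (E d)}
    (hSS : S ⊆ S') (i : I) (k : MIdx d) (hk : (deg k : ℝ) = α i + β) :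
    homNorm S 1 rPi 0 (fun x => distDeriv k (kpi K M i x)) ≤ compatNorm K M S' 1 := by
  refine (homNorm_mono hSS _ _ _ _).trans ?_
  refine (ENNReal.le_tsum (f := fun k : {k : MIdx d // (deg k : ℝ) = α i + β} =>
    homNorm S' 1 rPi 0 fun x => distDeriv (k : MIdx d) (kpi K M i x)) ⟨k, hk⟩).trans ?_
  exact Finset.single_le_sum (f := fun i => ∑' k : {k : MIdx d // (deg k : ℝ) = α i + β},
    homNorm S' 1 rPi 0 fun x => distDeriv (k : MIdx d) (kpi K M i x))
    (fun _ _ => zero_le) (Finset.mem_univ i)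

theorem exists_gamNorm_hatBlock_le_norms (K : RegKernel d β m r ρ) (hr : rPi ≤ r) {γ : ℝ}
    (hγ : ∀ i, α i < γ) (hm : γ + β < m) {S S' : Set (E d)} (hS : IsCompact S)
    (hSS : S ⊆ S') (hS' : IsCompact S')
    {η : TestFn d} (hη : tsupport η ⊆ Metric.closedBall 0 1)
    (hηm : ∀ i, IsMollifier (α i + β) η) :
    ∃ C : ℝ≥0, ∀ M : Model d I α rPi, Compatible K M → AnalyticBound α M.gam →
      gamNorm (fun i => α i + β) (polyHom d (γ + β)) S (hatBlock K M γ) ≤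
        C * ((piNorm M S' (2 * (1 + ρ)) + compatNorm K M S' 1) * gamNorm α α S M.gam) := by
  obtain ⟨C, hC, h⟩ := exists_gamNorm_hatBlock_le K hr hγ hm hS hη hηm
  obtain ⟨B, hB, hBd⟩ := exists_abs_distDeriv_le (α := α) K hr hη rPi
  -- Compatibility does not make [𝖪Π] finite, since it is measured at the order `rPi`. A positive
  -- constant makes the right-hand side infinite in that case when ‖Γ‖ ≠ 0.
  refine ⟨(C * (Fintype.card I + B) + 1).toNNReal, fun M hM hG => ?_⟩
  have hfin := analyticBound_iff.1 hG S hS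
  have hc0 : (0 : ℝ) < C * (Fintype.card I + B) + 1 := by positivity
  set g := gamNorm α α S M.gam
  set Z := piNorm M S' (2 * (1 + ρ)) + compatNorm K M S' 1 with hZ
  rcases eq_or_ne g 0 with hg | hg
  -- For ‖Γ‖ = 0 the right-hand side is 0 even if [𝖪Π] is infinite, so the qualitative finite bound
  -- Q is used in its place.
  · obtain ⟨Q, hQ, hcr⟩ := exists_critBound K hr hη hM hS
    have h' := h M Q hQ hcr hfin
    rw [show gamNorm α α S M.gam = 0 from hg] at h'
    rw [hg]
    simpa using h'
  rcases eq_or_ne Z ⊤ with hZt | hZt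
  · rw [hZt, ENNReal.top_mul hg, ENNReal.mul_top]
    · exact le_top
    · simpa using hc0
  · have hZ2 : compatNorm K M S' 1 ≠ ⊤ := fun h' => hZt (by rw [hZ, h', add_top])
    have hcr : CritBound K M η S (B * (compatNorm K M S' 1).toReal) := fun i k hk y hy t ht ht1 => by
      have hle := homNorm_le_compatNorm K M hSS i k hk
      refine (hBd M S i k (hle.trans_lt hZ2.lt_top) y hy t ht ht1).trans ?_
      gcongr
    refine (h M _ (by positivity) hcr hfin).trans ?_
    have e : ((C * (Fintype.card I + B) + 1).toNNReal : ℝ≥0∞) * (Z * g)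
        = ENNReal.ofReal ((C * (Fintype.card I + B) + 1) * (Z.toReal * g.toReal)) := by
      rw [ENNReal.ofReal_mul hc0.le, ENNReal.ofReal_mul ENNReal.toReal_nonneg,
        ENNReal.ofReal_toReal hZt, ENNReal.ofReal_toReal hfin.ne]
      rfl
    rw [e]
    refine ENNReal.ofReal_le_ofReal ?_
    rw [← mul_assoc]
    refine mul_le_mul_of_nonneg_right ?_ ENNReal.toReal_nonneg
    have h1 := piSum_le K M hSS hS'
    have h2 : Z.toReal = (piNorm M S' (2 * (1 + ρ))).toReal + (compatNorm K M S' 1).toReal :=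
      ENNReal.toReal_add (piNorm_lt_top K M hS').ne hZ2
    have h3 : 0 ≤ (piNorm M S' (2 * (1 + ρ))).toReal := ENNReal.toReal_nonneg
    have h4 : 0 ≤ (compatNorm K M S' 1).toReal := ENNReal.toReal_nonneg
    have h5 : piSum ρ M S + B * (compatNorm K M S' 1).toReal
        ≤ (Fintype.card I + B) * Z.toReal := by
      have : (0 : ℝ) ≤ Fintype.card I := Nat.cast_nonneg _
      rw [h2]
      nlinarith [mul_nonneg this h4, mul_nonneg hB h3]
    calc _ ≤ C * ((Fintype.card I + B) * Z.toReal) := by gcongr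
      _ ≤ _ := by
        have : 0 ≤ Z.toReal := ENNReal.toReal_nonneg
        nlinarith

theorem exists_common_mollifier {ι : Type*} {a : ι → ℝ} (d : ℕ) {γ : ℝ} (hγ : ∀ i, a i < γ)
    (β : ℝ) :
    ∃ η : TestFn d, tsupport η ⊆ Metric.closedBall 0 1 ∧ ∀ i, IsMollifier (a i + β) η := by
  obtain ⟨η, hη, h⟩ := exists_mollifier d ⌈γ + β⌉₊
  exact ⟨η, hη, fun i => h _ (by linarith [hγ i, Nat.le_ceil (γ + β)])⟩

theorem analyticBound_hatGam (K : RegKernel d β m r ρ) (hr : rPi ≤ r) {γ : ℝ}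
    (hγ : ∀ i, α i < γ) (hm : γ + β < m) {M : Model d I α rPi} (hM : Compatible K M)
    (hG : AnalyticBound α M.gam) : AnalyticBound (hatHom d α β γ) (hatGam K M γ) := by
  obtain ⟨η, hη, hηm⟩ := exists_common_mollifier d hγ β
  refine analyticBound_iff.2 fun S hS => (gamNorm_hatGam_le K M γ S).trans_lt ?_
  obtain ⟨C, -, h⟩ := exists_gamNorm_hatBlock_le K hr hγ hm hS hη hηm
  obtain ⟨Q, hQ, hcr⟩ := exists_critBound K hr hη hM hS
  have hfin := analyticBound_iff.1 hG S hS
  exact max_lt ((h M Q hQ hcr hfin).trans_lt ENNReal.ofReal_lt_top)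
    (max_lt ENNReal.one_lt_top hfin)

end Assembly

end

end GermSchauder

end

theorem proposition4p11 {d : ℕ} (hd : 1 ≤ d) {I : Type*} [Fintype I] (α : I → ℝ)
    (β γ ρ : ℝ) (m r rPi : ℕ) (K : GermSchauder.RegKernel d β m r ρ)
    (hγ : ∀ i, α i < γ) (hγβ : ∀ n : ℕ, γ + β ≠ n) (hm : γ + β < m) (hr : rPi ≤ r) :
    (∀ M : GermSchauder.Model d I α rPi, GermSchauder.Compatible K M →
      (GermSchauder.GroupProperty M.gam →
        GermSchauder.GroupProperty (GermSchauder.hatGam K M γ)) ∧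
      (GermSchauder.Triangular α M.gam →
        GermSchauder.Triangular (GermSchauder.hatHom d α β γ) (GermSchauder.hatGam K M γ)) ∧
      (GermSchauder.AnalyticBound α M.gam →
        GermSchauder.AnalyticBound (GermSchauder.hatHom d α β γ)
          (GermSchauder.hatGam K M γ))) ∧
    ∀ S : Set (GermSchauder.E d), IsCompact S → ∃ C : ℝ≥0,
      ∀ M : GermSchauder.Model d I α rPi, GermSchauder.Compatible K M →
        GermSchauder.AnalyticBound α M.gam →
        GermSchauder.gamNorm (fun i => α i + β) (GermSchauder.polyHom d (γ + β)) S
            (GermSchauder.hatBlock K M γ) ≤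
          C * ((GermSchauder.piNorm M (S + Metric.closedBall 0 2) (2 * (1 + ρ))
            + GermSchauder.compatNorm K M (S + Metric.closedBall 0 2) 1)
              * GermSchauder.gamNorm α α S M.gam) ∧
        GermSchauder.gamNorm (GermSchauder.hatHom d α β γ) (GermSchauder.hatHom d α β γ) S
            (GermSchauder.hatGam K M γ) ≤
          max (C * ((GermSchauder.piNorm M (S + Metric.closedBall 0 2) (2 * (1 + ρ))
            + GermSchauder.compatNorm K M (S + Metric.closedBall 0 2) 1)
              * GermSchauder.gamNorm α α S M.gam))
            (max 1 (GermSchauder.gamNorm α α S M.gam)) := by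
  refine ⟨fun M hM => ⟨GermSchauder.groupProperty_hatGam K M hγ,
    GermSchauder.triangular_hatGam K M γ, GermSchauder.analyticBound_hatGam K hr hγ hm hM⟩,
    fun S hS => ?_⟩
  obtain ⟨η, hη, hηm⟩ := GermSchauder.exists_common_mollifier d hγ β
  -- The estimates involve base points in S alone; the enlarged set enters by monotonicity of the
  -- norms.
  have hSS : S ⊆ S + Metric.closedBall 0 2 := fun x hx =>
    Set.mem_add.2 ⟨x, hx, 0, by simp, add_zero x⟩
  obtain ⟨C, hC⟩ := GermSchauder.exists_gamNorm_hatBlock_le_norms K hr hγ hm hS hSS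
    (hS.add (isCompact_closedBall 0 2)) hη hηm
  exact ⟨C, fun M hM hG => ⟨hC M hM hG, (GermSchauder.gamNorm_hatGam_le K M γ S).trans
    (max_le_max_right _ (hC M hM hG))⟩⟩
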